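/- **Setting.** Let $d\in(-\tfrac12,\tfrac12)\setminus\{0\}$. Let $\theta,\phi$ be real polynomials without common zeros such that $\theta(z)=\prod_{j=1}^q(1-z_j^{-1}z)$ with distinct non-zero $z_1,\dots,z_q\in\mathbb C$, $|z_j|\neq1$; $\phi(0)=1$ and $\phi$ has no zeros in the closed unit disk. Let $$f_0(\lambda)=\frac{\Gamma(2d+2)\cos(\pi d)}{2\pi}\,|1-e^{i\lambda}|^2\sum_{k\in\mathbb Z}|\lambda+2\pi k|^{-2d-2},\qquad f(\lambda)=\left|\frac{\theta(e^{i\lambda})}{\phi(e^{i\lambda})}\right|^2f_0(\lambda),\qquad \gamma(k)=\int_{-\pi}^{\pi}f(\lambda)e^{-ik\lambda}\,d\lambda ,$$ and $$Q(z)=\frac1{4\pi}(z^{-1}-2+z)\big(\mathrm{Li}_{-2d-1}(z)+\mathrm{Li}_{-2d-1}(z^{-1})\big),\quad z\in\mathbb C\setminus[0,\infty),$$ where $\mathrm{Li}_s$ is the holomorphic extension of $\sum_{k\ge1}k^{-s}z^k$ to $\mathbb C\setminus[1,\infty)$. Let $n\ge1$, let $g_n(1),\dots,g_n(n-1)$ solve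 $\sum_{k=1}^{n-1}g_n(k)\gamma(j-k)=\gamma(j)$, $1\le j\le n-1$ (with $g_n(k)=0$ for other $k$), and let $r(j)=\gamma(j)-\sum_{k=1}^{n-1}g_n(k)\gamma(j-k)$, $g^L_n(j)=r(j)\mathbf 1_{\{j\le0\}}$, $g^R_n(j)=r(j)\mathbf 1_{\{j\ge n\}}$, $G(z)=\sum_{k=1}^{n-1} g_n(k)z^k$. For $|z|>1$ put $G_0(z)=\sum_{j}g^L_n(j)z^j$ and $G_1(z)=\sum_jg^R_n(n-j)z^j$; for $|z|<1$, $z\notin[0,1]$, put $$G_0(z)=2\pi(1-G(z))\frac{\theta(z)\theta(z^{-1})}{\phi(z)\phi(z^{-1})}Q(z)-z^nG_1(z^{-1}),\qquad G_1(z)=2\pi(1-G(z^{-1}))z^n\frac{\theta(z)\theta(z^{-1})}{\phi(z)\phi(z^{-1})}Q(z)-z^nG_0(z^{-1}).$$ **Theorem 2.1.** The series converge for $|z|>1$, and the functions $\Phi_0(z)=z^q\phi(z^{-1})G_0(z)$, $\Phi_1(z)=z^q\phi(z^{-1})G_1(z)$ extend (through the unit circle and the removable singularities where $\phi(z^{-1})=0$)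 to sectionally holomorphic functions in $\mathbb C\setminus[0,1]$: they are holomorphic there and have finite limits $\Phi_i^\pm(t)$ at every $t\in(0,1)$ from the upper and the lower half-plane. Moreover: - **(H1)** For $t\in(0,1)$ the limits $Q^\pm(t)$ from the upper and the lower half-plane exist, $Q^-(t)\ne0$, and $$\Phi_0^+(t)-\frac{Q^+(t)}{Q^-(t)}\Phi_0^-(t)=t^{n+2q}\Phi_1(t^{-1})\frac{\phi(t^{-1})}{\phi(t)}\Big(\frac{Q^+(t)}{Q^-(t)}-1\Big),\qquad \Phi_1^+(t)-\frac{Q^+(t)}{Q^-(t)}\Phi_1^-(t)=t^{n+2q}\Phi_0(t^{-1})\frac{\phi(t^{-1})}{\phi(t)}\Big(\frac{Q^+(t)}{Q^-(t)}-1\Big).$$ - **(H2)** $\Phi_0(z),\Phi_1(z)$ are $O(z^q)$ as $z\to\infty$; as $z\to1$ they are $O((z-1)^{-2d})$ if $d>0$ and $O(1)$ if $d<0$; and, provided $\deg\phi\le n+q$, they are $O\big(z^{-1}(\log z^{-1})^{-1-2d}\big)$ as $z\to0$. - **(H3)** $\Phi_0(z)\phi(z)+z^{n+2q}\Phi_1(z^{-1})\phi(z^{-1})=0$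 for all $z\in Z=\{z_1,\dots,z_q\}\cup\{z_1^{-1},\dots,z_q^{-1}\}\cup Z_Q$, where $Z_Q$ is the set of zeros of $Q$ in $\mathbb C\setminus[0,\infty)$; at points $z\in Z\cap(0,\infty)$ this means that the limits of the left-hand side from the upper and from the lower half-plane are both $0$. - **(H4)** If $\deg\phi\le n+q$, then, as $z\to0$ in $\mathbb C\setminus[0,\infty)$, $$\lim_{z\to0}\frac{\Phi_0(z)}{Q(z)}=2\pi\prod_{j=1}^q(-z_j^{-1}),\qquad \lim_{z\to0}\frac{\Phi_1(z)}{Q(z)}=0 .$$ -/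

import Mathlib

open Filter Topology MeasureTheory Polynomial

noncomputable section

namespace FGN

/-- The polylogarithm `Li_s(z)` for real `s > -2`, on the slit plane `ℂ ∖ [1, ∞)`: the holomorphic
extension of the power series `∑_{k ≥ 1} k ^ (-s) z ^ k` given by the integral
`Γ(s+2)⁻¹ ∫_0^∞ t^{s+1} (∑_{k ≥ 1} k² (z e^{-t})^k) dt`, with the inner sum in closed form. -/
def polylog (s : ℝ) (z : ℂ) : ℂ :=
  ((Real.Gamma (s + 2) : ℝ) : ℂ)⁻¹ *
    ∫ t in Set.Ioi (0 : ℝ), ((t ^ (s + 1) : ℝ) : ℂ) *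
      (z * (Real.exp (-t) : ℂ) * (1 + z * (Real.exp (-t) : ℂ)) /
        (1 - z * (Real.exp (-t) : ℂ)) ^ 3)

/-- On the open unit disk the polylogarithm is the sum of its defining power series. -/
theorem polylog_hasSum {s : ℝ} (hs : -2 < s) {z : ℂ} (hz : ‖z‖ < 1) :
    HasSum (fun k : ℕ => (((k + 1 : ℝ) ^ (-s) : ℝ) : ℂ) * z ^ (k + 1)) (polylog s z) := by
  have hs' : 0 < ((s + 2 : ℝ) : ℂ).re := by simp; linarith
  have hG : ((Real.Gamma (s + 2) : ℝ) : ℂ) ≠ 0 := by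
    exact_mod_cast (Real.Gamma_pos_of_pos (by linarith)).ne'
  have key := hasSum_mellin (ι := ℕ) (a := fun k => ((k : ℂ) + 1) ^ 2 * z ^ (k + 1))
    (p := fun k => (k : ℝ) + 1)
    (F := fun t => z * (Real.exp (-t) : ℂ) * (1 + z * (Real.exp (-t) : ℂ)) /
        (1 - z * (Real.exp (-t) : ℂ)) ^ 3) (s := ((s + 2 : ℝ) : ℂ))
    (fun k => Or.inr (by positivity)) hs' ?_ ?_
  · have h2 := key.mul_left (((Real.Gamma (s + 2) : ℝ) : ℂ)⁻¹)
    convert! h2 using 1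
    · funext k
      have hk : (0 : ℝ) < (k : ℝ) + 1 := by positivity
      rw [Complex.Gamma_ofReal, ← Complex.ofReal_cpow hk.le]
      have e : ((k : ℝ) + 1) ^ (-s) = ((k : ℝ) + 1) ^ 2 / ((k : ℝ) + 1) ^ (s + 2) := by
        rw [← Real.rpow_natCast, ← Real.rpow_sub hk]
        congr 1
        push_cast
        ring
      rw [e]
      push_cast
      field_simp
    · rw [polylog, mellin]
      congr 1
      refine setIntegral_congr_fun measurableSet_Ioi (fun t ht => ?_)
      have e : ((s + 2 : ℝ) : ℂ) - 1 = ((s + 1 : ℝ) : ℂ) := by push_cast; ring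
      simp only [e, smul_eq_mul, ← Complex.ofReal_cpow (le_of_lt (Set.mem_Ioi.mp ht))]
  · intro t ht
    have hr : ‖z * (Real.exp (-t) : ℂ)‖ < 1 := by
      rw [norm_mul, Complex.norm_real, Real.norm_of_nonneg (Real.exp_pos _).le]
      have : Real.exp (-t) ≤ 1 := Real.exp_le_one_iff.mpr (by linarith [Set.mem_Ioi.mp ht])
      nlinarith [norm_nonneg z, Real.exp_pos (-t)]
    set r : ℂ := z * (Real.exp (-t) : ℂ) with hrdef
    have h1 : (1 : ℂ) - r ≠ 0 := by
      intro h
      rw [sub_eq_zero] at h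
      rw [← h] at hr
      simp at hr
    have hA := (((hasSum_choose_mul_geometric_of_norm_lt_one 2 hr).mul_left 2).sub
      (hasSum_choose_mul_geometric_of_norm_lt_one 1 hr)).mul_left r
    convert! hA using 1
    · funext k
      have c2 : (((k + 2).choose 2 : ℕ) : ℂ) = ((k : ℂ) + 2) * ((k : ℂ) + 1) / 2 := by
        rw [Nat.cast_choose_two]
        push_cast
        ring
      have e : ((Real.exp (-((k : ℝ) + 1) * t) : ℝ) : ℂ) = (Real.exp (-t) : ℂ) ^ (k + 1) := by
        rw [← Complex.ofReal_pow, ← Real.exp_nat_mul]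
        congr 2
        push_cast
        ring
      rw [e, c2, Nat.choose_one_right, mul_assoc, ← mul_pow, ← hrdef]
      push_cast
      ring
    · field_simp
      ring
  · have hsum : Summable (fun k : ℕ => ((k : ℝ) ^ 2 * ‖z‖ ^ k)) :=
      summable_pow_mul_geometric_of_norm_lt_one 2 (by simpa using hz)
    refine Summable.of_nonneg_of_le (fun k => by positivity) (fun k => ?_)
      ((summable_nat_add_iff 1).mpr hsum)
    have h1 : (1 : ℝ) ≤ ((k : ℝ) + 1) ^ ((s + 2 : ℝ) : ℂ).re :=
      Real.one_le_rpow (by linarith [(Nat.cast_nonneg k : (0 : ℝ) ≤ k)]) hs'.le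
    have e : ‖((k : ℂ) + 1) ^ 2 * z ^ (k + 1)‖ = ((k + 1 : ℕ) : ℝ) ^ 2 * ‖z‖ ^ (k + 1) := by
      have : ((k : ℂ) + 1) = ((k + 1 : ℕ) : ℂ) := by push_cast; ring
      rw [this, norm_mul, norm_pow, norm_pow, Complex.norm_natCast]
    rw [e]
    exact div_le_self (by positivity) h1

/-- The sectionally holomorphic extension of the fGn spectral density, used off `[0, ∞)` only. -/
def Q (d : ℝ) (z : ℂ) : ℂ :=
  1 / (4 * (Real.pi : ℂ)) * (z⁻¹ - 2 + z) *
    (polylog (-2 * d - 1) z + polylog (-2 * d - 1) z⁻¹)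

/-- The spectral density of the fractional Gaussian noise with Hurst exponent `d + 1/2`. -/
def f0 (d : ℝ) (l : ℝ) : ℝ :=
  (1 / (2 * Real.pi) * Real.Gamma (2 * d + 2) * Real.cos (Real.pi * d)) *
    ‖1 - Complex.exp (Complex.I * l)‖ ^ 2 *
    ∑' k : ℤ, |l + 2 * Real.pi * k| ^ (-2 * d - 2)

/-- The spectral density of the ARIMA type process with MA polynomial `θ` and AR polynomial `φ`,
driven by the fractional Gaussian noise. -/
def specDensity (d : ℝ) (θ φ : ℝ[X]) (l : ℝ) : ℝ :=
  ‖aeval (Complex.exp (Complex.I * l)) θ / aeval (Complex.exp (Complex.I * l)) φ‖ ^ 2 * f0 d l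

/-- The covariance sequence with this (even) spectral density `f`:
`γ(k) = ∫_{-π}^{π} f(λ) e^{-ikλ} dλ = ∫_{-π}^{π} f(λ) cos(kλ) dλ`. -/
def cov (d : ℝ) (θ φ : ℝ[X]) (k : ℤ) : ℝ :=
  ∫ l in (-Real.pi)..Real.pi, Real.cos (k * l) * specDensity d θ φ l

/-- `g` is the sequence of weights of the predictor based on `n - 1` observations of a process with
covariance `γ`, extended by zero outside `{1, …, n - 1}`. -/
structure IsPredictor (γ : ℤ → ℝ) (n : ℕ) (g : ℤ → ℝ) : Prop where
  zero_off : ∀ k : ℤ, k ∉ Finset.Icc (1 : ℤ) (n - 1) → g k = 0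
  eqn : ∀ j ∈ Finset.Icc (1 : ℤ) (n - 1), ∑ k ∈ Finset.Icc (1 : ℤ) (n - 1), g k * γ (j - k) = γ j

/-- The residual sequence supported on `j ≤ 0`. -/
def gL (γ : ℤ → ℝ) (n : ℕ) (g : ℤ → ℝ) (j : ℤ) : ℝ :=
  if j ≤ 0 then γ j - ∑ k ∈ Finset.Icc (1 : ℤ) (n - 1), g k * γ (j - k) else 0

/-- The residual sequence supported on `j ≥ n`. -/
def gR (γ : ℤ → ℝ) (n : ℕ) (g : ℤ → ℝ) (j : ℤ) : ℝ :=
  if (n : ℤ) ≤ j then γ j - ∑ k ∈ Finset.Icc (1 : ℤ) (n - 1), g k * γ (j - k) else 0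

/-- The generating polynomial of the predictor weights. -/
def G (n : ℕ) (g : ℤ → ℝ) (z : ℂ) : ℂ :=
  ∑ k ∈ Finset.Icc (1 : ℤ) (n - 1), (g k : ℂ) * z ^ k

/-- `∑_j g^L(j) z^j`, for `|z| > 1`. -/
def G0ext (γ : ℤ → ℝ) (n : ℕ) (g : ℤ → ℝ) (z : ℂ) : ℂ := ∑' j : ℤ, (gL γ n g j : ℂ) * z ^ j

/-- `∑_j g^R(n - j) z^j`, for `|z| > 1`. -/
def G1ext (γ : ℤ → ℝ) (n : ℕ) (g : ℤ → ℝ) (z : ℂ) : ℂ :=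
  ∑' j : ℤ, (gR γ n g (n - j) : ℂ) * z ^ j

/-- The factor `θ(z) θ(z⁻¹) / (φ(z) φ(z⁻¹))`. -/
def ratio (θ φ : ℝ[X]) (z : ℂ) : ℂ :=
  (aeval z θ * aeval z⁻¹ θ) / (aeval z φ * aeval z⁻¹ φ)

/-- The function `G₀`: the generating function of `g^L` for `|z| > 1`, and its extension to the
slit unit disk for `|z| < 1` (off the poles, that is where `φ(z⁻¹) ≠ 0`). -/
def G0 (d : ℝ) (θ φ : ℝ[X]) (n : ℕ) (g : ℤ → ℝ) (z : ℂ) : ℂ :=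
  if 1 < ‖z‖ then G0ext (cov d θ φ) n g z
  else 2 * Real.pi * (1 - G n g z) * ratio θ φ z * Q d z - z ^ n * G1ext (cov d θ φ) n g z⁻¹

/-- The function `G₁`: the generating function of `g^R(n - ·)` for `|z| > 1`, and its extension to
the slit unit disk for `|z| < 1` (off the poles, that is where `φ(z⁻¹) ≠ 0`). -/
def G1 (d : ℝ) (θ φ : ℝ[X]) (n : ℕ) (g : ℤ → ℝ) (z : ℂ) : ℂ :=
  if 1 < ‖z‖ then G1ext (cov d θ φ) n g z
  else 2 * Real.pi * (1 - G n g z⁻¹) * z ^ n * ratio θ φ z * Q d z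
    - z ^ n * G0ext (cov d θ φ) n g z⁻¹

/-- The segment `[0, 1]` in the complex plane. -/
def unitCut : Set ℂ := (fun t : ℝ => (t : ℂ)) '' Set.Icc 0 1

/-- The closed half-line `[0, ∞)` in the complex plane. -/
def halfLine : Set ℂ := (fun t : ℝ => (t : ℂ)) '' Set.Ici 0

/-- `z → t⁺`: approach to the real point `t` through the open upper half-plane. -/
def fromAbove (t : ℝ) : Filter ℂ := 𝓝[{w : ℂ | 0 < w.im}] (t : ℂ)

/-- `z → t⁻`: approach to the real point `t` through the open lower half-plane. -/
def fromBelow (t : ℝ) : Filter ℂ := 𝓝[{w : ℂ | w.im < 0}] (t : ℂ)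

/-- Sectionally holomorphic in `ℂ ∖ [0, 1]`: holomorphic there, with finite limits from both sides
at every interior point of the segment. -/
structure SectionallyHolomorphic (F : ℂ → ℂ) : Prop where
  holo : DifferentiableOn ℂ F unitCutᶜ
  above : ∀ t ∈ Set.Ioo (0 : ℝ) 1, ∃ a : ℂ, Tendsto F (fromAbove t) (𝓝 a)
  below : ∀ t ∈ Set.Ioo (0 : ℝ) 1, ∃ a : ℂ, Tendsto F (fromBelow t) (𝓝 a)

/-- The boundary condition on `(0, 1)`: the boundary values of `Φ₀`, `Φ₁` and `Q` exist, `Q⁻(t)`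
is non-zero, and the two coupled jump relations hold. -/
def JumpCondition (d : ℝ) (φ : ℝ[X]) (n q : ℕ) (Φ₀ Φ₁ : ℂ → ℂ) : Prop :=
  ∀ t ∈ Set.Ioo (0 : ℝ) 1, ∃ Φ₀p Φ₀m Φ₁p Φ₁m Qp Qm : ℂ,
    Tendsto Φ₀ (fromAbove t) (𝓝 Φ₀p) ∧ Tendsto Φ₀ (fromBelow t) (𝓝 Φ₀m) ∧
    Tendsto Φ₁ (fromAbove t) (𝓝 Φ₁p) ∧ Tendsto Φ₁ (fromBelow t) (𝓝 Φ₁m) ∧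
    Tendsto (Q d) (fromAbove t) (𝓝 Qp) ∧ Tendsto (Q d) (fromBelow t) (𝓝 Qm) ∧ Qm ≠ 0 ∧
    Φ₀p - Qp / Qm * Φ₀m =
      (t : ℂ) ^ (n + 2 * q) * Φ₁ (t : ℂ)⁻¹ * (aeval (t : ℂ)⁻¹ φ / aeval (t : ℂ) φ) *
        (Qp / Qm - 1) ∧
    Φ₁p - Qp / Qm * Φ₁m =
      (t : ℂ) ^ (n + 2 * q) * Φ₀ (t : ℂ)⁻¹ * (aeval (t : ℂ)⁻¹ φ / aeval (t : ℂ) φ) *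
        (Qp / Qm - 1)

/-- The growth estimate `O(z⁻¹ (log z⁻¹)^{-1-2d})` at `0`. -/
def GrowthAtZero (d : ℝ) (Φ : ℂ → ℂ) : Prop :=
  Φ =O[𝓝[unitCutᶜ] 0] fun z : ℂ => ‖z‖⁻¹ * ‖Complex.log z⁻¹‖ ^ (-1 - 2 * d)

/-- The growth estimate at `1`: `O((z - 1)^{-2d})` for `d > 0` and `O(1)` for `d < 0`. -/
def GrowthAtOne (d : ℝ) (Φ : ℂ → ℂ) : Prop :=
  Φ =O[𝓝[unitCutᶜ] 1] fun z : ℂ => ‖z - 1‖ ^ (-2 * max d 0)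

/-- The growth estimate `O(z^q)` at infinity. -/
def GrowthAtInfinity (q : ℕ) (Φ : ℂ → ℂ) : Prop :=
  Φ =O[Bornology.cobounded ℂ] fun z : ℂ => z ^ q

/-- The set `Z`: the zeros of `θ`, their reciprocals, and the zeros of `Q` in `ℂ ∖ [0, ∞)`. -/
def zeroSet (d : ℝ) {q : ℕ} (z : Fin q → ℂ) : Set ℂ :=
  Set.range z ∪ Set.range (fun j => (z j)⁻¹) ∪ {w : ℂ | w ∉ halfLine ∧ Q d w = 0}

/-- The expression `Φ₀(w) φ(w) + w^{n+2q} Φ₁(w⁻¹) φ(w⁻¹)`. -/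
def algExpr (φ : ℝ[X]) (n q : ℕ) (Φ₀ Φ₁ : ℂ → ℂ) (w : ℂ) : ℂ :=
  Φ₀ w * aeval w φ + w ^ (n + 2 * q) * Φ₁ w⁻¹ * aeval w⁻¹ φ

/-- The algebraic condition. At a point of `Z` on the positive half-line, `w` or `w⁻¹` lies on the
cut, and the condition is imposed on both one-sided boundary values. -/
def AlgebraicCondition (d : ℝ) (φ : ℝ[X]) (n : ℕ) {q : ℕ} (z : Fin q → ℂ) (Φ₀ Φ₁ : ℂ → ℂ) : Prop :=
  (∀ w ∈ zeroSet d z, w ∉ halfLine → algExpr φ n q Φ₀ Φ₁ w = 0) ∧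
  (∀ t : ℝ, 0 < t → (t : ℂ) ∈ zeroSet d z →
    Tendsto (algExpr φ n q Φ₀ Φ₁) (fromAbove t) (𝓝 0) ∧
    Tendsto (algExpr φ n q Φ₀ Φ₁) (fromBelow t) (𝓝 0))

/-- The scaling condition at `0`. -/
def ScalingCondition (d : ℝ) {q : ℕ} (z : Fin q → ℂ) (Φ₀ Φ₁ : ℂ → ℂ) : Prop :=
  Tendsto (fun w => Φ₀ w / Q d w) (𝓝[halfLineᶜ] 0) (𝓝 (2 * Real.pi * ∏ j, (-(z j)⁻¹))) ∧
  Tendsto (fun w => Φ₁ w / Q d w) (𝓝[halfLineᶜ] 0) (𝓝 0)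

end FGN

end

namespace FGN

/-! Put `a = 2d + 2`, so that `1 < a < 3` and `Q` is built from `Li_{1-a}(z)` and `Li_{1-a}(z⁻¹)`.

The analytic input is Lipschitz' formula `polylog_exp_neg`: `Li_{1-a}(e^{-l}) = Γ(a) ∑_k (l +
2πik)^{-a}`, valid in the strip `|Im l| < 3π/2` off the negative axis. All branching sits in the
central term `l^{-a}`; the rest, `lipRem`, is holomorphic in the whole strip. Substituting `l = ∓iλ`
identifies `Q` on the unit circle with `f₀` (`Q_exp_eq_f0`). Letting `l → 0` gives the singularity
at `1`, and letting `Re l → -∞` gives `w Q(w) ~ c (-log |w|)^{-(2d+1)}` with `c ≠ 0` at the origin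
(`exists_tendsto_mul_Q`). The two determinations of `l^{-a}` on the negative axis give `Q^±` and
`Q^- ≠ 0` (`exists_tendsto_Q`).

The link with the prediction problem is that `r(j)` is the Fourier coefficient of `(1 - G) f`. By
the normal equations `r` vanishes on `1, …, n - 1`, so the Cauchy transform of `(1 - G) f` is, up to
`r(0)`, `-S₀(w⁻¹)` outside the disk and `w^n S₁(w)` inside, with `S₀`, `S₁` the generating functions
of the two residual sequences. On the circle `φ(u) φ(u⁻¹) (1 - G) f = θ(u) θ(u⁻¹) (1 - G) f₀`.
Multiplying a density by a Laurent polynomial changes its Cauchy transform by the same factor and an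
error holomorphic off `0` (`IsMultiplier`), and the Cauchy transform of `f₀` is explicit: it
involves `Li(w)` inside and `Li(w⁻¹)` outside. With `K = θ(w) θ(w⁻¹) (1 - G(w))`, this gives two
functional equations sharing one function `V` holomorphic off `0` (`exists_functional_equations`).

Everything else follows from these equations (`IsContinuation`). The outer one continues `w^q φ(w⁻¹)
S₀(w⁻¹)` to the complement of `[0, 1]`, because `Li(w⁻¹)` is holomorphic there and `φ` has no zero
in the closed disk. Adding the two equations cancels `V` and turns the polylogarithms into `Q`. This
gives the formula for `G₀` in the disk, the jump relations (only `Q` jumps across the cut), and the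
identity saying that the expression in (H3) equals `2π w^q K(w) Q(w)`. Near `0`, the term carrying
`S₁` is bounded when `deg φ ≤ n + q` while `Q` is unbounded, which gives (H4) and the growth at `0`.
The substitution `w ↦ w⁻¹` exchanges the roles of `S₀` and `S₁` (`IsContinuation.reflect`), so each
statement is proved only for `Φ₀`. -/

/-! ### The polylogarithm: symmetry and holomorphy -/

theorem polylog_conj (s : ℝ) (z : ℂ) :
    polylog s (starRingEnd ℂ z) = starRingEnd ℂ (polylog s z) := by
  unfold polylog
  rw [map_mul, map_inv₀, Complex.conj_ofReal, ← integral_conj]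
  congr 1
  refine integral_congr_ae (ae_of_all _ fun t => ?_)
  simp [Complex.conj_ofReal, ← Complex.exp_conj]

/-- Differentiation under the integral sign. Since `z` avoids `[1, ∞)`, the denominators `1 - w v`
with `v = e^{-t} ∈ [0, 1]` stay away from zero uniformly for `w` near `z`, and what remains is
dominated by the Gamma integrand `e^{-t} t^{s+1}`. -/
theorem differentiableAt_polylog {s : ℝ} (hs : -2 < s) {z : ℂ} (hz : 1 - z ∈ Complex.slitPlane) :
    DifferentiableAt ℂ (polylog s) z := by
  have hne : ∀ v ∈ Set.Icc (0 : ℝ) 1, 1 - z * (v : ℂ) ≠ 0 := by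
    intro v hv h0
    rw [Complex.mem_slitPlane_iff] at hz
    have h1 := congrArg Complex.re h0
    have h2 := congrArg Complex.im h0
    simp at h1 h2 hz
    rcases h2 with h2 | h2
    · rcases hz with h3 | h3
      · have hv0 : v ≠ 0 := by
          rintro rfl
          simp at h1
        have := mul_pos (sub_pos.2 h3) (lt_of_le_of_ne hv.1 hv0.symm)
        nlinarith [hv.1, hv.2]
      · exact h3 h2
    · simp [h2] at h1
  obtain ⟨ε, hε, δ, hδ, hb⟩ : ∃ ε > 0, ∃ δ > 0, ∀ w ∈ Metric.closedBall z ε,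
      ∀ v ∈ Set.Icc (0 : ℝ) 1, δ ≤ ‖1 - w * (v : ℂ)‖ := by
    have hc : Continuous fun v : ℝ => ‖1 - z * (v : ℂ)‖ := by fun_prop
    obtain ⟨v0, hv0, hmin⟩ := isCompact_Icc.exists_isMinOn (Set.nonempty_Icc.2 zero_le_one)
      hc.continuousOn (s := Set.Icc (0 : ℝ) 1)
    have hpos : 0 < ‖1 - z * (v0 : ℂ)‖ := norm_pos_iff.2 (hne v0 hv0)
    refine ⟨‖1 - z * (v0 : ℂ)‖ / 2, by positivity, ‖1 - z * (v0 : ℂ)‖ / 2, by positivity, ?_⟩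
    intro w hw v hv
    have h1 : ‖1 - z * (v0 : ℂ)‖ ≤ ‖1 - z * (v : ℂ)‖ := hmin hv
    have h2 : ‖1 - z * (v : ℂ)‖ ≤ ‖1 - w * (v : ℂ)‖ + ‖(w - z) * (v : ℂ)‖ := by
      refine le_trans (le_of_eq ?_) (norm_add_le _ _)
      congr 1; ring
    have h3 : ‖(w - z) * (v : ℂ)‖ ≤ ‖1 - z * (v0 : ℂ)‖ / 2 := by
      rw [norm_mul, Complex.norm_real, Real.norm_of_nonneg hv.1]
      have := mem_closedBall_iff_norm.1 hw
      nlinarith [hv.1, hv.2, norm_nonneg (w - z)]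
    linarith
  unfold polylog
  refine DifferentiableAt.const_mul ?_ _
  set K : ℝ := ‖z‖ + ε
  have hK : 0 ≤ K := by positivity
  have hexp : ∀ t ∈ Set.Ioi (0 : ℝ), Real.exp (-t) ∈ Set.Icc (0 : ℝ) 1 := fun t ht =>
    ⟨(Real.exp_pos _).le, Real.exp_le_one_iff.mpr (by linarith [Set.mem_Ioi.mp ht])⟩
  have hwK : ∀ w ∈ Metric.closedBall z ε, ‖w‖ ≤ K := by
    intro w hw
    have := mem_closedBall_iff_norm.1 hw
    have h2 : ‖w‖ ≤ ‖z‖ + ‖w - z‖ := by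
      refine le_trans (le_of_eq ?_) (norm_add_le _ _)
      congr 1; ring
    linarith
  have hgam : IntegrableOn (fun t : ℝ => Real.exp (-t) * t ^ (s + 1)) (Set.Ioi 0) := by
    have := Real.GammaIntegral_convergent (s := s + 2) (by linarith)
    convert! this using 3
    ring_nf
  have hmeasF : ∀ w : ℂ, AEStronglyMeasurable (fun t : ℝ => ((t ^ (s + 1) : ℝ) : ℂ) *
      (w * (Real.exp (-t) : ℂ) * (1 + w * (Real.exp (-t) : ℂ)) /
        (1 - w * (Real.exp (-t) : ℂ)) ^ 3)) (volume.restrict (Set.Ioi 0)) := by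
    intro w
    apply Measurable.aestronglyMeasurable
    fun_prop
  have hexpn : ∀ t : ℝ, ‖(Real.exp (-t) : ℂ)‖ = Real.exp (-t) := fun t => by
    rw [Complex.norm_real, Real.norm_of_nonneg (Real.exp_pos _).le]
  have key := hasDerivAt_integral_of_dominated_loc_of_deriv_le (μ := volume.restrict (Set.Ioi 0))
    (F := fun (w : ℂ) (t : ℝ) => ((t ^ (s + 1) : ℝ) : ℂ) *
      (w * (Real.exp (-t) : ℂ) * (1 + w * (Real.exp (-t) : ℂ)) /
        (1 - w * (Real.exp (-t) : ℂ)) ^ 3))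
    (F' := fun (w : ℂ) (t : ℝ) => ((t ^ (s + 1) : ℝ) : ℂ) *
      ((Real.exp (-t) : ℂ) * (1 + 4 * (w * (Real.exp (-t) : ℂ)) + (w * (Real.exp (-t) : ℂ)) ^ 2) /
        (1 - w * (Real.exp (-t) : ℂ)) ^ 4))
    (x₀ := z) (s := Metric.closedBall z ε)
    (bound := fun t => (1 + 4 * K + K ^ 2) / δ ^ 4 * (Real.exp (-t) * t ^ (s + 1)))
    (Metric.closedBall_mem_nhds z hε) (Filter.Eventually.of_forall hmeasF) ?_ ?_ ?_ ?_ ?_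
  · exact key.2.differentiableAt
  · refine Integrable.mono' (hgam.const_mul (K * (1 + K) / δ ^ 3)) (hmeasF z) ?_
    filter_upwards [ae_restrict_mem measurableSet_Ioi] with t ht
    have hz0 := Metric.mem_closedBall_self (x := z) hε.le
    have hd := hb z hz0 _ (hexp t ht)
    rw [norm_mul, Complex.norm_real, Real.norm_of_nonneg (Real.rpow_nonneg (le_of_lt ht) _),
      norm_div, norm_mul, norm_mul, norm_pow, hexpn]
    have h1 : ‖1 + z * (Real.exp (-t) : ℂ)‖ ≤ 1 + K := by
      refine (norm_add_le _ _).trans ?_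
      rw [norm_mul, hexpn, norm_one]
      nlinarith [(hexp t ht).1, (hexp t ht).2, hwK z hz0, norm_nonneg z]
    have h2 : δ ^ 3 ≤ ‖1 - z * (Real.exp (-t) : ℂ)‖ ^ 3 := by gcongr
    calc _ ≤ t ^ (s + 1) * (K * Real.exp (-t) * (1 + K) / δ ^ 3) := by
          have := (Real.exp_pos (-t)).le
          have := Real.rpow_nonneg (le_of_lt ht) (s + 1)
          gcongr
          exact hwK z hz0
      _ = _ := by ring
  · apply Measurable.aestronglyMeasurable
    fun_prop
  · filter_upwards [ae_restrict_mem measurableSet_Ioi] with t ht w hw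
    have hd := hb w hw _ (hexp t ht)
    rw [norm_mul, Complex.norm_real, Real.norm_of_nonneg (Real.rpow_nonneg (le_of_lt ht) _),
      norm_div, norm_mul, norm_pow, hexpn]
    have h0 : ‖w * (Real.exp (-t) : ℂ)‖ ≤ K := by
      rw [norm_mul, hexpn]
      nlinarith [(hexp t ht).1, (hexp t ht).2, hwK w hw, norm_nonneg w]
    have h1 : ‖1 + 4 * (w * (Real.exp (-t) : ℂ)) + (w * (Real.exp (-t) : ℂ)) ^ 2‖
        ≤ 1 + 4 * K + K ^ 2 := by
      refine (norm_add_le _ _).trans (add_le_add ((norm_add_le _ _).trans ?_) ?_)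
      · rw [norm_mul 4, norm_one]
        simpa using h0
      · rw [norm_pow]
        gcongr
    calc _ ≤ t ^ (s + 1) * (Real.exp (-t) * (1 + 4 * K + K ^ 2) / δ ^ 4) := by
          have := (Real.exp_pos (-t)).le
          have := Real.rpow_nonneg (le_of_lt ht) (s + 1)
          gcongr
      _ = _ := by ring
  · exact hgam.const_mul _
  · filter_upwards [ae_restrict_mem measurableSet_Ioi] with t ht w hw
    have hd : 1 - w * (Real.exp (-t) : ℂ) ≠ 0 := by
      rw [← norm_pos_iff]
      exact hδ.trans_le (hb w hw _ (hexp t ht))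
    generalize (Real.exp (-t) : ℂ) = v at hd
    refine HasDerivAt.const_mul _ ?_
    have h1 : HasDerivAt (fun w : ℂ => w * v) v w := by simpa using (hasDerivAt_id w).mul_const v
    have h2 := (h1.mul (h1.const_add 1)).div ((h1.const_sub 1).pow 3) (pow_ne_zero 3 hd)
    refine h2.congr_deriv ?_
    simp only [Pi.mul_apply, Pi.pow_apply]
    rw [div_eq_div_iff (pow_ne_zero 2 (pow_ne_zero 3 hd)) (pow_ne_zero 4 hd)]
    push_cast
    ring

/-! ### Lipschitz' formula -/

/-- Both sides are holomorphic in the right half-plane and agree for real `r`, where this is the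
Gamma integral; the identity theorem does the rest. It computes the Fourier transform needed for
Poisson summation. -/
theorem integral_rpow_mul_cexp_neg_mul_Ioi {a : ℝ} (ha : 0 < a) {r : ℂ} (hr : 0 < r.re) :
    ∫ t in Set.Ioi (0 : ℝ), ((t ^ (a - 1) : ℝ) : ℂ) * Complex.exp (-(r * t)) =
      (Real.Gamma a : ℂ) * r ^ (-a : ℂ) := by
  have hint : ∀ b c : ℝ, 0 < b → 0 < c →
      IntegrableOn (fun t : ℝ => t ^ (b - 1) * Real.exp (-(c * t))) (Set.Ioi 0) := by
    intro b c hb hc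
    have h := integrableOn_rpow_mul_exp_neg_mul_rpow (p := 1) (s := b - 1) (b := c)
      (by linarith) one_pos hc
    simpa using h
  have hnorm : ∀ (t : ℝ) (w : ℂ), ‖Complex.exp (-(w * t))‖ = Real.exp (-(w.re * t)) := by
    intro t w
    rw [Complex.norm_exp]
    simp
  have hmeas : ∀ (b : ℝ) (w : ℂ), AEStronglyMeasurable
      (fun t : ℝ => ((t ^ b : ℝ) : ℂ) * Complex.exp (-(w * t))) (volume.restrict (Set.Ioi 0)) := by
    intro b w
    apply Measurable.aestronglyMeasurable
    fun_prop
  have hopen : IsOpen {w : ℂ | 0 < w.re} := isOpen_lt continuous_const Complex.continuous_re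
  have hd : DifferentiableOn ℂ (fun w : ℂ => ∫ t in Set.Ioi (0 : ℝ),
      ((t ^ (a - 1) : ℝ) : ℂ) * Complex.exp (-(w * t))) {w : ℂ | 0 < w.re} := by
    intro w hw
    have hw : 0 < w.re := hw
    have key := hasDerivAt_integral_of_dominated_loc_of_deriv_le
      (μ := volume.restrict (Set.Ioi 0)) (x₀ := w)
      (F := fun (w : ℂ) (t : ℝ) => ((t ^ (a - 1) : ℝ) : ℂ) * Complex.exp (-(w * t)))
      (F' := fun (w : ℂ) (t : ℝ) => ((t ^ (a - 1) : ℝ) : ℂ) * (Complex.exp (-(w * t)) * -t))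
      -- Halving the real part gives a neighbourhood of `w` with a uniform exponential bound. The
      -- derivative brings down a factor `t`, so the dominating function is the integrand for `a +
      -- 1`.
      (s := {v : ℂ | w.re / 2 < v.re})
      (bound := fun t => t ^ (a + 1 - 1) * Real.exp (-(w.re / 2 * t)))
      ((isOpen_lt continuous_const Complex.continuous_re).mem_nhds (by simp; linarith))
      (Eventually.of_forall fun v => hmeas _ v) ?_ ?_ ?_ (hint _ _ (by linarith) (by linarith)) ?_
    · exact key.2.differentiableAt.differentiableWithinAt
    · refine Integrable.mono' (hint a w.re ha hw) (hmeas _ w) ?_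
      filter_upwards [ae_restrict_mem measurableSet_Ioi] with t ht
      rw [norm_mul, hnorm, Complex.norm_real, Real.norm_of_nonneg (Real.rpow_nonneg (le_of_lt ht) _)]
    · apply Measurable.aestronglyMeasurable
      fun_prop
    · filter_upwards [ae_restrict_mem measurableSet_Ioi] with t ht v hv
      have ht : 0 < t := ht
      have hv : w.re / 2 < v.re := hv
      rw [norm_mul, norm_mul, hnorm, norm_neg, Complex.norm_real, Complex.norm_real,
        Real.norm_of_nonneg (Real.rpow_nonneg ht.le _), Real.norm_of_nonneg ht.le]
      have e : t ^ (a + 1 - 1) = t ^ (a - 1) * t := by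
        rw [← Real.rpow_add_one ht.ne']
        congr 1; ring
      rw [e, mul_comm (Real.exp _) t, mul_assoc]
      gcongr
    · filter_upwards with t v hv
      refine HasDerivAt.const_mul _ ?_
      have h1 : HasDerivAt (fun w : ℂ => -(w * (t : ℂ))) (-t : ℂ) v :=
        ((hasDerivAt_id v).mul_const (t : ℂ)).fun_neg.congr_deriv (by simp)
      exact h1.cexp
  have hd2 : DifferentiableOn ℂ (fun w : ℂ => (Real.Gamma a : ℂ) * w ^ (-a : ℂ))
      {w : ℂ | 0 < w.re} := by
    intro w hw
    refine DifferentiableWithinAt.const_mul ?_ _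
    exact (differentiableAt_id.cpow_const (Or.inl hw)).differentiableWithinAt
  have hconv : IsPreconnected {w : ℂ | 0 < w.re} :=
    (convex_halfSpace_re_gt 0).isPreconnected
  refine AnalyticOnNhd.eqOn_of_preconnected_of_frequently_eq (z₀ := 1)
    (hd.analyticOnNhd hopen) (hd2.analyticOnNhd hopen) hconv (by simp) ?_ hr
  have hreal : ∀ x : ℝ, 0 < x → (∫ t in Set.Ioi (0 : ℝ),
      ((t ^ (a - 1) : ℝ) : ℂ) * Complex.exp (-((x : ℂ) * t))) =
      (Real.Gamma a : ℂ) * (x : ℂ) ^ (-a : ℂ) := by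
    intro x hx
    have h := Real.integral_rpow_mul_exp_neg_mul_Ioi ha hx
    have h2 := congrArg (fun y : ℝ => (y : ℂ)) h
    simp only [← integral_complex_ofReal] at h2
    push_cast at h2 ⊢
    rw [h2, mul_comm, ← Complex.ofReal_neg, ← Complex.ofReal_cpow hx.le, Real.rpow_neg hx.le,
      one_div, Real.inv_rpow hx.le]
  have htend : Tendsto (fun x : ℝ => (x : ℂ)) (𝓝[≠] 1) (𝓝[≠] 1) := by
    refine tendsto_nhdsWithin_iff.2 ⟨?_, ?_⟩
    · exact (Complex.continuous_ofReal.tendsto' 1 1 (by simp)).mono_left nhdsWithin_le_nhds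
    · filter_upwards [self_mem_nhdsWithin] with x hx
      simpa using hx
  refine htend.frequently (Eventually.frequently ?_)
  filter_upwards [nhdsWithin_le_nhds (lt_mem_nhds (zero_lt_one' ℝ))] with x hx
  exact hreal x hx

/-- For `k ≠ 0` the imaginary part is at least `2π|k| - 3π/2 ≥ (π/2)|k|`. The half-width `3π/2`
leaves this room below `2π` while making the open strip contain all values `|Im| ≤ π` of the
principal logarithm. -/
theorem norm_add_two_pi_mul_I_ge {l : ℂ} (hl : |l.im| < 3 * Real.pi / 2) {k : ℤ} (hk : k ≠ 0) :
    |(k : ℝ)| ≤ ‖l + 2 * Real.pi * Complex.I * k‖ := by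
  have h1 : |(l + 2 * Real.pi * Complex.I * k).im| ≤ ‖l + 2 * Real.pi * Complex.I * k‖ :=
    Complex.abs_im_le_norm _
  have h2 : (l + 2 * Real.pi * Complex.I * k).im = l.im + 2 * Real.pi * k := by simp
  rw [h2] at h1
  have hk1 : (1 : ℝ) ≤ |(k : ℝ)| := by
    have := Int.one_le_abs hk
    exact_mod_cast this
  have h3 : 2 * Real.pi * |(k : ℝ)| - |l.im| ≤ |l.im + 2 * Real.pi * k| := by
    have e : 2 * Real.pi * |(k : ℝ)| = |2 * Real.pi * k| := by
      rw [abs_mul, abs_of_pos Real.two_pi_pos]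
    rw [e]
    have h4 := abs_sub_abs_le_abs_sub (2 * Real.pi * (k : ℝ)) (-l.im)
    rw [abs_neg, sub_neg_eq_add, add_comm (2 * Real.pi * (k : ℝ))] at h4
    exact h4
  nlinarith [Real.pi_gt_three]

/-- The terms of the Lipschitz series. -/
noncomputable def lipTerm (a : ℝ) (k : ℤ) (l : ℂ) : ℂ :=
  (l + 2 * Real.pi * Complex.I * k) ^ (-a : ℂ)

/-- The Lipschitz series without its central term. -/
noncomputable def lipRem (a : ℝ) (l : ℂ) : ℂ :=
  ∑' k : ℕ, (lipTerm a (k + 1) l + lipTerm a (-(k + 1)) l)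

theorem norm_lipTerm (a : ℝ) (k : ℤ) (l : ℂ) :
    ‖lipTerm a k l‖ = ‖l + 2 * Real.pi * Complex.I * k‖ ^ (-a) := by
  rw [lipTerm, ← Complex.ofReal_neg, Complex.norm_cpow_real]

theorem norm_lipTerm_le {a : ℝ} (ha : 0 < a) {l : ℂ} (hl : |l.im| < 3 * Real.pi / 2) {k : ℤ}
    (hk : k ≠ 0) : ‖lipTerm a k l‖ ≤ |(k : ℝ)| ^ (-a) := by
  rw [norm_lipTerm]
  exact Real.rpow_le_rpow_of_nonpos (abs_pos.2 (by exact_mod_cast hk))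
    (norm_add_two_pi_mul_I_ge hl hk) (by linarith)

theorem summable_lipTerm {a : ℝ} (ha : 1 < a) {l : ℂ} (hl : |l.im| < 3 * Real.pi / 2) :
    Summable fun k : ℤ => lipTerm a k l := by
  refine Summable.of_norm_bounded_eventually (Real.summable_abs_int_rpow ha) ?_
  have : ∀ᶠ k : ℤ in cofinite, k ≠ 0 := (Set.finite_singleton 0).compl_mem_cofinite
  filter_upwards [this] with k hk
  exact norm_lipTerm_le (by linarith) hl hk

theorem summable_add_one_rpow {a : ℝ} (ha : 1 < a) : Summable fun k : ℕ => ((k : ℝ) + 1) ^ (-a) := by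
  have h := (summable_nat_add_iff 1).2 (Real.summable_nat_rpow.2 (by linarith : -a < -1))
  simpa using h

theorem norm_lipRem_term_le {a : ℝ} (ha : 0 < a) {l : ℂ} (hl : |l.im| < 3 * Real.pi / 2) (k : ℕ) :
    ‖lipTerm a (k + 1) l + lipTerm a (-(k + 1)) l‖ ≤ 2 * ((k : ℝ) + 1) ^ (-a) := by
  have hp : |((k : ℝ) + 1)| = (k : ℝ) + 1 := abs_of_pos (by positivity)
  have h1 := norm_lipTerm_le ha hl (k := k + 1) (by omega)
  have h2 := norm_lipTerm_le ha hl (k := -(k + 1)) (by omega)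
  push_cast at h1 h2
  rw [hp] at h1
  rw [abs_neg, hp] at h2
  linarith [norm_add_le (lipTerm a (k + 1) l) (lipTerm a (-(k + 1)) l)]

theorem hasSum_lipTerm {a : ℝ} (ha : 1 < a) {l : ℂ} (hl : |l.im| < 3 * Real.pi / 2) :
    HasSum (fun k : ℤ => lipTerm a k l) (l ^ (-a : ℂ) + lipRem a l) := by
  have hs := summable_lipTerm ha hl
  have h1 : Summable fun k : ℕ => lipTerm a (k + 1) l := by
    refine Summable.of_norm_bounded (summable_add_one_rpow ha) fun k => ?_
    have h1 := norm_lipTerm_le (by linarith : 0 < a) hl (k := k + 1) (by omega)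
    push_cast at h1
    rwa [abs_of_pos (by positivity)] at h1
  have h2 : Summable fun k : ℕ => lipTerm a (-(k + 1)) l := by
    refine Summable.of_norm_bounded (summable_add_one_rpow ha) fun k => ?_
    have h1 := norm_lipTerm_le (by linarith : 0 < a) hl (k := -(k + 1)) (by omega)
    push_cast at h1
    rwa [abs_neg, abs_of_pos (by positivity)] at h1
  have h := HasSum.of_add_one_of_neg_add_one (f := fun k : ℤ => lipTerm a k l) h1.hasSum h2.hasSum
  convert! h using 1
  rw [lipRem, h1.tsum_add h2]
  simp only [lipTerm, Int.cast_zero, mul_zero, add_zero]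
  ring

/-- For `k ≠ 0` the base of the power is never real, so the principal branch commutes with
conjugation. The term `k = 0` is different: `l` may lie on the negative axis. -/
theorem lipTerm_conj (a : ℝ) {k : ℤ} {l : ℂ} (hl : |l.im| < 3 * Real.pi / 2) (hk : k ≠ 0) :
    lipTerm a k (starRingEnd ℂ l) = starRingEnd ℂ (lipTerm a (-k) l) := by
  have him : (l + 2 * Real.pi * Complex.I * (-k : ℤ)).im ≠ 0 := by
    have hk1 : (1 : ℝ) ≤ |(k : ℝ)| := by
      have := Int.one_le_abs hk
      exact_mod_cast this
    intro h0
    simp at h0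
    have : l.im = 2 * Real.pi * k := by linarith
    rw [this, abs_mul, abs_of_pos Real.two_pi_pos] at hl
    nlinarith [Real.pi_pos]
  have harg : (starRingEnd ℂ (l + 2 * Real.pi * Complex.I * (-k : ℤ))).arg ≠ Real.pi := by
    intro h
    rw [Complex.arg_eq_pi_iff] at h
    simp only [Complex.conj_im] at h
    exact him (by linarith [h.2])
  have h := Complex.cpow_conj (starRingEnd ℂ (l + 2 * Real.pi * Complex.I * (-k : ℤ))) (-a : ℂ) harg
  rw [Complex.conj_conj] at h
  rw [lipTerm, lipTerm, ← h]
  simp only [map_add, map_mul, map_neg, map_ofNat, Complex.conj_ofReal, Complex.conj_I,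
    Int.cast_neg, map_intCast]
  congr 1
  ring

theorem lipRem_conj (a : ℝ) {l : ℂ} (hl : |l.im| < 3 * Real.pi / 2) :
    lipRem a (starRingEnd ℂ l) = starRingEnd ℂ (lipRem a l) := by
  rw [lipRem, lipRem, Complex.conj_tsum]
  congr 1
  funext k
  rw [lipTerm_conj a hl (by omega), lipTerm_conj a hl (by omega), map_add, neg_neg, add_comm]

theorem isOpen_strip : IsOpen {l : ℂ | |l.im| < 3 * Real.pi / 2} :=
  isOpen_lt (by fun_prop) continuous_const

/-- For `k ≠ 0` the base never meets the branch cut, so the remainder is holomorphic across the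
negative axis: only the central term branches. -/
theorem differentiableOn_lipRem {a : ℝ} (ha : 1 < a) :
    DifferentiableOn ℂ (lipRem a) {l : ℂ | |l.im| < 3 * Real.pi / 2} := by
  refine Complex.differentiableOn_tsum_of_summable_norm ((summable_add_one_rpow ha).mul_left 2) ?_
    isOpen_strip (fun k w hw => norm_lipRem_term_le (by linarith) hw k)
  have main : ∀ k : ℤ, k ≠ 0 → DifferentiableOn ℂ (lipTerm a k) {l : ℂ | |l.im| < 3 * Real.pi / 2} := by
    intro k hk l hl
    have hl : |l.im| < 3 * Real.pi / 2 := hl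
    have hsl : l + 2 * Real.pi * Complex.I * k ∈ Complex.slitPlane := by
      right
      have hk1 : (1 : ℝ) ≤ |(k : ℝ)| := by
        have := Int.one_le_abs hk
        exact_mod_cast this
      intro h0
      simp at h0
      have : l.im = -(2 * Real.pi * k) := by linarith
      rw [this, abs_neg, abs_mul, abs_of_pos Real.two_pi_pos] at hl
      nlinarith [Real.pi_pos]
    have hd : DifferentiableAt ℂ (fun l : ℂ => l + 2 * Real.pi * Complex.I * k) l := by fun_prop
    exact (hd.cpow_const hsl).differentiableWithinAt
  exact fun k => (main _ (by omega)).add (main _ (by omega))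

/-- Poisson summation for `x_+^{a-1} e^{-lx}`, whose Fourier transform at `y` is `Γ(a) (l +
2πiy)^{-a}`. -/
theorem polylog_exp_neg_of_re_pos {a : ℝ} (ha : 1 < a) (ha3 : a < 3) {l : ℂ}
    (hl : |l.im| < 3 * Real.pi / 2) (hre : 0 < l.re) :
    polylog (1 - a) (Complex.exp (-l)) = Real.Gamma a * (l ^ (-a : ℂ) + lipRem a l) := by
  set f : ℝ → ℂ := fun x => (((max x 0) ^ (a - 1) : ℝ) : ℂ) * Complex.exp (-(l * x)) with hf
  -- The truncation is continuous at `0` because `a > 1`.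
  have hcont : Continuous f := by
    refine Continuous.mul (Complex.continuous_ofReal.comp ?_) (by fun_prop)
    exact (continuous_id.max continuous_const).rpow_const fun x => Or.inr (by linarith)
  have hneg : ∀ x ≤ 0, f x = 0 := by
    intro x hx
    simp [hf, max_eq_right hx, Real.zero_rpow (by linarith : a - 1 ≠ 0)]
  have hpos : ∀ x : ℝ, 0 < x → f x = ((x ^ (a - 1) : ℝ) : ℂ) * Complex.exp (-(l * x)) := by
    intro x hx
    simp [hf, max_eq_left hx.le]
  have hdecay : f =O[cocompact ℝ] fun x : ℝ => |x| ^ (-2 : ℝ) := by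
    rw [cocompact_eq_atBot_atTop, Asymptotics.isBigO_sup]
    constructor
    · refine (Asymptotics.isBigO_zero (fun x : ℝ => |x| ^ (-2 : ℝ)) atBot).congr' ?_ EventuallyEq.rfl
      filter_upwards [eventually_le_atBot 0] with x hx
      exact (hneg x hx).symm
    · have h := (isLittleO_exp_neg_mul_rpow_atTop hre (-2 - (a - 1))).isBigO
      have h2 := (Asymptotics.isBigO_refl (fun x : ℝ => x ^ (a - 1)) atTop).mul h
      refine Asymptotics.IsBigO.of_norm_left (h2.congr' ?_ ?_)
      · filter_upwards [eventually_gt_atTop 0] with x hx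
        rw [hpos x hx, norm_mul, Complex.norm_real, Real.norm_of_nonneg (Real.rpow_nonneg hx.le _),
          Complex.norm_exp]
        simp
      · filter_upwards [eventually_gt_atTop 0] with x hx
        rw [abs_of_pos hx, ← Real.rpow_add hx]
        congr 1; ring
  have hfour : ∀ y : ℝ, FourierTransform.fourier f y =
      (Real.Gamma a : ℂ) * (l + 2 * Real.pi * Complex.I * y) ^ (-a : ℂ) := by
    intro y
    rw [Real.fourier_real_eq_integral_exp_smul, ← integral_rpow_mul_cexp_neg_mul_Ioi (by linarith)
      (r := l + 2 * Real.pi * Complex.I * y) (by simpa using hre),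
      ← setIntegral_eq_integral_of_forall_compl_eq_zero (s := Set.Ioi (0 : ℝ))]
    · refine setIntegral_congr_fun measurableSet_Ioi fun x hx => ?_
      simp only [hpos x hx, smul_eq_mul]
      rw [mul_left_comm, ← Complex.exp_add]
      congr 2
      push_cast
      ring
    · intro x hx
      rw [hneg x (not_lt.1 hx), smul_zero]
  have hz : ‖Complex.exp (-l)‖ < 1 := by
    rw [Complex.norm_exp]
    simpa using hre
  have hfour' : ∀ k : ℤ, FourierTransform.fourier f (k : ℝ) = Real.Gamma a * lipTerm a k l := by
    intro k
    rw [hfour, lipTerm]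
    norm_cast
  have hsum := (hasSum_lipTerm ha hl).mul_left (Real.Gamma a : ℂ)
  have hpoisson := Real.tsum_eq_tsum_fourier_of_rpow_decay_of_summable hcont one_lt_two hdecay
    (by simpa only [hfour'] using hsum.summable) 0
  simp only [hfour', zero_add, QuotientAddGroup.mk_zero, fourier_eval_zero, mul_one,
    hsum.tsum_eq] at hpoisson
  rw [← hpoisson, ← (polylog_hasSum (by linarith) hz).tsum_eq]
  have hinj : Function.Injective (fun k : ℕ => ((k : ℤ) + 1)) := by
    intro i j h
    simpa using h
  rw [← hinj.tsum_eq (f := fun n : ℤ => f n)]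
  · refine tsum_congr fun k => ?_
    rw [hpos _ (by push_cast; positivity), ← Complex.exp_nat_mul]
    push_cast
    congr 2
    · congr 1
      ring
    · ring
  · intro n hn
    rw [Function.mem_support] at hn
    have hn0 : 0 < n := by
      by_contra h
      exact hn (hneg _ (by exact_mod_cast not_lt.1 h))
    exact ⟨(n - 1).toNat, by simp only; omega⟩

/-- If `e^{-l}` were a real number `≥ 1`, then `sin (Im l) = 0` and `cos (Im l) > 0`, which in this
strip forces `Im l = 0`; then `Re l ≤ 0`, against `l` lying in the slit plane. -/
theorem one_sub_exp_neg_mem_slitPlane {l : ℂ} (hl : |l.im| < 3 * Real.pi / 2)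
    (hsl : l ∈ Complex.slitPlane) : 1 - Complex.exp (-l) ∈ Complex.slitPlane := by
  rw [Complex.mem_slitPlane_iff] at hsl ⊢
  by_contra! h
  obtain ⟨h1, h2⟩ := h
  simp only [Complex.sub_re, Complex.sub_im, Complex.one_re, Complex.one_im, Complex.exp_re,
    Complex.exp_im, Complex.neg_re, Complex.neg_im, Real.cos_neg, Real.sin_neg] at h1 h2
  have he := Real.exp_pos (-l.re)
  have hcos : 0 < Real.cos l.im := by
    by_contra hc
    nlinarith
  have hsin : Real.sin l.im = 0 := by
    have : Real.exp (-l.re) * Real.sin l.im = 0 := by linarith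
    rcases mul_eq_zero.1 this with h | h
    · exact absurd h he.ne'
    · exact h
  have him : l.im = 0 := by
    rw [abs_lt] at hl
    by_contra h0
    rcases lt_or_ge Real.pi |l.im| with h | h
    · have : Real.cos |l.im| < 0 := by
        refine Real.cos_neg_of_pi_div_two_lt_of_lt (by linarith [Real.pi_pos]) ?_
        have := abs_lt.2 hl
        linarith
      rw [Real.cos_abs] at this
      linarith
    · rcases h.lt_or_eq with h | h
      · rw [abs_lt] at h
        exact h0 ((Real.sin_eq_zero_iff_of_lt_of_lt h.1 h.2).1 hsin)
      · have : Real.cos |l.im| = -1 := by rw [h, Real.cos_pi]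
        rw [Real.cos_abs] at this
        linarith
  rw [him] at h1 hsl
  have h3 : 0 < l.re := by simpa using hsl
  have : Real.exp (-l.re) < 1 := by
    rw [← Real.exp_zero]
    exact Real.exp_lt_exp.2 (by linarith)
  rw [Real.cos_zero] at h1
  linarith

/-- Lipschitz' formula for the polylogarithm, continued analytically. -/
theorem polylog_exp_neg {a : ℝ} (ha : 1 < a) (ha3 : a < 3) {l : ℂ}
    (hl : |l.im| < 3 * Real.pi / 2) (hsl : l ∈ Complex.slitPlane) :
    polylog (1 - a) (Complex.exp (-l)) = Real.Gamma a * (l ^ (-a : ℂ) + lipRem a l) := by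
  have hopen : IsOpen ({l : ℂ | |l.im| < 3 * Real.pi / 2} ∩ Complex.slitPlane) :=
    isOpen_strip.inter Complex.isOpen_slitPlane
  have hstrip : Convex ℝ {l : ℂ | |l.im| < 3 * Real.pi / 2} := by
    have : {l : ℂ | |l.im| < 3 * Real.pi / 2} =
        {l : ℂ | -(3 * Real.pi / 2) < l.im} ∩ {l : ℂ | l.im < 3 * Real.pi / 2} := by
      ext l
      simp [abs_lt]
    rw [this]
    exact (convex_halfSpace_im_gt _).inter (convex_halfSpace_im_lt _)
  have h1 : (1 : ℂ) ∈ {l : ℂ | |l.im| < 3 * Real.pi / 2} ∩ Complex.slitPlane := by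
    refine ⟨?_, by simp⟩
    simp [Real.pi_pos]
  -- The slit strip is star-shaped about `1`, so the identity theorem carries the formula over from
  -- a neighbourhood of `1`.
  have hconn : IsPreconnected ({l : ℂ | |l.im| < 3 * Real.pi / 2} ∩ Complex.slitPlane) :=
    (((hstrip.starConvex h1.1).inter Complex.starConvex_one_slitPlane).isPathConnected
      h1).isConnected.isPreconnected
  have hd1 : DifferentiableOn ℂ (fun l : ℂ => polylog (1 - a) (Complex.exp (-l)))
      ({l : ℂ | |l.im| < 3 * Real.pi / 2} ∩ Complex.slitPlane) := by
    intro l hl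
    have h := differentiableAt_polylog (s := 1 - a) (by linarith)
      (one_sub_exp_neg_mem_slitPlane hl.1 hl.2)
    have h2 : DifferentiableAt ℂ (fun l : ℂ => Complex.exp (-l)) l := by fun_prop
    exact (h.comp l h2).differentiableWithinAt
  have hd2 : DifferentiableOn ℂ (fun l : ℂ => Real.Gamma a * (l ^ (-a : ℂ) + lipRem a l))
      ({l : ℂ | |l.im| < 3 * Real.pi / 2} ∩ Complex.slitPlane) := by
    refine DifferentiableOn.const_mul (DifferentiableOn.add ?_
      ((differentiableOn_lipRem ha).mono Set.inter_subset_left)) _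
    intro l hl
    exact (differentiableAt_id.cpow_const hl.2).differentiableWithinAt
  refine AnalyticOnNhd.eqOn_of_preconnected_of_eventuallyEq
    (hd1.analyticOnNhd hopen) (hd2.analyticOnNhd hopen) hconn h1 ?_ ⟨hl, hsl⟩
  filter_upwards [isOpen_strip.mem_nhds h1.1,
    (isOpen_lt continuous_const Complex.continuous_re).mem_nhds
      (show (1 : ℂ) ∈ {l : ℂ | 0 < l.re} by simp)] with l hl hre
  exact polylog_exp_neg_of_re_pos ha ha3 hl hre

/-! ### `Q` on the unit circle and the polylogarithm near `1` -/

theorem cpow_mul_I_add_cpow_mul_neg_I (a : ℝ) {m : ℝ} (hm : m ≠ 0) :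
    ((m : ℂ) * Complex.I) ^ (-a : ℂ) + ((m : ℂ) * -Complex.I) ^ (-a : ℂ) =
      ((2 * Real.cos (Real.pi * a / 2) * |m| ^ (-a) : ℝ) : ℂ) := by
  have main : ∀ m : ℝ, 0 < m → ((m : ℂ) * Complex.I) ^ (-a : ℂ) + ((m : ℂ) * -Complex.I) ^ (-a : ℂ)
      = ((2 * Real.cos (Real.pi * a / 2) * |m| ^ (-a) : ℝ) : ℂ) := by
    intro m hm
    have hm' : (m : ℂ) ≠ 0 := by exact_mod_cast hm.ne'
    rw [Complex.cpow_def_of_ne_zero (mul_ne_zero hm' Complex.I_ne_zero),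
      Complex.cpow_def_of_ne_zero (mul_ne_zero hm' (neg_ne_zero.2 Complex.I_ne_zero)),
      Complex.log_ofReal_mul hm Complex.I_ne_zero,
      Complex.log_ofReal_mul hm (neg_ne_zero.2 Complex.I_ne_zero), Complex.log_I, Complex.log_neg_I,
      abs_of_pos hm, Real.rpow_def_of_pos hm]
    push_cast
    rw [Complex.cos, add_mul, add_mul, Complex.exp_add, Complex.exp_add]
    have e1 : (Real.pi / 2 * Complex.I * -(a : ℂ)) = -(Real.pi * a / 2 : ℂ) * Complex.I := by ring
    have e2 : (-(Real.pi / 2) * Complex.I * -(a : ℂ)) = (Real.pi * a / 2 : ℂ) * Complex.I := by ring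
    rw [e1, e2]
    ring
  rcases lt_or_gt_of_ne hm with h | h
  · have := main (-m) (by linarith)
    rw [abs_neg] at this
    rw [← this, add_comm]
    push_cast
    ring_nf
  · exact main m h

/-- Lipschitz' formula at `l ↦ ∓il`: the `k`-th term of one series and the `-k`-th of the other add
up to `2 cos(πa/2) |l + 2πk|^{-a}`. Since `πa/2 = πd + π`, the cosine is `-cos(πd)`, and its sign
cancels that of `u⁻¹ - 2 + u = -|1 - u|²`. -/
theorem Q_exp_eq_f0 {d : ℝ} (hd₁ : -(1 / 2) < d) (hd₂ : d < 1 / 2) {l : ℝ} (hl : l ≠ 0)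
    (hl' : |l| ≤ Real.pi) : Q d (Complex.exp (Complex.I * l)) = f0 d l := by
  have hpi := Real.pi_pos
  set a : ℝ := 2 * d + 2 with ha
  have ea : -2 * d - 1 = 1 - a := by rw [ha]; ring
  have h1 : polylog (1 - a) (Complex.exp (Complex.I * l)) = Real.Gamma a *
      ((-(Complex.I * l)) ^ (-a : ℂ) + lipRem a (-(Complex.I * l))) := by
    have := polylog_exp_neg (a := a) (l := -(Complex.I * l)) (by linarith) (by linarith)
      (by simp; linarith) (by right; simpa using hl)
    rwa [neg_neg] at this
  have h2 : polylog (1 - a) (Complex.exp (Complex.I * l))⁻¹ = Real.Gamma a *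
      ((Complex.I * l) ^ (-a : ℂ) + lipRem a (Complex.I * l)) := by
    rw [← Complex.exp_neg]
    exact polylog_exp_neg (a := a) (l := Complex.I * l) (by linarith) (by linarith)
      (by simp; linarith) (by right; simpa using hl)
  have s1 := hasSum_lipTerm (a := a) (l := -(Complex.I * l)) (by linarith) (by simp; linarith)
  have s2 := hasSum_lipTerm (a := a) (l := Complex.I * l) (by linarith) (by simp; linarith)
  rw [← (Equiv.neg ℤ).hasSum_iff] at s1
  have s3 := s2.add s1
  have hterm : ∀ k : ℤ, lipTerm a k (Complex.I * l) + lipTerm a (-k) (-(Complex.I * l)) =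
      ((2 * Real.cos (Real.pi * a / 2) * |l + 2 * Real.pi * k| ^ (-2 * d - 2) : ℝ) : ℂ) := by
    intro k
    have hne : l + 2 * Real.pi * k ≠ 0 := by
      intro h0
      rcases eq_or_ne k 0 with rfl | hk
      · simp at h0; exact hl h0
      · have hk1 : (1 : ℝ) ≤ |(k : ℝ)| := by
          have := Int.one_le_abs hk
          exact_mod_cast this
        have : l = -(2 * Real.pi * k) := by linarith
        rw [this, abs_neg, abs_mul, abs_of_pos Real.two_pi_pos] at hl'
        nlinarith
    have e : -2 * d - 2 = -a := by rw [ha]; ring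
    rw [e, ← cpow_mul_I_add_cpow_mul_neg_I a hne, lipTerm, lipTerm]
    push_cast
    congr 2 <;> ring
  have s4 := s3
  simp only [Function.comp_apply, Equiv.neg_apply, hterm] at s4
  have hcos : Real.cos (Real.pi * a / 2) = -Real.cos (Real.pi * d) := by
    rw [← Real.cos_add_pi]
    congr 1
    rw [ha]; ring
  have hM : (Complex.exp (Complex.I * l))⁻¹ - 2 + Complex.exp (Complex.I * l) =
      -((‖1 - Complex.exp (Complex.I * l)‖ ^ 2 : ℝ) : ℂ) := by
    have hu : ‖Complex.exp (Complex.I * l)‖ = 1 := by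
      rw [mul_comm]; exact Complex.norm_exp_ofReal_mul_I l
    rw [Complex.inv_eq_conj hu, Complex.ofReal_pow, ← Complex.mul_conj']
    have huu := Complex.mul_conj' (Complex.exp (Complex.I * l))
    rw [hu] at huu
    rw [map_sub, map_one]
    push_cast at huu
    linear_combination huu
  rw [Q, f0, ea, h1, h2, ← mul_add, add_comm (_ + _) (_ + _), ← s4.tsum_eq, hM, ← Complex.ofReal_tsum,
    tsum_mul_left, hcos, ← ha]
  generalize (∑' k : ℤ, |l + 2 * Real.pi * k| ^ (-2 * d - 2)) = S
  generalize Real.Gamma a = g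
  push_cast
  field_simp
  ring

theorem neg_log_mem_slitPlane {z : ℂ} (hz0 : z ≠ 0) (hz : 1 - z ∈ Complex.slitPlane) :
    -Complex.log z ∈ Complex.slitPlane := by
  rw [Complex.mem_slitPlane_iff] at hz ⊢
  by_contra! h
  obtain ⟨h1, h2⟩ := h
  simp only [Complex.neg_re, Complex.neg_im] at h1 h2
  have e : z = ((Real.exp (Complex.log z).re : ℝ) : ℂ) := by
    conv_lhs => rw [← Complex.exp_log hz0]
    rw [Complex.ofReal_exp]
    congr 1
    apply Complex.ext
    · simp
    · rw [Complex.ofReal_im]; linarith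
  have h3 : 1 ≤ Real.exp (Complex.log z).re := Real.one_le_exp (by linarith)
  rw [e] at hz
  simp only [Complex.sub_re, Complex.one_re, Complex.ofReal_re, Complex.sub_im, Complex.one_im,
    Complex.ofReal_im, sub_self, ne_eq, not_true_eq_false, or_false] at hz
  linarith

/-- With `l = -log z` small, the central term `l^{-a}` dominates and the remainder is bounded; `|1 -
z| ≤ 2 |log z|` converts the estimate to one in `1 - z`. -/
theorem polylog_isBigO_one {a : ℝ} (ha : 1 < a) (ha3 : a < 3) :
    polylog (1 - a) =O[𝓝[{z | 1 - z ∈ Complex.slitPlane}] 1] fun z : ℂ => ‖1 - z‖ ^ (-a) := by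
  have hlog : Tendsto (fun z : ℂ => -Complex.log z) (𝓝 1) (𝓝 0) := by
    have : ContinuousAt (fun z : ℂ => -Complex.log z) 1 := (continuousAt_clog (by simp)).neg
    simpa [ContinuousAt] using this
  have h0 : (0 : ℂ) ∈ {l : ℂ | |l.im| < 3 * Real.pi / 2} := by simp [Real.pi_pos]
  have hrem : (fun z : ℂ => lipRem a (-Complex.log z)) =O[𝓝[{z | 1 - z ∈ Complex.slitPlane}] 1]
      fun _ => (1 : ℝ) := by
    have hc : ContinuousAt (lipRem a) 0 :=
      ((differentiableOn_lipRem ha).differentiableAt (isOpen_strip.mem_nhds h0)).continuousAt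
    exact ((hc.tendsto.comp hlog).mono_left nhdsWithin_le_nhds).isBigO_one ℝ
  have hone : (fun _ : ℂ => (1 : ℝ)) =O[𝓝[{z | 1 - z ∈ Complex.slitPlane}] 1]
      fun z : ℂ => ‖1 - z‖ ^ (-a) := by
    refine Asymptotics.IsBigO.of_bound 1 ?_
    filter_upwards [nhdsWithin_le_nhds (Metric.ball_mem_nhds (1 : ℂ) one_pos),
      self_mem_nhdsWithin] with z hz hs
    have h1 : ‖1 - z‖ < 1 := by
      rw [norm_sub_rev]; simpa [dist_eq_norm] using hz
    have h2 : 0 < ‖1 - z‖ := norm_pos_iff.2 (Complex.slitPlane_ne_zero hs)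
    have h3 : 1 ≤ ‖1 - z‖ ^ (-a) := Real.one_le_rpow_of_pos_of_le_one_of_nonpos h2 h1.le (by linarith)
    rw [norm_one, one_mul, Real.norm_of_nonneg (by positivity)]
    exact h3
  have hmain : (fun z : ℂ => (-Complex.log z) ^ (-a : ℂ)) =O[𝓝[{z | 1 - z ∈ Complex.slitPlane}] 1]
      fun z : ℂ => ‖1 - z‖ ^ (-a) := by
    refine Asymptotics.IsBigO.of_bound ((1 / 2) ^ (-a)) ?_
    filter_upwards [nhdsWithin_le_nhds (hlog (Metric.closedBall_mem_nhds (0 : ℂ) one_pos)),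
      nhdsWithin_le_nhds (isOpen_ne.mem_nhds (one_ne_zero : (1 : ℂ) ≠ 0)),
      self_mem_nhdsWithin] with z hz hz0 hs
    have hz1 : ‖Complex.log z‖ ≤ 1 := by simpa using hz
    have h1 := Complex.norm_exp_sub_one_le hz1
    rw [Complex.exp_log hz0, norm_sub_rev] at h1
    have h2 : 0 < ‖1 - z‖ := norm_pos_iff.2 (Complex.slitPlane_ne_zero hs)
    rw [← Complex.ofReal_neg, Complex.norm_cpow_real, norm_neg,
      Real.norm_of_nonneg (Real.rpow_nonneg h2.le _), ← Real.mul_rpow (by norm_num) h2.le]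
    exact Real.rpow_le_rpow_of_nonpos (by positivity) (by linarith) (by linarith)
  refine (Asymptotics.IsBigO.congr' ((hmain.add (hrem.trans hone)).const_mul_left (Real.Gamma a : ℂ))
    ?_ EventuallyEq.rfl)
  filter_upwards [nhdsWithin_le_nhds (hlog (isOpen_strip.mem_nhds h0)),
      nhdsWithin_le_nhds (isOpen_ne.mem_nhds (one_ne_zero : (1 : ℂ) ≠ 0)),
      self_mem_nhdsWithin] with z hz hz0 hs
  have := polylog_exp_neg ha ha3 hz (neg_log_mem_slitPlane hz0 hs)
  rw [neg_neg, Complex.exp_log hz0] at this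
  exact this.symm

/-! ### The Lipschitz series as `Re l → -∞` -/

/-- The subtracted quotient is the integral of `(l + 2πiu)^{-a}` over `[k+1, k+2]`, so this compares
a term of the series with an integral that telescopes in `k`. The error is controlled by the
derivative of the integrand. -/
theorem norm_cpow_add_two_pi_sub_le {a : ℝ} (ha : 1 < a) {l : ℂ} (hl : |l.im| ≤ Real.pi)
    (hre : l.re < 0) (k : ℕ) :
    ‖lipTerm a (k + 1) l -
      ((l + 2 * Real.pi * Complex.I * ((k : ℂ) + 2)) ^ (1 - a : ℂ) -
        (l + 2 * Real.pi * Complex.I * ((k : ℂ) + 1)) ^ (1 - a : ℂ)) /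
        (2 * Real.pi * Complex.I * (1 - a))‖ ≤
      2 * Real.pi * a * ((-l.re) ^ (1 / 2 - a) * ((k : ℝ) + 1) ^ (-(3 / 2) : ℝ)) := by
  have hpi := Real.pi_pos
  have ha1 : (1 - a : ℂ) ≠ 0 := by
    rw [sub_ne_zero]; exact_mod_cast ha.ne
  have hI : (2 * Real.pi * Complex.I : ℂ) ≠ 0 := Complex.two_pi_I_ne_zero
  set v : ℝ → ℂ := fun u => l + 2 * Real.pi * Complex.I * u with hv
  have hvd : ∀ u, HasDerivAt v (2 * Real.pi * Complex.I) u := by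
    intro u
    have h1 : HasDerivAt (fun u : ℝ => (u : ℂ)) 1 u := Complex.ofRealCLM.hasDerivAt
    exact ((h1.const_mul (2 * Real.pi * Complex.I)).const_add l).congr_deriv (by simp)
  have him : ∀ u, (v u).im = l.im + 2 * Real.pi * u := by intro u; simp [hv]
  have hvre : ∀ u, (v u).re = l.re := by intro u; simp [hv]
  have hk : (0 : ℝ) ≤ k := k.cast_nonneg
  rw [abs_le] at hl
  have hsl : ∀ u ∈ Set.Icc ((k : ℝ) + 1) (k + 2), v u ∈ Complex.slitPlane := by
    intro u hu
    right
    rw [him]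
    nlinarith [hu.1]
  have hge : ∀ u ∈ Set.Icc ((k : ℝ) + 1) (k + 2), (k : ℝ) + 1 ≤ ‖v u‖ := by
    intro u hu
    refine le_trans ?_ (Complex.abs_im_le_norm _)
    rw [him]
    refine le_trans ?_ (le_abs_self _)
    nlinarith [hu.1, Real.pi_gt_three]
  have hge2 : ∀ u ∈ Set.Icc ((k : ℝ) + 1) (k + 2), -l.re ≤ ‖v u‖ := by
    intro u hu
    refine le_trans ?_ (Complex.abs_re_le_norm _)
    rw [hvre]
    exact neg_le_abs _
  set K : ℝ := 2 * Real.pi * a * ((-l.re) ^ (1 / 2 - a) * ((k : ℝ) + 1) ^ (-(3 / 2) : ℝ)) with hK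
  have hK0 : 0 ≤ K := by
    have : 0 < -l.re := by linarith
    positivity
  set f : ℝ → ℂ := fun u => (v u) ^ (-a : ℂ) with hf
  have hfd : ∀ u ∈ Set.Icc ((k : ℝ) + 1) (k + 2),
      HasDerivAt f ((-a : ℂ) * (v u) ^ (-a - 1 : ℂ) * (2 * Real.pi * Complex.I)) u := by
    intro u hu
    have h0 : HasDerivAt (fun z : ℂ => z ^ (-a : ℂ)) ((-a : ℂ) * (v u) ^ (-a - 1 : ℂ) * 1) (v u) :=
      (hasDerivAt_id (v u)).cpow_const (hsl u hu)
    exact (h0.scomp u (hvd u)).congr_deriv (by rw [smul_eq_mul]; ring)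
  have hfb : ∀ u ∈ Set.Icc ((k : ℝ) + 1) (k + 2),
      ‖(-a : ℂ) * (v u) ^ (-a - 1 : ℂ) * (2 * Real.pi * Complex.I)‖ ≤ K := by
    intro u hu
    have e1 : ‖(v u) ^ (-a - 1 : ℂ)‖ = ‖v u‖ ^ (-a - 1) := by
      have : (-a - 1 : ℂ) = ((-a - 1 : ℝ) : ℂ) := by push_cast; ring
      rw [this, Complex.norm_cpow_real]
    -- The exponent is split so that one factor, bounded through `Re l`, supplies decay better than
    -- the main order `1 - a`, and the other, bounded through `k`, is summable.
    have e2 : ‖v u‖ ^ (-a - 1) = ‖v u‖ ^ (1 / 2 - a) * ‖v u‖ ^ (-(3 / 2) : ℝ) := by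
      rw [← Real.rpow_add (by linarith [hge u hu])]
      congr 1; ring
    have e3 : ‖(2 * Real.pi * Complex.I : ℂ)‖ = 2 * Real.pi := by
      simp [abs_of_pos hpi]
    rw [norm_mul, norm_mul, e1, e2, e3, norm_neg, Complex.norm_real,
      Real.norm_of_nonneg (by linarith : (0 : ℝ) ≤ a), hK]
    have b1 : ‖v u‖ ^ (1 / 2 - a) ≤ (-l.re) ^ (1 / 2 - a) :=
      Real.rpow_le_rpow_of_nonpos (by linarith) (hge2 u hu) (by linarith)
    have b2 : ‖v u‖ ^ (-(3 / 2) : ℝ) ≤ ((k : ℝ) + 1) ^ (-(3 / 2) : ℝ) :=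
      Real.rpow_le_rpow_of_nonpos (by linarith) (hge u hu) (by norm_num)
    calc a * (‖v u‖ ^ (1 / 2 - a) * ‖v u‖ ^ (-(3 / 2) : ℝ)) * (2 * Real.pi)
        ≤ a * ((-l.re) ^ (1 / 2 - a) * ((k : ℝ) + 1) ^ (-(3 / 2) : ℝ)) * (2 * Real.pi) := by
          have : 0 ≤ (-l.re) ^ (1 / 2 - a) := Real.rpow_nonneg (by linarith) _
          gcongr
      _ = _ := by ring
  have hmem1 : (k : ℝ) + 1 ∈ Set.Icc ((k : ℝ) + 1) (k + 2) := ⟨le_rfl, by linarith⟩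
  have hmem2 : (k : ℝ) + 2 ∈ Set.Icc ((k : ℝ) + 1) (k + 2) := ⟨by linarith, le_rfl⟩
  have hfdiff : ∀ u ∈ Set.Icc ((k : ℝ) + 1) (k + 2), ‖f u - f (k + 1)‖ ≤ K := by
    intro u hu
    have h := (convex_Icc ((k : ℝ) + 1) (k + 2)).norm_image_sub_le_of_norm_hasDerivWithin_le
      (fun x hx => (hfd x hx).hasDerivWithinAt) hfb hmem1 hu
    refine h.trans ?_
    have : ‖u - ((k : ℝ) + 1)‖ ≤ 1 := by
      rw [Real.norm_eq_abs, abs_le]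
      constructor <;> linarith [hu.1, hu.2]
    nlinarith
  -- The primitive of `f u - f (k+1)`: a second use of the mean value inequality, on an interval of
  -- length one, bounds its increment, which is the quantity to be estimated up to sign.
  set F : ℝ → ℂ := fun u => (v u) ^ (1 - a : ℂ) / (2 * Real.pi * Complex.I * (1 - a)) -
    u * f (k + 1) with hF
  have hFd : ∀ u ∈ Set.Icc ((k : ℝ) + 1) (k + 2), HasDerivAt F (f u - f (k + 1)) u := by
    intro u hu
    have h1 : HasDerivAt (fun u : ℝ => (u : ℂ)) 1 u := Complex.ofRealCLM.hasDerivAt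
    have h0 : HasDerivAt (fun z : ℂ => z ^ (1 - a : ℂ)) ((1 - a : ℂ) * (v u) ^ (1 - a - 1 : ℂ) * 1)
      (v u) := (hasDerivAt_id (v u)).cpow_const (hsl u hu)
    have h2 := ((h0.scomp u (hvd u)).div_const
      (2 * Real.pi * Complex.I * (1 - a))).fun_sub (h1.mul_const (f (k + 1)))
    refine h2.congr_deriv ?_
    have e : (1 - a - 1 : ℂ) = -a := by ring
    rw [e, one_mul, mul_one, smul_eq_mul]
    simp only [hf]
    field_simp
  have h := (convex_Icc ((k : ℝ) + 1) (k + 2)).norm_image_sub_le_of_norm_hasDerivWithin_le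
      (fun x hx => (hFd x hx).hasDerivWithinAt) hfdiff hmem1 hmem2
  have e1 : ‖((k : ℝ) + 2) - ((k : ℝ) + 1)‖ = 1 := by
    rw [show ((k : ℝ) + 2) - ((k : ℝ) + 1) = 1 by ring, norm_one]
  rw [e1, mul_one, norm_sub_rev] at h
  convert! h using 2
  simp only [hF, hf, hv, lipTerm]
  push_cast
  ring

/-- The part of the Lipschitz series in the upper half-plane. -/
noncomputable def lipUpper (a : ℝ) (l : ℂ) : ℂ := ∑' k : ℕ, lipTerm a (k + 1) l

/-- The filter of points of the strip `|Im l| ≤ π` whose real part tends to `-∞`. -/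
def stripBot : Filter ℂ := comap Complex.re atBot ⊓ 𝓟 {l : ℂ | |l.im| ≤ Real.pi}

theorem tendsto_neg_re_stripBot : Tendsto (fun l : ℂ => -l.re) stripBot atTop :=
  tendsto_neg_atBot_atTop.comp (tendsto_comap.mono_left inf_le_left)

theorem abs_im_le_of_stripBot : ∀ᶠ l in stripBot, |l.im| ≤ Real.pi :=
  (mem_inf_of_right (mem_principal_self _) : _ ∈ stripBot)

theorem abs_im_lt_of_le_pi {l : ℂ} (hl : |l.im| ≤ Real.pi) : |l.im| < 3 * Real.pi / 2 := by
  linarith [Real.pi_pos]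

theorem summable_lipUpper {a : ℝ} (ha : 1 < a) {l : ℂ} (hl : |l.im| < 3 * Real.pi / 2) :
    Summable fun k : ℕ => lipTerm a (k + 1) l := by
  refine Summable.of_norm_bounded (summable_add_one_rpow ha) fun k => ?_
  have h1 := norm_lipTerm_le (by linarith : 0 < a) hl (k := k + 1) (by omega)
  push_cast at h1
  rwa [abs_of_pos (by positivity)] at h1

/-- The terms with negative index are the conjugates of those with positive index at the conjugate
point, so only the upper half of the series needs an asymptotic analysis. -/
theorem lipRem_eq_lipUpper {a : ℝ} (ha : 1 < a) {l : ℂ} (hl : |l.im| < 3 * Real.pi / 2) :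
    lipRem a l = lipUpper a l + starRingEnd ℂ (lipUpper a (starRingEnd ℂ l)) := by
  have hl2 : |(starRingEnd ℂ l).im| < 3 * Real.pi / 2 := by simpa using hl
  have e : ∀ k : ℕ, lipTerm a (-(k + 1)) l =
      starRingEnd ℂ (lipTerm a (k + 1) (starRingEnd ℂ l)) := by
    intro k
    rw [lipTerm_conj a hl (by omega), Complex.conj_conj]
  have hs : Summable fun k : ℕ => starRingEnd ℂ (lipTerm a (k + 1) (starRingEnd ℂ l)) :=
    Complex.conjCLE.summable.2 (summable_lipUpper ha hl2)
  rw [lipRem, lipUpper, lipUpper, Complex.conj_tsum]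
  simp only [e]
  exact (summable_lipUpper ha hl).tsum_add hs

/-- Summing the comparison errors over `k`; the integrals telescope to minus the boundary term at `k
= 0`, because the primitive has exponent `1 - a < 0` and vanishes at infinity. The bound is smaller
than the main order `(-Re l)^{1-a}` by a factor `(-Re l)^{-1/2}`. -/
theorem lipUpper_sub_bound {a : ℝ} (ha : 1 < a) : ∃ K : ℝ, ∀ l : ℂ, |l.im| ≤ Real.pi → l.re < 0 →
    ‖lipUpper a l + (l + 2 * Real.pi * Complex.I) ^ (1 - a : ℂ) /
      (2 * Real.pi * Complex.I * (1 - a))‖ ≤ K * (-l.re) ^ (1 / 2 - a) := by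
  have hs : Summable fun k : ℕ => ((k : ℝ) + 1) ^ (-(3 / 2) : ℝ) :=
    summable_add_one_rpow (by norm_num)
  refine ⟨2 * Real.pi * a * ∑' k : ℕ, ((k : ℝ) + 1) ^ (-(3 / 2) : ℝ), fun l hl hre => ?_⟩
  have hb := norm_cpow_add_two_pi_sub_le ha hl hre
  set c : ℂ := 2 * Real.pi * Complex.I * (1 - a)
  set F : ℕ → ℂ := fun k => (l + 2 * Real.pi * Complex.I * ((k : ℂ) + 1)) ^ (1 - a : ℂ) / c with hF
  set e : ℕ → ℂ := fun k => lipTerm a (k + 1) l - (F (k + 1) - F k) with he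
  have hbe : ∀ k, ‖e k‖ ≤
      2 * Real.pi * a * ((-l.re) ^ (1 / 2 - a) * ((k : ℝ) + 1) ^ (-(3 / 2) : ℝ)) := by
    intro k
    refine le_trans (le_of_eq ?_) (hb k)
    simp only [he, hF]
    push_cast
    rw [sub_div, show (k : ℂ) + 1 + 1 = k + 2 by ring]
  have hsb := (hs.mul_left ((-l.re) ^ (1 / 2 - a))).mul_left (2 * Real.pi * a)
  have hse : Summable e := Summable.of_norm_bounded hsb hbe
  have hsT := summable_lipUpper ha (abs_im_lt_of_le_pi hl)
  have hsF : Summable fun k => F (k + 1) - F k := by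
    refine (hsT.sub hse).congr fun k => ?_
    simp only [he]
    ring
  have hF0 : Tendsto F atTop (𝓝 0) := by
    have hnorm : ∀ k : ℕ, ‖F k‖ ≤ ((k : ℝ) + 1) ^ (1 - a) / ‖c‖ := by
      intro k
      have e1 : (1 - a : ℂ) = ((1 - a : ℝ) : ℂ) := by push_cast; ring
      simp only [hF]
      rw [norm_div, e1, Complex.norm_cpow_real]
      have h1 := norm_add_two_pi_mul_I_ge (abs_im_lt_of_le_pi hl) (k := k + 1) (by omega)
      push_cast at h1
      rw [abs_of_pos (by positivity)] at h1
      have := Real.rpow_le_rpow_of_nonpos (z := 1 - a) (by positivity) h1 (by linarith)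
      gcongr
    have hlim : Tendsto (fun k : ℕ => ((k : ℝ) + 1) ^ (1 - a) / ‖c‖) atTop (𝓝 0) := by
      have h1 : Tendsto (fun x : ℝ => x ^ (1 - a)) atTop (𝓝 0) := by
        have := tendsto_rpow_neg_atTop (y := a - 1) (by linarith)
        simpa using this
      have h2 : Tendsto (fun k : ℕ => (k : ℝ) + 1) atTop atTop :=
        tendsto_atTop_add_const_right _ _ tendsto_natCast_atTop_atTop
      simpa using (h1.comp h2).div_const ‖c‖
    exact squeeze_zero_norm hnorm hlim
  have htel : ∑' k, (F (k + 1) - F k) = -F 0 := by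
    have h1 := hsF.hasSum.tendsto_sum_nat
    simp only [Finset.sum_range_sub] at h1
    have h2 : Tendsto (fun n => F n - F 0) atTop (𝓝 (0 - F 0)) := hF0.sub_const _
    rw [zero_sub] at h2
    exact tendsto_nhds_unique h1 h2
  have hmain : lipUpper a l + F 0 = ∑' k, e k := by
    rw [lipUpper, ← sub_neg_eq_add, ← htel, ← hsT.tsum_sub hsF]
  have e0 : F 0 = (l + 2 * Real.pi * Complex.I) ^ (1 - a : ℂ) / c := by simp [hF]
  rw [← e0, hmain]
  refine (tsum_of_norm_bounded hsb.hasSum hbe).trans (le_of_eq ?_)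
  rw [tsum_mul_left, tsum_mul_left]
  ring

/-- Dividing the base by `-Re l > 0` gives a point tending to `-1`. The shift by `2πi` keeps it in
the upper half-plane for all `|Im l| ≤ π`, so its logarithm tends to `πi`, uniformly in the strip.
-/
theorem tendsto_cpow_stripBot (p : ℝ) :
    Tendsto (fun l : ℂ => (l + 2 * Real.pi * Complex.I) ^ (p : ℂ) * (((-l.re) ^ (-p) : ℝ) : ℂ))
      stripBot (𝓝 (Complex.exp (Real.pi * Complex.I * p))) := by
  have hpi := Real.pi_pos
  have hx := tendsto_neg_re_stripBot
  have hinv : Tendsto (fun l : ℂ => (-l.re)⁻¹) stripBot (𝓝 0) := tendsto_inv_atTop_zero.comp hx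
  have hlim : Tendsto (fun l : ℂ => -1 + (((l.im + 2 * Real.pi) * (-l.re)⁻¹ : ℝ) : ℂ) * Complex.I)
      stripBot (𝓝[{z : ℂ | 0 ≤ z.im}] (-1)) := by
    refine tendsto_nhdsWithin_iff.2 ⟨?_, ?_⟩
    · have h1 : Tendsto (fun l : ℂ => (l.im + 2 * Real.pi) * (-l.re)⁻¹) stripBot (𝓝 0) := by
        refine squeeze_zero_norm' (a := fun l : ℂ => 3 * Real.pi * (-l.re)⁻¹) ?_
          (by simpa using hinv.const_mul (3 * Real.pi))
        filter_upwards [abs_im_le_of_stripBot, hx.eventually_gt_atTop 0] with l hl hx0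
        rw [abs_le] at hl
        have : 0 ≤ (-l.re)⁻¹ := by positivity
        rw [norm_mul, Real.norm_of_nonneg this, Real.norm_eq_abs]
        refine mul_le_mul_of_nonneg_right ?_ this
        rw [abs_le]
        constructor <;> linarith
      have h2 := ((Complex.continuous_ofReal.tendsto 0).comp h1).mul_const Complex.I
      simpa using h2.const_add (-1)
    · filter_upwards [abs_im_le_of_stripBot, hx.eventually_gt_atTop 0] with l hl hx0
      rw [abs_le] at hl
      have h1 : 0 ≤ (l.im + 2 * Real.pi) * (-l.re)⁻¹ :=
        mul_nonneg (by linarith) (by positivity)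
      have h2 : (-1 + (((l.im + 2 * Real.pi) * (-l.re)⁻¹ : ℝ) : ℂ) * Complex.I).im =
          (l.im + 2 * Real.pi) * (-l.re)⁻¹ := by
        rw [Complex.add_im, Complex.im_ofReal_mul]
        simp
      exact h1.trans_eq h2.symm
  have hlog := (Complex.tendsto_log_nhdsWithin_im_nonneg_of_re_neg_of_im_zero (z := -1)
    (by simp) (by simp)).comp hlim
  have hexp := (Complex.continuous_exp.tendsto _).comp (hlog.mul_const (p : ℂ))
  have e : Complex.exp (((Real.log ‖(-1 : ℂ)‖ : ℝ) + Real.pi * Complex.I) * p) =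
      Complex.exp (Real.pi * Complex.I * p) := by simp
  rw [e] at hexp
  refine hexp.congr' ?_
  filter_upwards [abs_im_le_of_stripBot, hx.eventually_gt_atTop 0] with l hl hx0
  have hne : (-1 + (((l.im + 2 * Real.pi) * (-l.re)⁻¹ : ℝ) : ℂ) * Complex.I) ≠ 0 := by
    intro h
    have := congrArg Complex.re h
    simp at this
  have hfac : l + 2 * Real.pi * Complex.I = ((-l.re : ℝ) : ℂ) *
      (-1 + (((l.im + 2 * Real.pi) * (-l.re)⁻¹ : ℝ) : ℂ) * Complex.I) := by
    have h1 : (l.re : ℂ) ≠ 0 := by exact_mod_cast (neg_pos.1 hx0).ne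
    conv_lhs => rw [← Complex.re_add_im l]
    push_cast
    field_simp
    ring
  rw [hfac, Complex.cpow_def_of_ne_zero (mul_ne_zero (by exact_mod_cast hx0.ne') hne),
    Complex.log_ofReal_mul hx0 hne, Real.rpow_def_of_pos hx0]
  simp only [Function.comp_apply]
  rw [Complex.ofReal_exp, ← Complex.exp_add]
  congr 1
  push_cast
  ring

theorem tendsto_lipUpper_stripBot {a : ℝ} (ha : 1 < a) :
    Tendsto (fun l : ℂ => lipUpper a l * (((-l.re) ^ (a - 1) : ℝ) : ℂ)) stripBot
      (𝓝 (-(Complex.exp (Real.pi * Complex.I * (1 - a : ℝ)) / (2 * Real.pi * Complex.I * (1 - a))))) := by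
  obtain ⟨K, hK⟩ := lipUpper_sub_bound ha
  have hx := tendsto_neg_re_stripBot
  have h1 := (tendsto_cpow_stripBot (1 - a)).div_const (2 * Real.pi * Complex.I * (1 - a))
  have h2 : Tendsto (fun l : ℂ => (lipUpper a l + (l + 2 * Real.pi * Complex.I) ^ (1 - a : ℂ) /
      (2 * Real.pi * Complex.I * (1 - a))) * (((-l.re) ^ (a - 1) : ℝ) : ℂ)) stripBot (𝓝 0) := by
    have h3 : Tendsto (fun l : ℂ => K * (-l.re) ^ (-(1 / 2) : ℝ)) stripBot (𝓝 0) := by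
      have := (tendsto_rpow_neg_atTop (y := 1 / 2) (by norm_num)).comp hx
      simpa using this.const_mul K
    refine squeeze_zero_norm' ?_ h3
    filter_upwards [abs_im_le_of_stripBot, hx.eventually_gt_atTop 0] with l hl hx0
    rw [norm_mul, Complex.norm_real, Real.norm_of_nonneg (Real.rpow_nonneg hx0.le _)]
    have e : (-l.re) ^ (-(1 / 2) : ℝ) = (-l.re) ^ (1 / 2 - a) * (-l.re) ^ (a - 1) := by
      rw [← Real.rpow_add hx0]; congr 1; ring
    rw [e, ← mul_assoc]
    have := Real.rpow_nonneg hx0.le (a - 1)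
    gcongr
    exact hK l hl (by linarith)
  have h4 := h2.sub h1
  rw [zero_sub] at h4
  refine h4.congr fun l => ?_
  rw [neg_sub]
  push_cast
  ring

theorem tendsto_conj_stripBot : Tendsto (starRingEnd ℂ) stripBot stripBot := by
  refine tendsto_inf.2 ⟨?_, ?_⟩
  · refine tendsto_comap_iff.2 ?_
    refine (tendsto_comap.mono_left inf_le_left : Tendsto Complex.re stripBot atBot).congr fun l => ?_
    simp
  · refine tendsto_principal.2 ?_
    filter_upwards [abs_im_le_of_stripBot] with l hl
    simpa using hl

/-- The upper and lower halves contribute `κ` and its conjugate, and `2 Re κ` is a non-zero multiple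
of `sin(π(1 - a))`; this is why the sine must not vanish. -/
theorem exists_tendsto_polylog_exp_neg {a : ℝ} (ha : 1 < a) (ha3 : a < 3)
    (hsin : Real.sin (Real.pi * (1 - a)) ≠ 0) :
    ∃ c : ℂ, c ≠ 0 ∧ Tendsto (fun l : ℂ => polylog (1 - a) (Complex.exp (-l)) *
      (((-l.re) ^ (a - 1) : ℝ) : ℂ)) (stripBot ⊓ 𝓟 Complex.slitPlane) (𝓝 c) := by
  have hx := tendsto_neg_re_stripBot
  set κ : ℂ := -(Complex.exp (Real.pi * Complex.I * (1 - a : ℝ)) / (2 * Real.pi * Complex.I * (1 - a)))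
    with hκ
  have hT := tendsto_lipUpper_stripBot ha
  have hTc := (Complex.continuous_conj.tendsto κ).comp (hT.comp tendsto_conj_stripBot)
  -- The central term is smaller than the main order by a factor `(-Re l)⁻¹`.
  have h0 : Tendsto (fun l : ℂ => l ^ (-a : ℂ) * (((-l.re) ^ (a - 1) : ℝ) : ℂ)) stripBot (𝓝 0) := by
    refine squeeze_zero_norm' ?_ (tendsto_inv_atTop_zero.comp hx)
    filter_upwards [hx.eventually_gt_atTop 0] with l hx0
    rw [norm_mul, Complex.norm_real, Real.norm_of_nonneg (Real.rpow_nonneg hx0.le _),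
      ← Complex.ofReal_neg, Complex.norm_cpow_real]
    have h1 : -l.re ≤ ‖l‖ := (neg_le_abs _).trans (Complex.abs_re_le_norm _)
    have h2 := Real.rpow_le_rpow_of_nonpos (z := -a) hx0 h1 (by linarith)
    have e : (-l.re)⁻¹ = (-l.re) ^ (-a) * (-l.re) ^ (a - 1) := by
      rw [← Real.rpow_add hx0, ← Real.rpow_neg_one]; congr 1; ring
    simp only [Function.comp_apply]
    rw [e]
    have := Real.rpow_nonneg hx0.le (a - 1)
    gcongr
  have hsum := ((h0.add (hT.add hTc)).const_mul (Real.Gamma a : ℂ)).mono_left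
    (inf_le_left : stripBot ⊓ 𝓟 Complex.slitPlane ≤ stripBot)
  refine ⟨_, ?_, hsum.congr' ?_⟩
  · rw [zero_add]
    refine mul_ne_zero (by exact_mod_cast (Real.Gamma_pos_of_pos (by linarith)).ne') ?_
    rw [Complex.add_conj]
    have hre : κ.re = -(Real.sin (Real.pi * (1 - a)) / (2 * Real.pi * (1 - a))) := by
      have ha1 : (1 - a : ℂ) ≠ 0 := by
        rw [sub_ne_zero]; exact_mod_cast ha.ne
      have hpi : (Real.pi : ℂ) ≠ 0 := by exact_mod_cast Real.pi_ne_zero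
      have e1 : κ = Complex.exp (((Real.pi * (1 - a) : ℝ) : ℂ) * Complex.I) * Complex.I *
          (((2 * Real.pi * (1 - a))⁻¹ : ℝ) : ℂ) := by
        rw [hκ]
        push_cast
        field_simp
        rw [Complex.I_sq]
      rw [e1, Complex.re_mul_ofReal, Complex.mul_I_re, Complex.exp_ofReal_mul_I_im]
      ring
    rw [hre]
    have h1 : (1 - a) ≠ 0 := by linarith
    exact_mod_cast mul_ne_zero two_ne_zero (neg_ne_zero.2 (div_ne_zero hsin (by
      have := Real.pi_ne_zero
      positivity)))
  · filter_upwards [mem_inf_of_left abs_im_le_of_stripBot, mem_inf_of_right (mem_principal_self _)]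
      with l hl hsl
    rw [polylog_exp_neg ha ha3 (abs_im_lt_of_le_pi hl) hsl, lipRem_eq_lipUpper ha (abs_im_lt_of_le_pi hl)]
    simp only [Function.comp_apply, map_mul, Complex.conj_ofReal, Complex.conj_re]
    ring

/-! ### The cut plane, and `Q` near the origin and on the cut -/

theorem mem_unitCut {w : ℂ} : w ∈ unitCut ↔ w.im = 0 ∧ 0 ≤ w.re ∧ w.re ≤ 1 := by
  constructor
  · rintro ⟨t, ht, rfl⟩
    exact ⟨by simp, by simpa using ht.1, by simpa using ht.2⟩
  · rintro ⟨h1, h2, h3⟩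
    exact ⟨w.re, ⟨h2, h3⟩, Complex.ext (by simp) (by simp [h1])⟩

theorem mem_halfLine {w : ℂ} : w ∈ halfLine ↔ w.im = 0 ∧ 0 ≤ w.re := by
  constructor
  · rintro ⟨t, ht, rfl⟩
    exact ⟨by simp, by simpa using ht⟩
  · rintro ⟨h1, h2⟩
    exact ⟨w.re, h2, Complex.ext (by simp) (by simp [h1])⟩

theorem ne_zero_of_notMem_unitCut {w : ℂ} (hw : w ∉ unitCut) : w ≠ 0 := by
  rintro rfl
  exact hw (mem_unitCut.2 (by simp))

theorem notMem_unitCut_of_notMem_halfLine {w : ℂ} (hw : w ∉ halfLine) : w ∉ unitCut := fun h =>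
  hw (mem_halfLine.2 ⟨(mem_unitCut.1 h).1, (mem_unitCut.1 h).2.1⟩)

theorem abs_log_im_le_pi (w : ℂ) : |(Complex.log w).im| ≤ Real.pi := by
  rw [Complex.log_im]
  exact Complex.abs_arg_le_pi w

theorem log_mem_slitPlane {w : ℂ} (hw : w ∉ unitCut) : Complex.log w ∈ Complex.slitPlane := by
  have hw0 := ne_zero_of_notMem_unitCut hw
  rw [Complex.mem_slitPlane_iff]
  by_contra! h
  have e : w = ((Real.exp (Complex.log w).re : ℝ) : ℂ) := by
    conv_lhs => rw [← Complex.exp_log hw0]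
    rw [Complex.ofReal_exp]
    congr 1
    exact Complex.ext (by simp) (by rw [Complex.ofReal_im]; exact h.2)
  refine hw ⟨_, ⟨(Real.exp_pos _).le, ?_⟩, e.symm⟩
  rw [← Real.exp_zero]
  exact Real.exp_le_exp.2 h.1

theorem one_sub_mem_slitPlane_of_norm_lt_one {w : ℂ} (hw : ‖w‖ < 1) : 1 - w ∈ Complex.slitPlane := by
  left
  have := (Complex.abs_re_le_norm w).trans_lt hw
  rw [abs_lt] at this
  simpa using this.2

theorem one_sub_inv_mem_slitPlane {w : ℂ} (hw : w ∉ unitCut) : 1 - w⁻¹ ∈ Complex.slitPlane := by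
  have h := one_sub_exp_neg_mem_slitPlane (l := Complex.log w)
    (abs_im_lt_of_le_pi (abs_log_im_le_pi w)) (log_mem_slitPlane hw)
  rwa [Complex.exp_neg, Complex.exp_log (ne_zero_of_notMem_unitCut hw)] at h

/-- The principal logarithm has `|Im| ≤ π`, inside the strip of Lipschitz' formula, so the formula
covers the whole complement of `[0, 1]`, including negative `w`, where the logarithm itself is
discontinuous. -/
theorem polylog_inv_eq {a : ℝ} (ha : 1 < a) (ha3 : a < 3) {w : ℂ} (hw : w ∉ unitCut) :
    polylog (1 - a) w⁻¹ =
      Real.Gamma a * ((Complex.log w) ^ (-a : ℂ) + lipRem a (Complex.log w)) := by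
  have h := polylog_exp_neg ha ha3 (l := Complex.log w)
    (abs_im_lt_of_le_pi (abs_log_im_le_pi w)) (log_mem_slitPlane hw)
  rwa [Complex.exp_neg, Complex.exp_log (ne_zero_of_notMem_unitCut hw)] at h

theorem tendsto_neg_log_norm : Tendsto (fun w : ℂ => -Real.log ‖w‖) (𝓝[unitCutᶜ] 0) atTop := by
  have h1 : Tendsto (fun w : ℂ => ‖w‖) (𝓝[unitCutᶜ] 0) (𝓝[≠] 0) := by
    refine tendsto_nhdsWithin_iff.2 ⟨?_, ?_⟩
    · exact (continuous_norm.tendsto' (0 : ℂ) 0 norm_zero).mono_left nhdsWithin_le_nhds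
    · filter_upwards [self_mem_nhdsWithin] with w hw
      simpa using ne_zero_of_notMem_unitCut hw
  exact tendsto_neg_atBot_atTop.comp (Real.tendsto_log_nhdsNE_zero.comp h1)

theorem tendsto_log_stripBot :
    Tendsto Complex.log (𝓝[unitCutᶜ] 0) (stripBot ⊓ 𝓟 Complex.slitPlane) := by
  refine tendsto_inf.2 ⟨tendsto_inf.2 ⟨?_, ?_⟩, ?_⟩
  · rw [tendsto_comap_iff]
    have := tendsto_neg_atTop_atBot.comp tendsto_neg_log_norm
    refine this.congr fun w => ?_
    simp [Complex.log_re]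
  · exact tendsto_principal.2 (Eventually.of_forall fun w => abs_log_im_le_pi w)
  · refine tendsto_principal.2 ?_
    filter_upwards [self_mem_nhdsWithin] with w hw
    exact log_mem_slitPlane hw

theorem polylog_zero (s : ℝ) : polylog s 0 = 0 := by
  simp [polylog]

theorem tendsto_mul_neg_log_norm_rpow (b : ℝ) :
    Tendsto (fun w : ℂ => w * (((-Real.log ‖w‖) ^ b : ℝ) : ℂ)) (𝓝[unitCutᶜ] 0) (𝓝 0) := by
  rw [tendsto_zero_iff_norm_tendsto_zero]
  refine ((tendsto_rpow_mul_exp_neg_mul_atTop_nhds_zero b 1 one_pos).comp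
    tendsto_neg_log_norm).congr' ?_
  filter_upwards [self_mem_nhdsWithin, tendsto_neg_log_norm.eventually_gt_atTop 0] with w hw hx
  have hw0 : 0 < ‖w‖ := norm_pos_iff.2 (ne_zero_of_notMem_unitCut hw)
  simp only [Function.comp_apply]
  rw [norm_mul, Complex.norm_real, Real.norm_of_nonneg (Real.rpow_nonneg hx.le _), mul_comm]
  congr 1
  rw [neg_mul_neg, one_mul, Real.exp_log hw0]

/-- The leading behaviour of `Q` at the origin. -/
theorem exists_tendsto_mul_Q {d : ℝ} (hd₁ : -(1 / 2) < d) (hd₂ : d < 1 / 2) (hd₀ : d ≠ 0) :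
    ∃ c : ℂ, c ≠ 0 ∧ Tendsto (fun w : ℂ => w * Q d w * (((-Real.log ‖w‖) ^ (2 * d + 1) : ℝ) : ℂ))
      (𝓝[unitCutᶜ] 0) (𝓝 c) := by
  have hpi := Real.pi_pos
  set a : ℝ := 2 * d + 2 with ha
  have ea : -2 * d - 1 = 1 - a := by rw [ha]; ring
  have ea2 : 2 * d + 1 = a - 1 := by rw [ha]; ring
  -- The sine equals `sin(2πd)`, non-zero because `0 < |2d| < 1`.
  have hsin : Real.sin (Real.pi * (1 - a)) ≠ 0 := by
    have e : Real.pi * (1 - a) = -(2 * d * Real.pi) - Real.pi := by rw [ha]; ring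
    rw [e, Real.sin_sub_pi, Real.sin_neg, neg_neg]
    rw [Ne, Real.sin_eq_zero_iff_of_lt_of_lt (by nlinarith) (by nlinarith)]
    exact mul_ne_zero (mul_ne_zero two_ne_zero hd₀) hpi.ne'
  obtain ⟨c, hc, hlim⟩ := exists_tendsto_polylog_exp_neg (a := a) (by linarith) (by linarith) hsin
  have h1 := hlim.comp tendsto_log_stripBot
  -- `Li(w) = O(w)` beats every power of the logarithm, so only `Li(w⁻¹)` contributes to the limit.
  have h2 : Tendsto (fun w : ℂ => polylog (1 - a) w * (((-Real.log ‖w‖) ^ (2 * d + 1) : ℝ) : ℂ))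
      (𝓝[unitCutᶜ] 0) (𝓝 0) := by
    have hO : polylog (1 - a) =O[𝓝[unitCutᶜ] 0] fun w : ℂ => w := by
      have := (differentiableAt_polylog (s := 1 - a) (z := 0) (by linarith) (by simp)).isBigO_sub
      simp only [polylog_zero, sub_zero] at this
      exact this.mono nhdsWithin_le_nhds
    exact (hO.mul (Asymptotics.isBigO_refl _ _)).trans_tendsto (tendsto_mul_neg_log_norm_rpow _)
  have h5 : Tendsto (fun w : ℂ => 1 / (4 * (Real.pi : ℂ)) * (1 - 2 * w + w ^ 2)) (𝓝[unitCutᶜ] 0)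
      (𝓝 (1 / (4 * (Real.pi : ℂ)))) := by
    have : Continuous fun w : ℂ => 1 / (4 * (Real.pi : ℂ)) * (1 - 2 * w + w ^ 2) := by fun_prop
    exact (this.tendsto' 0 _ (by simp)).mono_left nhdsWithin_le_nhds
  have h6 := h5.mul (h2.add h1)
  refine ⟨_, ?_, h6.congr' ?_⟩
  · rw [zero_add]
    refine mul_ne_zero (div_ne_zero one_ne_zero (mul_ne_zero (by norm_num) ?_)) hc
    exact_mod_cast hpi.ne'
  · filter_upwards [self_mem_nhdsWithin] with w hw
    have hw0 := ne_zero_of_notMem_unitCut hw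
    simp only [Function.comp_apply]
    rw [Complex.exp_neg, Complex.exp_log hw0, Complex.log_re, ← ea2, Q, ea]
    field_simp

theorem Q_inv (d : ℝ) (w : ℂ) : Q d w⁻¹ = Q d w := by
  simp only [Q, inv_inv]
  ring

theorem notMem_halfLine_of_im_ne_zero {w : ℂ} (hw : w.im ≠ 0) : w ∉ halfLine := fun h =>
  hw (mem_halfLine.1 h).1

theorem eventually_fromAbove (t : ℝ) : ∀ᶠ w in fromAbove t, w ∉ halfLine := by
  filter_upwards [self_mem_nhdsWithin] with w (hw : 0 < w.im)
  exact notMem_halfLine_of_im_ne_zero hw.ne'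

theorem eventually_fromBelow (t : ℝ) : ∀ᶠ w in fromBelow t, w ∉ halfLine := by
  filter_upwards [self_mem_nhdsWithin] with w (hw : w.im < 0)
  exact notMem_halfLine_of_im_ne_zero hw.ne

/-- By Lipschitz' formula in `log w`, the only factor discontinuous across `(0, 1)` is `(log
w)^{-a}`, since `log t` lies on the negative axis: `log (log w)` tends to `log |log t| ± πi` from
the two sides. -/
theorem exists_tendsto_Q {d : ℝ} (hd₁ : -(1 / 2) < d) (hd₂ : d < 1 / 2) (hd₀ : d ≠ 0) {t : ℝ}
    (ht : t ∈ Set.Ioo (0 : ℝ) 1) : ∃ Qp Qm : ℂ, Tendsto (Q d) (fromAbove t) (𝓝 Qp) ∧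
      Tendsto (Q d) (fromBelow t) (𝓝 Qm) ∧ Qm ≠ 0 := by
  have hpi := Real.pi_pos
  set a : ℝ := 2 * d + 2 with ha
  have ea : -2 * d - 1 = 1 - a := by rw [ha]; ring
  have ha1 : 1 < a := by linarith
  have ha3 : a < 3 := by linarith
  have ht0 : (t : ℂ) ≠ 0 := by exact_mod_cast ht.1.ne'
  have hlogneg : Real.log t < 0 := Real.log_neg ht.1 ht.2
  have hlog : ContinuousAt Complex.log (t : ℂ) := continuousAt_clog (by simp [ht.1])
  have hlogt : Complex.log (t : ℂ) = (Real.log t : ℂ) := (Complex.ofReal_log ht.1.le).symm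
  have hstrip : Complex.log (t : ℂ) ∈ {l : ℂ | |l.im| < 3 * Real.pi / 2} := by
    rw [hlogt]; simp [hpi]
  have hrem : ContinuousAt (fun w : ℂ => lipRem a (Complex.log w)) (t : ℂ) :=
    ContinuousAt.comp (g := lipRem a)
      ((differentiableOn_lipRem ha1).differentiableAt (isOpen_strip.mem_nhds hstrip)).continuousAt hlog
  have hLi : ContinuousAt (polylog (1 - a)) (t : ℂ) :=
    (differentiableAt_polylog (by linarith) (by left; simpa using ht.2)).continuousAt
  have hfac : ContinuousAt (fun w : ℂ => 1 / (4 * (Real.pi : ℂ)) * (w⁻¹ - 2 + w)) (t : ℂ) :=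
    ((((continuousAt_id.inv₀ ht0)).sub continuousAt_const).add continuousAt_id).const_mul _
  have main : ∀ (F : Filter ℂ) (m : ℂ), F ≤ 𝓝 (t : ℂ) → (∀ᶠ w in F, w ∉ halfLine) →
      Tendsto (fun w => Complex.log (Complex.log w)) F (𝓝 m) →
      Tendsto (Q d) F (𝓝 (1 / (4 * (Real.pi : ℂ)) * ((t : ℂ)⁻¹ - 2 + t) *
        (polylog (1 - a) t + Real.Gamma a * (Complex.exp (m * -a) + lipRem a (Complex.log t))))) := by
    intro F m hF hev hm
    have h1 := (Complex.continuous_exp.tendsto _).comp (hm.mul_const (-a : ℂ))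
    have h2 := (hfac.tendsto.mono_left hF).mul ((hLi.tendsto.mono_left hF).add
      ((h1.add (hrem.tendsto.mono_left hF)).const_mul (Real.Gamma a : ℂ)))
    refine h2.congr' ?_
    filter_upwards [hev] with w hw
    have hw' := notMem_unitCut_of_notMem_halfLine hw
    rw [Q, ea, polylog_inv_eq ha1 ha3 hw',
      Complex.cpow_def_of_ne_zero (Complex.slitPlane_ne_zero (log_mem_slitPlane hw'))]
    rfl
  have hre : (Complex.log (t : ℂ)).re < 0 := by rw [hlogt]; simpa using hlogneg
  have him : (Complex.log (t : ℂ)).im = 0 := by rw [hlogt]; simp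
  have hup : Tendsto Complex.log (fromAbove t) (𝓝[{z : ℂ | 0 ≤ z.im}] (Complex.log t)) := by
    refine tendsto_nhdsWithin_iff.2 ⟨hlog.tendsto.mono_left nhdsWithin_le_nhds, ?_⟩
    filter_upwards [self_mem_nhdsWithin] with w (hw : 0 < w.im)
    simp only [Complex.log_im]
    exact Complex.arg_nonneg_iff.2 hw.le
  have hdown : Tendsto Complex.log (fromBelow t) (𝓝[{z : ℂ | z.im < 0}] (Complex.log t)) := by
    refine tendsto_nhdsWithin_iff.2 ⟨hlog.tendsto.mono_left nhdsWithin_le_nhds, ?_⟩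
    filter_upwards [self_mem_nhdsWithin] with w (hw : w.im < 0)
    simp only [Complex.log_im]
    exact Complex.arg_neg_iff.2 hw
  refine ⟨_, _, main _ _ nhdsWithin_le_nhds (eventually_fromAbove t)
    ((Complex.tendsto_log_nhdsWithin_im_nonneg_of_re_neg_of_im_zero hre him).comp hup),
    main _ _ nhdsWithin_le_nhds (eventually_fromBelow t)
    ((Complex.tendsto_log_nhdsWithin_im_neg_of_re_neg_of_im_zero hre him).comp hdown), ?_⟩
  refine mul_ne_zero (mul_ne_zero (one_div_ne_zero (mul_ne_zero (by norm_num)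
    (by exact_mod_cast hpi.ne'))) ?_) ?_
  · have e : (t : ℂ)⁻¹ - 2 + t = (((1 - t) ^ 2 / t : ℝ) : ℂ) := by
      push_cast
      field_simp
      ring
    rw [e]
    exact_mod_cast (div_pos (pow_pos (by linarith [ht.2]) 2) ht.1).ne'
  -- `Li(t)` and the remainder at `log t` are real by conjugation symmetry, so the imaginary part of
  -- the lower limit comes from the central term alone and is a non-zero multiple of `sin(πa) =
  -- sin(2πd)`.
  · intro h0
    have hP : (polylog (1 - a) (t : ℂ)).im = 0 := by
      rw [← Complex.conj_eq_iff_im, ← polylog_conj, Complex.conj_ofReal]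
    have hR : (lipRem a (Complex.log (t : ℂ))).im = 0 := by
      rw [← Complex.conj_eq_iff_im, ← lipRem_conj a hstrip, hlogt, Complex.conj_ofReal]
    have h1 := congrArg Complex.im h0
    rw [Complex.add_im, hP, Complex.im_ofReal_mul, Complex.add_im, hR, Complex.exp_im] at h1
    have e : (((Real.log ‖Complex.log (t : ℂ)‖ : ℝ) : ℂ) - Real.pi * Complex.I) * -(a : ℂ) =
      ((-(Real.log ‖Complex.log (t : ℂ)‖ * a) : ℝ) : ℂ) + ((Real.pi * a : ℝ) : ℂ) * Complex.I := by
      push_cast; ring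
    have e2 : ((((Real.log ‖Complex.log (t : ℂ)‖ : ℝ) : ℂ) - Real.pi * Complex.I) * -(a : ℂ)).im =
        Real.pi * a := by
      rw [e, Complex.add_im, Complex.ofReal_im, Complex.im_ofReal_mul]
      simp
    rw [e2] at h1
    have hG := Real.Gamma_pos_of_pos (by linarith : 0 < a)
    have hs : Real.sin (Real.pi * a) ≠ 0 := by
      have e : Real.pi * a = 2 * d * Real.pi + 2 * Real.pi := by rw [ha]; ring
      rw [e, Real.sin_add_two_pi, Ne, Real.sin_eq_zero_iff_of_lt_of_lt (by nlinarith) (by nlinarith)]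
      exact mul_ne_zero (mul_ne_zero two_ne_zero hd₀) hpi.ne'
    simp only [zero_add, add_zero, Complex.zero_im, mul_eq_zero, hG.ne', hs, Real.exp_ne_zero,
      or_self] at h1

/-! ### Fourier coefficients of `f₀` -/

/-- The standard parametrization of the unit circle. -/
noncomputable abbrev circ (l : ℝ) : ℂ := Complex.exp (Complex.I * l)

/-- The interval `(-π, π]` with Lebesgue measure. -/
noncomputable abbrev arcMeasure : Measure ℝ := volume.restrict (Set.Ioc (-Real.pi) Real.pi)

theorem norm_circ (l : ℝ) : ‖circ l‖ = 1 := by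
  rw [circ, mul_comm]; exact Complex.norm_exp_ofReal_mul_I l

theorem circ_ne_zero (l : ℝ) : circ l ≠ 0 := Complex.exp_ne_zero _

theorem circ_neg (l : ℝ) : circ (-l) = (circ l)⁻¹ := by
  simp only [circ]
  rw [← Complex.exp_neg]
  push_cast
  ring_nf

theorem conj_circ (l : ℝ) : starRingEnd ℂ (circ l) = (circ l)⁻¹ :=
  (Complex.inv_eq_conj (norm_circ l)).symm

theorem continuous_circ : Continuous circ := by
  unfold circ; fun_prop

theorem continuous_circ_zpow (k : ℤ) : Continuous fun l => circ l ^ k :=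
  continuous_circ.zpow₀ k fun l => Or.inl (circ_ne_zero l)

theorem norm_circ_zpow (l : ℝ) (k : ℤ) : ‖circ l ^ k‖ = 1 := by
  rw [norm_zpow, norm_circ, one_zpow]

theorem ae_arc : ∀ᵐ l ∂arcMeasure, l ≠ 0 ∧ |l| ≤ Real.pi := by
  have h0 : ∀ᵐ l ∂arcMeasure, l ≠ 0 := ae_restrict_of_ae (Measure.ae_ne volume 0)
  filter_upwards [h0, ae_restrict_mem measurableSet_Ioc] with l hl hm
  exact ⟨hl, abs_le.2 ⟨hm.1.le, hm.2⟩⟩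

theorem integral_circ_zpow (k : ℤ) :
    ∫ l, circ l ^ k ∂arcMeasure = if k = 0 then (2 * Real.pi : ℂ) else 0 := by
  rw [← intervalIntegral.integral_of_le (by linarith [Real.pi_pos])]
  split_ifs with hk
  · subst hk
    simp
    ring
  · have hc : Complex.I * k ≠ 0 := mul_ne_zero Complex.I_ne_zero (by exact_mod_cast hk)
    have e : ∀ l : ℝ, circ l ^ k = Complex.exp ((Complex.I * k) * l) := by
      intro l
      rw [circ, ← Complex.exp_int_mul]
      congr 1; ring
    simp only [e]
    rw [integral_exp_mul_complex hc, div_eq_zero_iff]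
    left
    rw [sub_eq_zero, Complex.exp_eq_exp_iff_exists_int]
    exact ⟨k, by push_cast; ring⟩

theorem integrable_abs_rpow {p : ℝ} (hp : -1 < p) : Integrable (fun l : ℝ => |l| ^ p) arcMeasure := by
  have hpi := Real.pi_pos
  have h1 : IntervalIntegrable (fun l : ℝ => |l| ^ p) volume 0 Real.pi := by
    refine (intervalIntegral.intervalIntegrable_rpow' hp).congr fun x hx => ?_
    rw [Set.uIoc_of_le hpi.le] at hx
    simp only [abs_of_pos hx.1]
  have h2 : IntervalIntegrable (fun l : ℝ => |l| ^ p) volume (-Real.pi) 0 := by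
    rw [IntervalIntegrable.iff_comp_neg]
    simpa using h1.symm
  have h3 := h2.trans h1
  rwa [intervalIntegrable_iff_integrableOn_Ioc_of_le (by linarith)] at h3

theorem norm_one_sub_circ_ge {l : ℝ} (hl : |l| ≤ Real.pi) :
    2 / Real.pi * |l| ≤ ‖1 - circ l‖ := by
  rw [norm_sub_rev, circ, Complex.norm_exp_I_mul_ofReal_sub_one, Real.norm_eq_abs, abs_mul, abs_two]
  have h := Real.mul_abs_le_abs_sin (x := l / 2) (by rw [abs_div, abs_two]; linarith)
  rw [abs_div, abs_two] at h
  calc 2 / Real.pi * |l| = 2 * (2 / Real.pi * (|l| / 2)) := by ring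
    _ ≤ _ := by gcongr

theorem norm_one_sub_circ_le (l : ℝ) : ‖1 - circ l‖ ≤ 2 := by
  refine (norm_sub_le _ _).trans ?_
  rw [norm_circ, norm_one]; norm_num

theorem one_sub_mem_slitPlane_of_norm_le_one {z : ℂ} (hz : ‖z‖ ≤ 1) (hz1 : z ≠ 1) :
    1 - z ∈ Complex.slitPlane := by
  rw [Complex.mem_slitPlane_iff]
  by_contra! h
  obtain ⟨h1, h2⟩ := h
  simp only [Complex.sub_re, Complex.one_re, Complex.sub_im, Complex.one_im] at h1 h2
  have h3 := (Complex.abs_re_le_norm z).trans hz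
  rw [abs_le] at h3
  exact hz1 (Complex.ext (by simp; linarith) (by simp; linarith))

/-- The local estimate at `1` combined with compactness of the closed disk with a neighbourhood of
`1` removed; there `|1 - z| ≤ 2` keeps the weight `|1 - z|^{-a}` bounded below. -/
theorem exists_norm_polylog_le {a : ℝ} (ha : 1 < a) (ha3 : a < 3) :
    ∃ C : ℝ, 0 ≤ C ∧ ∀ z : ℂ, ‖z‖ ≤ 1 → z ≠ 1 → ‖polylog (1 - a) z‖ ≤ C * ‖1 - z‖ ^ (-a) := by
  obtain ⟨C, hC⟩ := (polylog_isBigO_one ha ha3).bound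
  rw [eventually_nhdsWithin_iff, Metric.eventually_nhds_iff] at hC
  obtain ⟨ε, hε, hball⟩ := hC
  have hK : IsCompact (Metric.closedBall (0 : ℂ) 1 ∩ {z | ε ≤ dist z 1}) :=
    (isCompact_closedBall _ _).inter_right (isClosed_le continuous_const (by fun_prop))
  have hcont : ContinuousOn (polylog (1 - a)) (Metric.closedBall (0 : ℂ) 1 ∩ {z | ε ≤ dist z 1}) := by
    intro z hz
    refine (differentiableAt_polylog (by linarith) (one_sub_mem_slitPlane_of_norm_le_one
      (by simpa using hz.1) ?_)).continuousAt.continuousWithinAt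
    rintro rfl
    have : ε ≤ dist (1 : ℂ) 1 := hz.2
    rw [dist_self] at this
    linarith
  obtain ⟨C', hC'⟩ := hK.exists_bound_of_continuousOn hcont
  refine ⟨max (max C (C' * 2 ^ a)) 0, le_max_right _ _, fun z hz hz1 => ?_⟩
  have hpos : 0 < ‖1 - z‖ := norm_pos_iff.2 (sub_ne_zero.2 hz1.symm)
  have hp := Real.rpow_nonneg hpos.le (-a)
  rcases lt_or_ge (dist z 1) ε with h | h
  · have := hball h (one_sub_mem_slitPlane_of_norm_le_one hz hz1)
    rw [Real.norm_of_nonneg hp] at this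
    refine this.trans ?_
    gcongr
    exact (le_max_left _ _).trans (le_max_left _ _)
  · have h1 := hC' z ⟨by simpa using hz, h⟩
    have h0 : 0 ≤ C' := (norm_nonneg _).trans h1
    have h2 : ‖1 - z‖ ≤ 2 := (norm_sub_le _ _).trans (by rw [norm_one]; linarith)
    have h3 : (2 : ℝ) ^ (-a) ≤ ‖1 - z‖ ^ (-a) :=
      Real.rpow_le_rpow_of_nonpos hpos h2 (by linarith)
    have e : C' = C' * 2 ^ a * 2 ^ (-a) := by
      rw [mul_assoc, ← Real.rpow_add two_pos]; simp
    calc _ ≤ C' := h1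
      _ = C' * 2 ^ a * 2 ^ (-a) := e
      _ ≤ max (max C (C' * 2 ^ a)) 0 * ‖1 - z‖ ^ (-a) := by
          gcongr
          exact (le_max_right _ _).trans (le_max_left _ _)

/-- Regularization of the spectral density `f0` by evaluating the polylogarithms inside the disk. -/
noncomputable def regDensity (a r : ℝ) (l : ℝ) : ℂ :=
  1 / (4 * (Real.pi : ℂ)) * ((circ l)⁻¹ - 2 + circ l) *
    (polylog (1 - a) (r * circ l) + polylog (1 - a) (r * (circ l)⁻¹))

theorem norm_inv_sub_two_add_circ (l : ℝ) : ‖(circ l)⁻¹ - 2 + circ l‖ = ‖1 - circ l‖ ^ 2 := by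
  have e : (circ l)⁻¹ - 2 + circ l = (1 - circ l) ^ 2 * (circ l)⁻¹ := by
    have := circ_ne_zero l
    field_simp
    ring
  rw [e, norm_mul, norm_inv, norm_circ, norm_pow]
  simp

theorem norm_ofReal_mul_of_norm_one {r : ℝ} (hr0 : 0 ≤ r) {u : ℂ} (hu : ‖u‖ = 1) :
    ‖(r : ℂ) * u‖ = r := by
  rw [norm_mul, hu, mul_one, Complex.norm_real, Real.norm_of_nonneg hr0]

/-- Since `|1 - u| ≤ 2 |1 - ru|` for `|u| = 1`, the polylogarithms are bounded by `|1 - u|^{-a}`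
uniformly in `r`. The factor `|1 - u|²` leaves the exponent `2 - a > -1`, which is integrable. -/
theorem exists_norm_regDensity_le {a : ℝ} (ha : 1 < a) (ha3 : a < 3) :
    ∃ b : ℝ → ℝ, Integrable b arcMeasure ∧ ∀ r : ℝ, 0 ≤ r → r < 1 → ∀ l : ℝ, l ≠ 0 → |l| ≤ Real.pi →
      ‖regDensity a r l‖ ≤ b l := by
  obtain ⟨C, hC0, hC⟩ := exists_norm_polylog_le ha ha3
  have hpi := Real.pi_pos
  have key : ∀ r : ℝ, 0 ≤ r → r < 1 → ∀ u : ℂ, ‖u‖ = 1 → u ≠ 1 →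
      ‖polylog (1 - a) (r * u)‖ ≤ C * 2 ^ a * ‖1 - u‖ ^ (-a) := by
    intro r hr0 hr1 u hu hu1
    have hn := norm_ofReal_mul_of_norm_one hr0 hu
    refine (hC _ (by rw [hn]; exact hr1.le) (fun h => ?_)).trans ?_
    · rw [h, norm_one] at hn
      linarith
    · have hpos : 0 < ‖1 - u‖ := norm_pos_iff.2 (sub_ne_zero.2 hu1.symm)
      have h1 : 1 - r ≤ ‖1 - (r : ℂ) * u‖ := by
        have := norm_sub_norm_le 1 ((r : ℂ) * u)
        rwa [hn, norm_one] at this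
      have h2 : ‖1 - u‖ ≤ ‖1 - (r : ℂ) * u‖ + (1 - r) := by
        have e : 1 - u = (1 - (r : ℂ) * u) - ((1 - r : ℝ) : ℂ) * u := by push_cast; ring
        rw [e]
        refine (norm_sub_le _ _).trans ?_
        rw [norm_ofReal_mul_of_norm_one (by linarith) hu]
      have h3 : ‖1 - (r : ℂ) * u‖ ^ (-a) ≤ (‖1 - u‖ / 2) ^ (-a) :=
        Real.rpow_le_rpow_of_nonpos (by positivity) (by linarith) (by linarith)
      have e : (‖1 - u‖ / 2) ^ (-a) = 2 ^ a * ‖1 - u‖ ^ (-a) := by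
        rw [Real.div_rpow hpos.le two_pos.le, Real.rpow_neg two_pos.le]
        field_simp
      rw [e] at h3
      rw [mul_assoc]
      gcongr
  -- The two summands cover the two signs of `2 - a`: for a non-positive exponent the lower bound
  -- `2|l|/π ≤ |1 - u|` is used, otherwise the upper bound `|1 - u| ≤ 2`.
  refine ⟨fun l => 1 / (4 * Real.pi) * (2 * (C * 2 ^ a)) *
    ((2 / Real.pi) ^ (2 - a) * |l| ^ (2 - a) + 2 ^ (2 - a)), ?_, ?_⟩
  · exact (((integrable_abs_rpow (by linarith)).const_mul _).add (integrable_const _)).const_mul _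
  · intro r hr0 hr1 l hl hl'
    have hge := norm_one_sub_circ_ge hl'
    have hlp : 0 < |l| := abs_pos.2 hl
    have hpos : 0 < ‖1 - circ l‖ := lt_of_lt_of_le (by positivity) hge
    have hne : circ l ≠ 1 := fun h => by simp [h] at hpos
    have h1 := key r hr0 hr1 _ (norm_circ l) hne
    have h2 := key r hr0 hr1 (circ l)⁻¹ (by rw [norm_inv, norm_circ, inv_one])
      (by rwa [Ne, inv_eq_one])
    have e : ‖1 - (circ l)⁻¹‖ = ‖1 - circ l‖ := by
      rw [← conj_circ, ← Complex.norm_conj (1 - circ l), map_sub, map_one]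
    rw [e] at h2
    have h3 : ‖1 - circ l‖ ^ (2 - a) ≤
        (2 / Real.pi) ^ (2 - a) * |l| ^ (2 - a) + 2 ^ (2 - a) := by
      rw [← Real.mul_rpow (by positivity) hlp.le]
      rcases le_total (2 - a) 0 with h | h
      · have := Real.rpow_le_rpow_of_nonpos (by positivity) hge h
        have := Real.rpow_nonneg two_pos.le (2 - a)
        linarith
      · have := Real.rpow_le_rpow hpos.le (norm_one_sub_circ_le l) h
        have : 0 ≤ (2 / Real.pi * |l|) ^ (2 - a) := by positivity
        linarith
    have h4 : ‖1 - circ l‖ ^ (2 - a) = ‖1 - circ l‖ ^ 2 * ‖1 - circ l‖ ^ (-a) := by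
      rw [← Real.rpow_natCast, ← Real.rpow_add hpos]
      congr 1
    rw [regDensity, norm_mul, norm_mul, norm_inv_sub_two_add_circ]
    have e1 : ‖(1 / (4 * (Real.pi : ℂ)))‖ = 1 / (4 * Real.pi) := by
      simp [abs_of_pos hpi]
    rw [e1]
    calc _ ≤ 1 / (4 * Real.pi) * ‖1 - circ l‖ ^ 2 * (C * 2 ^ a * ‖1 - circ l‖ ^ (-a) +
          C * 2 ^ a * ‖1 - circ l‖ ^ (-a)) := by
          gcongr
          exact (norm_add_le _ _).trans (add_le_add h1 h2)
      _ = 1 / (4 * Real.pi) * (2 * (C * 2 ^ a)) * ‖1 - circ l‖ ^ (2 - a) := by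
          rw [h4]; ring
      _ ≤ _ := mul_le_mul_of_nonneg_left h3 (by positivity)

theorem continuous_regDensity {a : ℝ} (ha3 : a < 3) {r : ℝ} (hr0 : 0 ≤ r) (hr1 : r < 1) :
    Continuous (regDensity a r) := by
  have hinv : Continuous fun l => (circ l)⁻¹ := continuous_circ.inv₀ circ_ne_zero
  have key : ∀ g : ℝ → ℂ, Continuous g → (∀ l, ‖g l‖ = 1) →
      Continuous fun l => polylog (1 - a) (r * g l) := by
    intro g hg hn
    rw [continuous_iff_continuousAt]
    intro l
    have h := differentiableAt_polylog (s := 1 - a) (z := r * g l) (by linarith)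
      (one_sub_mem_slitPlane_of_norm_lt_one (by rwa [norm_ofReal_mul_of_norm_one hr0 (hn l)]))
    exact ContinuousAt.comp (g := polylog (1 - a)) h.continuousAt
      (continuous_const.mul hg).continuousAt
  unfold regDensity
  exact (continuous_const.mul ((hinv.sub continuous_const).add continuous_circ)).mul
    ((key _ continuous_circ norm_circ).add
      (key _ hinv fun l => by rw [norm_inv, norm_circ, inv_one]))

theorem tendsto_regDensity {d : ℝ} (hd₁ : -(1 / 2) < d) (hd₂ : d < 1 / 2) {l : ℝ} (hl : l ≠ 0)
    (hl' : |l| ≤ Real.pi) :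
    Tendsto (fun r => regDensity (2 * d + 2) r l) (𝓝[<] 1) (𝓝 (f0 d l : ℂ)) := by
  have hpos : 0 < ‖1 - circ l‖ :=
    lt_of_lt_of_le (mul_pos (div_pos two_pos Real.pi_pos) (abs_pos.2 hl)) (norm_one_sub_circ_ge hl')
  have hne : circ l ≠ 1 := fun h => by simp [h] at hpos
  have key : ∀ u : ℂ, ‖u‖ = 1 → u ≠ 1 → Tendsto (fun r : ℝ => polylog (1 - (2 * d + 2)) (r * u))
      (𝓝[<] 1) (𝓝 (polylog (1 - (2 * d + 2)) u)) := by
    intro u hu hu1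
    have h := (differentiableAt_polylog (s := 1 - (2 * d + 2)) (z := u) (by linarith)
      (one_sub_mem_slitPlane_of_norm_le_one hu.le hu1)).continuousAt.tendsto
    have h2 : Tendsto (fun r : ℝ => (r : ℂ) * u) (𝓝[<] 1) (𝓝 u) := by
      have : Continuous fun r : ℝ => (r : ℂ) * u := by fun_prop
      exact (this.tendsto' 1 u (by simp)).mono_left nhdsWithin_le_nhds
    exact h.comp h2
  rw [← Q_exp_eq_f0 hd₁ hd₂ hl hl', Q]
  have e : -2 * d - 1 = 1 - (2 * d + 2) := by ring
  rw [e]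
  exact ((key _ (norm_circ l) hne).add (key _ (by rw [norm_inv, norm_circ, inv_one])
    (by rwa [Ne, inv_eq_one]))).const_mul _

/-- The Fourier coefficients of the spectral density of fractional Gaussian noise. -/
noncomputable def fgnCov (a : ℝ) (k : ℤ) : ℝ :=
  1 / 2 * (|(k : ℝ) + 1| ^ (a - 1) - 2 * |(k : ℝ)| ^ (a - 1) + |(k : ℝ) - 1| ^ (a - 1))

theorem hasSum_polylog_circ {a : ℝ} (ha : 1 < a) (ha3 : a < 3) {r : ℝ} (hr0 : 0 ≤ r) (hr1 : r < 1)
    (l : ℝ) : HasSum (fun m : ℤ => ((|(m : ℝ)| ^ (a - 1) * r ^ m.natAbs : ℝ) : ℂ) * circ l ^ m)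
      (polylog (1 - a) (r * circ l) + polylog (1 - a) (r * (circ l)⁻¹)) := by
  have hinv : ‖(circ l)⁻¹‖ = 1 := by rw [norm_inv, norm_circ, inv_one]
  have h1 := polylog_hasSum (s := 1 - a) (z := r * circ l) (by linarith)
    (by rwa [norm_ofReal_mul_of_norm_one hr0 (norm_circ l)])
  have h2 := polylog_hasSum (s := 1 - a) (z := r * (circ l)⁻¹) (by linarith)
    (by rwa [norm_ofReal_mul_of_norm_one hr0 hinv])
  have h3 : HasSum (fun n : ℕ => ((|(((n : ℤ) + 1 : ℤ) : ℝ)| ^ (a - 1) *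
      r ^ ((n : ℤ) + 1).natAbs : ℝ) : ℂ) * circ l ^ ((n : ℤ) + 1))
      (polylog (1 - a) (r * circ l)) := by
    convert! h1 using 1
    funext n
    have e1 : ((n : ℤ) + 1).natAbs = n + 1 := by omega
    have e2 : circ l ^ ((n : ℤ) + 1) = circ l ^ (n + 1) := by
      exact_mod_cast zpow_natCast (circ l) (n + 1)
    rw [e1, e2, mul_pow, neg_sub]
    push_cast
    rw [abs_of_pos (by positivity : (0 : ℝ) < (n : ℝ) + 1)]
    ring
  have h4 : HasSum (fun n : ℕ => ((|((-((n : ℤ) + 1) : ℤ) : ℝ)| ^ (a - 1) *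
      r ^ (-((n : ℤ) + 1)).natAbs : ℝ) : ℂ) * circ l ^ (-((n : ℤ) + 1)))
      (polylog (1 - a) (r * (circ l)⁻¹)) := by
    convert! h2 using 1
    funext n
    have e1 : (-((n : ℤ) + 1)).natAbs = n + 1 := by omega
    have e2 : circ l ^ (-((n : ℤ) + 1)) = (circ l)⁻¹ ^ (n + 1) := by
      rw [zpow_neg, inv_pow]
      congr 1
    rw [e1, e2, mul_pow, neg_sub]
    push_cast
    rw [abs_neg, abs_of_pos (by positivity : (0 : ℝ) < (n : ℝ) + 1)]
    ring
  have h5 := HasSum.of_add_one_of_neg_add_one (f := fun m : ℤ =>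
    ((|(m : ℝ)| ^ (a - 1) * r ^ m.natAbs : ℝ) : ℂ) * circ l ^ m) h3 h4
  -- The two-sided series also has a term `m = 0`; it vanishes because `a > 1`.
  have e0 : (0 : ℝ) ^ (a - 1) = 0 := Real.zero_rpow (by linarith)
  simpa [e0] using h5

/-- For `r < 1` the Fourier series converges absolutely and may be integrated term by term; the
factor `u⁻¹ - 2 + u` produces a second difference of the coefficients. -/
theorem integral_regDensity {a : ℝ} (ha : 1 < a) (ha3 : a < 3) {r : ℝ} (hr0 : 0 ≤ r) (hr1 : r < 1)
    (k : ℤ) : ∫ l, regDensity a r l * circ l ^ (-k) ∂arcMeasure =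
      ((1 / 2 * (|((k + 1 : ℤ) : ℝ)| ^ (a - 1) * r ^ (k + 1).natAbs -
        2 * (|(k : ℝ)| ^ (a - 1) * r ^ k.natAbs) +
        |((k - 1 : ℤ) : ℝ)| ^ (a - 1) * r ^ (k - 1).natAbs) : ℝ) : ℂ) := by
  have hpi := Real.pi_pos
  set e : ℤ → ℝ := fun m => |(m : ℝ)| ^ (a - 1) * r ^ m.natAbs with he
  have he0 : ∀ m, 0 ≤ e m := fun m => by simp only [he]; positivity
  have hsum : ∀ l, HasSum (fun m : ℤ => (e m : ℂ) * circ l ^ m)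
      (polylog (1 - a) (r * circ l) + polylog (1 - a) (r * (circ l)⁻¹)) :=
    hasSum_polylog_circ ha ha3 hr0 hr1
  have hes : Summable e := by
    have := (hsum 0).summable.norm
    refine this.congr fun m => ?_
    rw [norm_mul, norm_circ_zpow, mul_one, Complex.norm_real, Real.norm_of_nonneg (he0 m)]
  set F : ℤ → ℝ → ℂ := fun m l => (e m : ℂ) * (1 / (4 * (Real.pi : ℂ)) *
    (circ l ^ (m - (k + 1)) - 2 * circ l ^ (m - k) + circ l ^ (m - (k - 1)))) with hF
  have hFsum : ∀ l, HasSum (fun m => F m l) (regDensity a r l * circ l ^ (-k)) := by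
    intro l
    have h := (hsum l).mul_left (1 / (4 * (Real.pi : ℂ)) * ((circ l)⁻¹ - 2 + circ l) * circ l ^ (-k))
    rw [regDensity]
    convert! h using 1
    · funext m
      have hu := circ_ne_zero l
      simp only [hF]
      have e1 : m - (k + 1) = m + (-k) + (-1) := by ring
      have e2 : m - k = m + (-k) := by ring
      have e3 : m - (k - 1) = m + (-k) + 1 := by ring
      rw [e1, e2, e3, zpow_add₀ hu (m + -k), zpow_add₀ hu (m + -k), zpow_add₀ hu m, zpow_one,
        zpow_neg_one]
      ring
    · ring
  have hcont : ∀ m, Continuous (F m) := by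
    intro m
    have h1 := continuous_circ_zpow (m - (k + 1))
    have h2 := continuous_circ_zpow (m - k)
    have h3 := continuous_circ_zpow (m - (k - 1))
    simp only [hF]
    exact continuous_const.mul (continuous_const.mul ((h1.sub (continuous_const.mul h2)).add h3))
  have hint0 : ∀ m : ℤ, Integrable (fun l => circ l ^ m) arcMeasure := fun m =>
    (continuous_circ_zpow m).continuousOn.integrableOn_Icc.mono_set Set.Ioc_subset_Icc_self
  have hint : ∀ m, Integrable (F m) arcMeasure := fun m =>
    (hcont m).continuousOn.integrableOn_Icc.mono_set Set.Ioc_subset_Icc_self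
  have hbound : ∀ m l, ‖F m l‖ ≤ e m * (1 / Real.pi) := by
    intro m l
    simp only [hF]
    rw [norm_mul, Complex.norm_real, Real.norm_of_nonneg (he0 m)]
    refine mul_le_mul_of_nonneg_left ?_ (he0 m)
    have e1 : ‖(1 / (4 * (Real.pi : ℂ)))‖ = 1 / (4 * Real.pi) := by
      simp [abs_of_pos hpi]
    rw [norm_mul, e1]
    have h1 : ‖circ l ^ (m - (k + 1)) - 2 * circ l ^ (m - k) + circ l ^ (m - (k - 1))‖ ≤ 4 := by
      refine (norm_add_le _ _).trans ?_
      have := norm_sub_le (circ l ^ (m - (k + 1))) (2 * circ l ^ (m - k))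
      rw [norm_mul, norm_circ_zpow, norm_circ_zpow, Complex.norm_ofNat] at this
      rw [norm_circ_zpow]
      linarith
    calc _ ≤ 1 / (4 * Real.pi) * 4 := by gcongr
      _ = _ := by field_simp
  have hnorm : Summable fun m => ∫ l, ‖F m l‖ ∂arcMeasure := by
    have h1 := (hes.mul_right (1 / Real.pi)).mul_left (arcMeasure.real Set.univ)
    refine Summable.of_nonneg_of_le (fun m => integral_nonneg fun l => norm_nonneg _) (fun m => ?_) h1
    calc ∫ l, ‖F m l‖ ∂arcMeasure ≤ ∫ l, e m * (1 / Real.pi) ∂arcMeasure :=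
          integral_mono (hint m).norm (integrable_const _) (hbound m)
      _ = _ := by rw [integral_const, smul_eq_mul]
  have hmain := hasSum_integral_of_summable_integral_norm hint hnorm
  simp only [fun l => (hFsum l).tsum_eq] at hmain
  have hFint : ∀ m, ∫ l, F m l ∂arcMeasure = (if m = k + 1 then (1 / 2 * e (k + 1) : ℂ) else 0) +
      (if m = k then (-e k : ℂ) else 0) + (if m = k - 1 then (1 / 2 * e (k - 1) : ℂ) else 0) := by
    intro m
    simp only [hF]
    rw [integral_const_mul, integral_const_mul, integral_add, integral_sub, integral_const_mul,
      integral_circ_zpow, integral_circ_zpow, integral_circ_zpow]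
    · simp only [sub_eq_zero]
      have hpi' : (Real.pi : ℂ) ≠ 0 := by exact_mod_cast hpi.ne'
      by_cases h1 : m = k + 1
      · subst h1
        simp only [if_true, if_neg (by omega : ¬ k + 1 = k), if_neg (by omega : ¬ k + 1 = k - 1)]
        field_simp
        ring
      · by_cases h2 : m = k
        · subst h2
          simp only [if_true, if_neg h1, if_neg (by omega : ¬ m = m - 1)]
          field_simp
          ring
        · by_cases h3 : m = k - 1
          · subst h3
            simp only [if_true, if_neg h1, if_neg h2]
            field_simp
            ring
          · simp only [if_neg h1, if_neg h2, if_neg h3]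
            ring
    · exact hint0 _
    · exact (hint0 _).const_mul _
    · exact (hint0 _).sub ((hint0 _).const_mul _)
    · exact hint0 _
  simp only [hFint] at hmain
  have h2 := ((hasSum_ite_eq (k + 1) (1 / 2 * e (k + 1) : ℂ)).add
    (hasSum_ite_eq k (-e k : ℂ))).add (hasSum_ite_eq (k - 1) (1 / 2 * e (k - 1) : ℂ))
  rw [hmain.unique h2]
  simp only [he]
  push_cast
  ring

/-- Dominated convergence as `r ↑ 1`. Measurability and integrability of `f₀` are inherited from the
continuous regularizations instead of being read off its defining series. -/
theorem tendsto_integral_regDensity {d : ℝ} (hd₁ : -(1 / 2) < d) (hd₂ : d < 1 / 2) :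
    Integrable (fun l => (f0 d l : ℂ)) arcMeasure ∧ ∀ k : ℤ,
    Tendsto (fun r => ∫ l, regDensity (2 * d + 2) r l * circ l ^ (-k) ∂arcMeasure) (𝓝[<] 1)
      (𝓝 (∫ l, (f0 d l : ℂ) * circ l ^ (-k) ∂arcMeasure)) := by
  obtain ⟨b, hb, hbound⟩ := exists_norm_regDensity_le (a := 2 * d + 2) (by linarith) (by linarith)
  have hev : ∀ᶠ r : ℝ in 𝓝[<] 1, 0 ≤ r ∧ r < 1 := by
    filter_upwards [self_mem_nhdsWithin, nhdsWithin_le_nhds (lt_mem_nhds (zero_lt_one' ℝ))]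
      with r h1 h2
    exact ⟨h2.le, h1⟩
  have hlim : ∀ᵐ l ∂arcMeasure,
      Tendsto (fun r => regDensity (2 * d + 2) r l) (𝓝[<] 1) (𝓝 (f0 d l : ℂ)) := by
    filter_upwards [ae_arc] with l hl
    exact tendsto_regDensity hd₁ hd₂ hl.1 hl.2
  have hmeas : AEStronglyMeasurable (fun l => (f0 d l : ℂ)) arcMeasure := by
    obtain ⟨x, hx⟩ := exists_seq_tendsto (𝓝[<] (1 : ℝ))
    -- Shifting the sequence by `N` makes every term, not just eventually, lie in `[0, 1)`.
    obtain ⟨N, hN⟩ := eventually_atTop.1 (hx.eventually hev)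
    refine aestronglyMeasurable_of_tendsto_ae atTop (f := fun n l => regDensity (2 * d + 2) (x (n + N)) l)
      (fun n => (continuous_regDensity (by linarith) (hN _ (by omega)).1
        (hN _ (by omega)).2).aestronglyMeasurable) ?_
    filter_upwards [hlim] with l hl
    exact (hl.comp hx).comp (tendsto_add_atTop_nat N)
  constructor
  · refine Integrable.mono' hb hmeas ?_
    filter_upwards [ae_arc, hlim] with l hl hll
    refine le_of_tendsto hll.norm ?_
    filter_upwards [hev] with r hr
    exact hbound r hr.1 hr.2 l hl.1 hl.2
  · intro k
    refine tendsto_integral_filter_of_dominated_convergence b ?_ ?_ hb ?_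
    · filter_upwards [hev] with r hr
      exact ((continuous_regDensity (by linarith) hr.1 hr.2).mul
        (continuous_circ_zpow _)).aestronglyMeasurable
    · filter_upwards [hev] with r hr
      filter_upwards [ae_arc] with l hl
      rw [norm_mul, norm_circ_zpow, mul_one]
      exact hbound r hr.1 hr.2 l hl.1 hl.2
    · filter_upwards [hlim] with l hl
      exact hl.mul_const _

theorem integrable_f0 {d : ℝ} (hd₁ : -(1 / 2) < d) (hd₂ : d < 1 / 2) :
    Integrable (fun l => (f0 d l : ℂ)) arcMeasure :=
  (tendsto_integral_regDensity hd₁ hd₂).1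

theorem integral_f0_mul_circ_zpow {d : ℝ} (hd₁ : -(1 / 2) < d) (hd₂ : d < 1 / 2) (k : ℤ) :
    ∫ l, (f0 d l : ℂ) * circ l ^ (-k) ∂arcMeasure = fgnCov (2 * d + 2) k := by
  have h1 := (tendsto_integral_regDensity hd₁ hd₂).2 k
  have hev : ∀ᶠ r : ℝ in 𝓝[<] 1, 0 ≤ r ∧ r < 1 := by
    filter_upwards [self_mem_nhdsWithin, nhdsWithin_le_nhds (lt_mem_nhds (zero_lt_one' ℝ))]
      with r h1 h2
    exact ⟨h2.le, h1⟩
  refine tendsto_nhds_unique h1 (Tendsto.congr' (f₁ := fun r : ℝ =>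
      ((1 / 2 * (|((k + 1 : ℤ) : ℝ)| ^ ((2 * d + 2) - 1) * r ^ (k + 1).natAbs -
        2 * (|(k : ℝ)| ^ ((2 * d + 2) - 1) * r ^ k.natAbs) +
        |((k - 1 : ℤ) : ℝ)| ^ ((2 * d + 2) - 1) * r ^ (k - 1).natAbs) : ℝ) : ℂ)) ?_ ?_)
  · filter_upwards [hev] with r hr
    exact (integral_regDensity (by linarith) (by linarith) hr.1 hr.2 k).symm
  · refine Tendsto.mono_left (Continuous.tendsto' (by fun_prop) 1 _ ?_) nhdsWithin_le_nhds
    simp only [one_pow, mul_one, fgnCov]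
    push_cast
    ring

/-! ### Cauchy transforms and Laurent polynomial multipliers -/

/-- The Cauchy transform of a density on the unit circle. -/
noncomputable def cauchy (h : ℝ → ℂ) (w : ℂ) : ℂ := ∫ l, h l * (circ l / (circ l - w)) ∂arcMeasure

theorem integrable_continuous_mul {h : ℝ → ℂ} (hh : Integrable h arcMeasure) {p : ℝ → ℂ}
    (hp : Continuous p) : Integrable (fun l => p l * h l) arcMeasure := by
  obtain ⟨C, hC⟩ := isCompact_Icc.exists_bound_of_continuousOn (s := Set.Icc (-Real.pi) Real.pi)
    hp.continuousOn
  refine hh.bdd_mul (c := C) hp.aestronglyMeasurable ?_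
  filter_upwards [ae_restrict_mem measurableSet_Ioc] with l hl
  exact hC l (Set.Ioc_subset_Icc_self hl)

theorem circ_sub_ne_zero {w : ℂ} (hw : ‖w‖ ≠ 1) (l : ℝ) : circ l - w ≠ 0 := by
  intro h
  rw [sub_eq_zero] at h
  exact hw (h ▸ norm_circ l)

theorem continuous_cauchyKernel {w : ℂ} (hw : ‖w‖ ≠ 1) :
    Continuous fun l => circ l / (circ l - w) :=
  continuous_circ.div (continuous_circ.sub continuous_const) (circ_sub_ne_zero hw)

theorem integrable_cauchy {h : ℝ → ℂ} (hh : Integrable h arcMeasure) {w : ℂ} (hw : ‖w‖ ≠ 1) :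
    Integrable (fun l => h l * (circ l / (circ l - w))) arcMeasure := by
  simpa only [mul_comm] using integrable_continuous_mul hh (continuous_cauchyKernel hw)

theorem hasSum_cauchy_of_norm_lt_one {h : ℝ → ℂ} (hh : Integrable h arcMeasure) {w : ℂ}
    (hw : ‖w‖ < 1) :
    HasSum (fun j : ℕ => (∫ l, h l * circ l ^ (-(j : ℤ)) ∂arcMeasure) * w ^ j) (cauchy h w) := by
  have hsum : ∀ l, HasSum (fun j : ℕ => h l * circ l ^ (-(j : ℤ)) * w ^ j)
      (h l * (circ l / (circ l - w))) := by
    intro l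
    have hu := circ_ne_zero l
    have h1 : ‖w / circ l‖ < 1 := by rw [norm_div, norm_circ, div_one]; exact hw
    have h2 := (hasSum_geometric_of_norm_lt_one h1).mul_left (h l)
    convert! h2 using 1
    · funext j
      rw [zpow_neg, zpow_natCast, div_pow]
      ring
    · congr 1
      have := circ_sub_ne_zero hw.ne l
      rw [one_sub_div hu, inv_div]
  have hint : ∀ j : ℕ, Integrable (fun l => h l * circ l ^ (-(j : ℤ)) * w ^ j) arcMeasure := by
    intro j
    have := (integrable_continuous_mul hh (continuous_circ_zpow (-(j : ℤ)))).mul_const (w ^ j)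
    simpa only [mul_comm (h _)] using this
  have hnorm : Summable fun j : ℕ => ∫ l, ‖h l * circ l ^ (-(j : ℤ)) * w ^ j‖ ∂arcMeasure := by
    have e : ∀ j : ℕ, ∫ l, ‖h l * circ l ^ (-(j : ℤ)) * w ^ j‖ ∂arcMeasure =
        (∫ l, ‖h l‖ ∂arcMeasure) * ‖w‖ ^ j := by
      intro j
      rw [← integral_mul_const]
      congr 1
      funext l
      rw [norm_mul, norm_mul, norm_circ_zpow, mul_one, norm_pow]
    simp only [e]
    exact (summable_geometric_of_lt_one (norm_nonneg _) hw).mul_left _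
  have hmain := hasSum_integral_of_summable_integral_norm hint hnorm
  simp only [fun l => (hsum l).tsum_eq, integral_mul_const] at hmain
  exact hmain

theorem hasSum_cauchy_of_one_lt_norm {h : ℝ → ℂ} (hh : Integrable h arcMeasure) {w : ℂ}
    (hw : 1 < ‖w‖) :
    HasSum (fun j : ℕ => (∫ l, h l * circ l ^ ((j : ℤ) + 1) ∂arcMeasure) * w⁻¹ ^ (j + 1))
      (-cauchy h w) := by
  have hw0 : w ≠ 0 := by
    rintro rfl
    simp at hw
    linarith
  have hsum : ∀ l, HasSum (fun j : ℕ => h l * circ l ^ ((j : ℤ) + 1) * w⁻¹ ^ (j + 1))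
      (-(h l * (circ l / (circ l - w)))) := by
    intro l
    have hu := circ_ne_zero l
    have h1 : ‖circ l / w‖ < 1 := by
      rw [norm_div, norm_circ, one_div]; exact inv_lt_one_of_one_lt₀ hw
    have h2 := (hasSum_geometric_of_norm_lt_one h1).mul_left (h l * circ l * w⁻¹)
    convert! h2 using 1
    · funext j
      rw [zpow_add₀ hu, zpow_natCast, zpow_one, div_eq_mul_inv, mul_pow, pow_succ w⁻¹]
      ring
    · have h3 := circ_sub_ne_zero hw.ne' l
      have h4 : w - circ l ≠ 0 := by rw [← neg_sub]; exact neg_ne_zero.2 h3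
      rw [one_sub_div hw0, inv_div]
      field_simp
      ring
  have hint : ∀ j : ℕ, Integrable (fun l => h l * circ l ^ ((j : ℤ) + 1) * w⁻¹ ^ (j + 1))
      arcMeasure := by
    intro j
    have := (integrable_continuous_mul hh (continuous_circ_zpow ((j : ℤ) + 1))).mul_const (w⁻¹ ^ (j + 1))
    simpa only [mul_comm (h _)] using this
  have hwi : ‖w⁻¹‖ < 1 := by rw [norm_inv]; exact inv_lt_one_of_one_lt₀ hw
  have hnorm : Summable fun j : ℕ => ∫ l, ‖h l * circ l ^ ((j : ℤ) + 1) * w⁻¹ ^ (j + 1)‖ ∂arcMeasure := by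
    have e : ∀ j : ℕ, ∫ l, ‖h l * circ l ^ ((j : ℤ) + 1) * w⁻¹ ^ (j + 1)‖ ∂arcMeasure =
        (∫ l, ‖h l‖ ∂arcMeasure) * ‖w⁻¹‖ ^ (j + 1) := by
      intro j
      rw [← integral_mul_const]
      congr 1
      funext l
      rw [norm_mul, norm_mul, norm_circ_zpow, mul_one, norm_pow]
    simp only [e]
    exact ((summable_nat_add_iff 1).2 (summable_geometric_of_lt_one (norm_nonneg _) hwi)).mul_left _
  have hmain := hasSum_integral_of_summable_integral_norm hint hnorm
  simp only [fun l => (hsum l).tsum_eq, integral_mul_const, integral_neg] at hmain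
  exact hmain

/-- Functions `p` such that the Cauchy transform of `p h` is `p` times that of `h`, up to a function
holomorphic off the origin. -/
structure IsMultiplier (p : ℂ → ℂ) : Prop where
  cont : Continuous fun l => p (circ l)
  diff : DifferentiableOn ℂ p {0}ᶜ
  cauchy_mul : ∀ h : ℝ → ℂ, Integrable h arcMeasure → ∃ L : ℂ → ℂ, DifferentiableOn ℂ L {0}ᶜ ∧
    ∀ w, w ≠ 0 → ‖w‖ ≠ 1 → cauchy (fun l => p (circ l) * h l) w = p w * cauchy h w + L w

namespace IsMultiplier

theorem const (c : ℂ) : IsMultiplier fun _ => c where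
  cont := continuous_const
  diff := differentiableOn_const c
  cauchy_mul h hh := by
    refine ⟨fun _ => 0, differentiableOn_const 0, fun w _ _ => ?_⟩
    simp only [cauchy, mul_assoc, integral_const_mul, add_zero]

/-- From `u · u/(u - w) = w · u/(u - w) + u`, so the error is a constant. -/
theorem id : IsMultiplier fun w => w where
  cont := continuous_circ
  diff := differentiableOn_id
  cauchy_mul h hh := by
    refine ⟨fun _ => ∫ l, circ l * h l ∂arcMeasure, differentiableOn_const _, fun w _ hw => ?_⟩
    simp only [cauchy]
    rw [← integral_const_mul, ← integral_add ((integrable_cauchy hh hw).const_mul w)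
      (integrable_continuous_mul hh continuous_circ)]
    congr 1
    funext l
    have := circ_sub_ne_zero hw l
    field_simp
    ring

/-- From `u⁻¹ · u/(u - w) = w⁻¹ (u/(u - w) - 1)`, so the error has a pole only at the origin. -/
theorem inv : IsMultiplier fun w => w⁻¹ where
  cont := continuous_circ.inv₀ circ_ne_zero
  diff := differentiableOn_inv
  cauchy_mul h hh := by
    refine ⟨fun w => w⁻¹ * -∫ l, h l ∂arcMeasure, differentiableOn_inv.mul_const _,
      fun w hw0 hw => ?_⟩
    have hn : Integrable (fun l => w⁻¹ * -h l) arcMeasure := hh.neg.const_mul _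
    simp only [cauchy]
    rw [← integral_neg, ← integral_const_mul, ← integral_const_mul,
      ← integral_add ((integrable_cauchy hh hw).const_mul w⁻¹) hn]
    congr 1
    funext l
    have h1 := circ_sub_ne_zero hw l
    have h2 := circ_ne_zero l
    field_simp
    ring

theorem add {p r : ℂ → ℂ} (hp : IsMultiplier p) (hr : IsMultiplier r) :
    IsMultiplier fun w => p w + r w where
  cont := hp.cont.add hr.cont
  diff := hp.diff.add hr.diff
  cauchy_mul h hh := by
    obtain ⟨L, hL, h1⟩ := hp.cauchy_mul h hh
    obtain ⟨L', hL', h2⟩ := hr.cauchy_mul h hh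
    refine ⟨fun w => L w + L' w, hL.add hL', fun w hw0 hw => ?_⟩
    have e : cauchy (fun l => (p (circ l) + r (circ l)) * h l) w =
        cauchy (fun l => p (circ l) * h l) w + cauchy (fun l => r (circ l) * h l) w := by
      simp only [cauchy]
      rw [← integral_add (integrable_cauchy (integrable_continuous_mul hh hp.cont) hw)
        (integrable_cauchy (integrable_continuous_mul hh hr.cont) hw)]
      congr 1
      funext l
      ring
    rw [e, h1 w hw0 hw, h2 w hw0 hw]
    ring

theorem mul {p r : ℂ → ℂ} (hp : IsMultiplier p) (hr : IsMultiplier r) :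
    IsMultiplier fun w => p w * r w where
  cont := hp.cont.mul hr.cont
  diff := hp.diff.mul hr.diff
  cauchy_mul h hh := by
    obtain ⟨L', hL', h2⟩ := hr.cauchy_mul h hh
    obtain ⟨L, hL, h1⟩ := hp.cauchy_mul _ (integrable_continuous_mul hh hr.cont)
    refine ⟨fun w => p w * L' w + L w, (hp.diff.mul hL').add hL, fun w hw0 hw => ?_⟩
    simp only [mul_assoc]
    rw [h1 w hw0 hw, h2 w hw0 hw]
    ring

theorem pow {p : ℂ → ℂ} (hp : IsMultiplier p) (k : ℕ) : IsMultiplier fun w => p w ^ k := by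
  induction k with
  | zero => simpa using const 1
  | succ k ih => simpa only [pow_succ] using ih.mul hp

theorem zpow (k : ℤ) : IsMultiplier fun w => w ^ k := by
  obtain ⟨m, rfl | rfl⟩ := k.eq_nat_or_neg
  · simpa only [zpow_natCast] using id.pow m
  · simpa only [zpow_neg, zpow_natCast, ← inv_pow] using inv.pow m

theorem sum {ι : Type*} (s : Finset ι) {p : ι → ℂ → ℂ} (hp : ∀ i, IsMultiplier (p i)) :
    IsMultiplier fun w => ∑ i ∈ s, p i w := by
  classical
  induction s using Finset.induction_on with
  | empty => simpa using const 0
  | insert i s hi ih =>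
    simp only [Finset.sum_insert hi]
    exact (hp i).add ih

theorem aeval {p : ℂ → ℂ} (hp : IsMultiplier p) (r : ℝ[X]) :
    IsMultiplier fun w => Polynomial.aeval (p w) r := by
  simp only [Polynomial.aeval_eq_sum_range]
  refine sum _ fun i => ?_
  simp only [Algebra.smul_def]
  exact (const _).mul (hp.pow i)

end IsMultiplier

theorem isMultiplier_one_sub_G (n : ℕ) (g : ℤ → ℝ) : IsMultiplier fun w => 1 - G n g w := by
  have h : IsMultiplier fun w => ∑ k ∈ Finset.Icc (1 : ℤ) (n - 1), (g k : ℂ) * w ^ k :=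
    IsMultiplier.sum _ fun k => (IsMultiplier.const _).mul (IsMultiplier.zpow k)
  have h2 := (IsMultiplier.const 1).add ((IsMultiplier.const (-1)).mul h)
  simpa only [G, neg_one_mul, ← sub_eq_add_neg] using h2

/-! ### The Cauchy transform of `f₀` -/

theorem fgnCov_neg (a : ℝ) (k : ℤ) : fgnCov a (-k) = fgnCov a k := by
  have h1 : |(-(k : ℝ)) + 1| = |(k : ℝ) - 1| := by rw [← abs_neg]; congr 1; ring
  have h2 : |(-(k : ℝ)) - 1| = |(k : ℝ) + 1| := by rw [← abs_neg]; congr 1; ring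
  simp only [fgnCov]
  push_cast
  rw [h1, h2, abs_neg]
  ring

/-- The three shifted series of `|j|^{a-1}` combine to `(w⁻¹ - 2 + w) Li(w)`. The extra `1` is the
boundary term `|0 - 1|^{a-1}` at `j = 0`. -/
theorem hasSum_fgnCov {a : ℝ} (ha : 1 < a) (ha3 : a < 3) {w : ℂ} (hw0 : w ≠ 0) (hw : ‖w‖ < 1) :
    HasSum (fun j : ℕ => (fgnCov a j : ℂ) * w ^ j)
      (1 / 2 * ((w⁻¹ - 2 + w) * polylog (1 - a) w + 1)) := by
  have e0 : (0 : ℝ) ^ (a - 1) = 0 := Real.zero_rpow (by linarith)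
  have h1 := polylog_hasSum (s := 1 - a) (z := w) (by linarith) hw
  rw [neg_sub] at h1
  have h0 : HasSum (fun j : ℕ => (((j : ℝ) ^ (a - 1) : ℝ) : ℂ) * w ^ j) (polylog (1 - a) w) := by
    rw [← hasSum_nat_add_iff' 1]
    simpa [e0] using h1
  have h2 : HasSum (fun j : ℕ => ((|(j : ℝ) + 1| ^ (a - 1) : ℝ) : ℂ) * w ^ j)
      (w⁻¹ * polylog (1 - a) w) := by
    convert! h1.mul_left w⁻¹ using 1
    funext j
    rw [abs_of_pos (by positivity), pow_succ]
    field_simp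
  have h3 : HasSum (fun j : ℕ => ((|(j : ℝ) - 1| ^ (a - 1) : ℝ) : ℂ) * w ^ j)
      (w * polylog (1 - a) w + 1) := by
    rw [← hasSum_nat_add_iff' 1]
    convert! h0.mul_left w using 1
    · funext j
      push_cast
      rw [add_sub_cancel_right, abs_of_nonneg j.cast_nonneg, pow_succ]
      ring
    · simp
  convert! ((h2.sub (h0.mul_left 2)).add h3).mul_left (1 / 2) using 1
  · funext j
    simp only [fgnCov, Int.cast_natCast, Nat.abs_cast]
    push_cast
    ring
  · ring

theorem cauchy_f0_of_norm_lt_one {d : ℝ} (hd₁ : -(1 / 2) < d) (hd₂ : d < 1 / 2) {w : ℂ} (hw0 : w ≠ 0)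
    (hw : ‖w‖ < 1) : cauchy (fun l => (f0 d l : ℂ)) w =
      1 / 2 * ((w⁻¹ - 2 + w) * polylog (-2 * d - 1) w + 1) := by
  have h1 := hasSum_cauchy_of_norm_lt_one (integrable_f0 hd₁ hd₂) hw
  simp only [integral_f0_mul_circ_zpow hd₁ hd₂] at h1
  rw [h1.unique (hasSum_fgnCov (by linarith) (by linarith) hw0 hw)]
  ring_nf

/-- Outside the disk only coefficients of non-zero index enter. Removing the zeroth coefficient,
equal to `1`, from the series in `w⁻¹` changes the constant to `-1` inside the bracket, and with the
outer sign the constant `1/2` is the same as inside the disk. -/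
theorem cauchy_f0_of_one_lt_norm {d : ℝ} (hd₁ : -(1 / 2) < d) (hd₂ : d < 1 / 2) {w : ℂ}
    (hw : 1 < ‖w‖) : cauchy (fun l => (f0 d l : ℂ)) w =
      -(1 / 2 * ((w⁻¹ - 2 + w) * polylog (-2 * d - 1) w⁻¹ - 1)) := by
  have hw0 : w ≠ 0 := by
    rintro rfl
    simp at hw
    linarith
  have hwi : ‖w⁻¹‖ < 1 := by rw [norm_inv]; exact inv_lt_one_of_one_lt₀ hw
  have h1 := hasSum_cauchy_of_one_lt_norm (integrable_f0 hd₁ hd₂) hw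
  have e : ∀ j : ℕ, ∫ l, (f0 d l : ℂ) * circ l ^ ((j : ℤ) + 1) ∂arcMeasure =
      (fgnCov (2 * d + 2) ((j + 1 : ℕ) : ℤ) : ℂ) := by
    intro j
    have h := integral_f0_mul_circ_zpow hd₁ hd₂ (-((j + 1 : ℕ) : ℤ))
    rw [neg_neg, fgnCov_neg] at h
    rw [← h]
    push_cast
    rfl
  simp only [e] at h1
  have h2 := hasSum_fgnCov (a := 2 * d + 2) (by linarith) (by linarith) (inv_ne_zero hw0) hwi
  rw [← hasSum_nat_add_iff' 1] at h2
  have h3 := h1.unique h2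
  have e0 : fgnCov (2 * d + 2) 0 = 1 := by
    have e0 : (0 : ℝ) ^ (2 * d + 2 - 1) = 0 := Real.zero_rpow (by linarith)
    simp [fgnCov, e0]
    norm_num
  rw [Finset.sum_range_one, pow_zero, mul_one, Nat.cast_zero, e0, inv_inv] at h3
  have e2 : -2 * d - 1 = 1 - (2 * d + 2) := by ring
  rw [e2, ← neg_eq_iff_eq_neg, h3]
  push_cast
  ring

/-! ### The spectral density and the residuals -/

theorem aeval_circ_inv (l : ℝ) (p : ℝ[X]) :
    aeval (circ l)⁻¹ p = starRingEnd ℂ (aeval (circ l) p) := by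
  rw [← conj_circ, Polynomial.aeval_conj]

theorem continuous_aeval_circ (p : ℝ[X]) : Continuous fun l => aeval (circ l) p :=
  (Polynomial.continuous_aeval p).comp continuous_circ

/-- Real coefficients give `p(u⁻¹)` as the conjugate of `p(u)` on the circle, so the rational factor
of the density becomes a quotient of Laurent polynomials and its denominator can be cleared. -/
theorem density_mul {d : ℝ} {θ φ : ℝ[X]} (hφ : ∀ w : ℂ, ‖w‖ ≤ 1 → aeval w φ ≠ 0) (l : ℝ) :
    aeval (circ l) φ * aeval (circ l)⁻¹ φ * (specDensity d θ φ l : ℂ) =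
      aeval (circ l) θ * aeval (circ l)⁻¹ θ * (f0 d l : ℂ) := by
  have h0 := hφ _ (norm_circ l).le
  rw [specDensity, aeval_circ_inv, aeval_circ_inv, Complex.mul_conj', Complex.mul_conj', norm_div]
  have h1 : (‖aeval (circ l) φ‖ : ℂ) ≠ 0 := by exact_mod_cast norm_ne_zero_iff.2 h0
  push_cast
  field_simp

theorem integrable_specDensity {d : ℝ} (hd₁ : -(1 / 2) < d) (hd₂ : d < 1 / 2) {θ φ : ℝ[X]}
    (hφ : ∀ w : ℂ, ‖w‖ ≤ 1 → aeval w φ ≠ 0) :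
    Integrable (fun l => (specDensity d θ φ l : ℂ)) arcMeasure := by
  have hc : Continuous fun l : ℝ => ((‖aeval (circ l) θ / aeval (circ l) φ‖ ^ 2 : ℝ) : ℂ) :=
    Complex.continuous_ofReal.comp ((((continuous_aeval_circ θ).div (continuous_aeval_circ φ)
      fun l => hφ _ (norm_circ l).le).norm).pow 2)
  refine (integrable_continuous_mul (integrable_f0 hd₁ hd₂) hc).congr (ae_of_all _ fun l => ?_)
  simp only [specDensity]
  push_cast
  rfl

theorem f0_neg (d l : ℝ) : f0 d (-l) = f0 d l := by
  have h1 : ‖1 - circ (-l)‖ = ‖1 - circ l‖ := by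
    rw [circ_neg, ← conj_circ, ← Complex.norm_conj (1 - circ l), map_sub, map_one]
  have h2 : ∑' k : ℤ, |-l + 2 * Real.pi * k| ^ (-2 * d - 2) =
      ∑' k : ℤ, |l + 2 * Real.pi * k| ^ (-2 * d - 2) := by
    rw [← (Equiv.neg ℤ).tsum_eq]
    refine tsum_congr fun k => ?_
    rw [← abs_neg]
    congr 2
    simp
    ring
  simp only [f0]
  rw [h2, ← h1]

theorem specDensity_neg (d : ℝ) (θ φ : ℝ[X]) (l : ℝ) :
    specDensity d θ φ (-l) = specDensity d θ φ l := by
  simp only [specDensity]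
  rw [f0_neg]
  congr 2
  have h1 : ∀ p : ℝ[X], ‖aeval (circ (-l)) p‖ = ‖aeval (circ l) p‖ := by
    intro p
    rw [circ_neg, aeval_circ_inv, Complex.norm_conj]
  rw [norm_div, norm_div]
  exact congrArg₂ _ (h1 θ) (h1 φ)

theorem integral_specDensity_mul_circ_zpow {d : ℝ} (hd₁ : -(1 / 2) < d) (hd₂ : d < 1 / 2) {θ φ : ℝ[X]}
    (hφ : ∀ w : ℂ, ‖w‖ ≤ 1 → aeval w φ ≠ 0) (k : ℤ) :
    ∫ l, (specDensity d θ φ l : ℂ) * circ l ^ (-k) ∂arcMeasure = cov d θ φ k := by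
  have hpi : -Real.pi ≤ Real.pi := by linarith [Real.pi_pos]
  have hF := integrable_specDensity hd₁ hd₂ (θ := θ) hφ
  have hint : ∀ m : ℤ, Integrable (fun l => (specDensity d θ φ l : ℂ) * circ l ^ m) arcMeasure := by
    intro m
    simpa only [mul_comm] using integrable_continuous_mul hF (continuous_circ_zpow m)
  have hsymm : ∫ l, (specDensity d θ φ l : ℂ) * circ l ^ (-k) ∂arcMeasure =
      ∫ l, (specDensity d θ φ l : ℂ) * circ l ^ k ∂arcMeasure := by
    rw [← intervalIntegral.integral_of_le hpi, ← intervalIntegral.integral_of_le hpi]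
    have h := intervalIntegral.integral_comp_neg (a := -Real.pi) (b := Real.pi)
      (fun l => (specDensity d θ φ l : ℂ) * circ l ^ k)
    rw [neg_neg] at h
    rw [← h]
    refine intervalIntegral.integral_congr fun l _ => ?_
    simp only [specDensity_neg, circ_neg, inv_zpow', zpow_neg]
  have hadd : ∫ l, (specDensity d θ φ l : ℂ) * circ l ^ (-k) ∂arcMeasure =
      ∫ l, ((Real.cos (k * l) * specDensity d θ φ l : ℝ) : ℂ) ∂arcMeasure := by
    have h2 : (2 : ℂ) * ∫ l, (specDensity d θ φ l : ℂ) * circ l ^ (-k) ∂arcMeasure =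
        2 * ∫ l, ((Real.cos (k * l) * specDensity d θ φ l : ℝ) : ℂ) ∂arcMeasure := by
      rw [two_mul]
      nth_rewrite 2 [hsymm]
      rw [← integral_add (hint _) (hint _), ← integral_const_mul]
      refine integral_congr_ae (ae_of_all _ fun l => ?_)
      have e1 : ∀ m : ℤ, circ l ^ m = Complex.exp ((m * l : ℂ) * Complex.I) := by
        intro m
        rw [circ, ← Complex.exp_int_mul]
        congr 1; ring
      simp only [e1]
      push_cast
      rw [Complex.cos]
      have e2 : -(k : ℂ) * l * Complex.I = -((k : ℂ) * l) * Complex.I := by ring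
      rw [e2]
      ring
    exact mul_left_cancel₀ two_ne_zero h2
  rw [hadd, integral_complex_ofReal, cov, intervalIntegral.integral_of_le hpi]

/-- The residual sequence `γ(j) - ∑ g(k) γ(j - k)`. -/
noncomputable def resid (γ : ℤ → ℝ) (n : ℕ) (g : ℤ → ℝ) (j : ℤ) : ℝ :=
  γ j - ∑ k ∈ Finset.Icc (1 : ℤ) (n - 1), g k * γ (j - k)

theorem integral_residual {d : ℝ} (hd₁ : -(1 / 2) < d) (hd₂ : d < 1 / 2) {θ φ : ℝ[X]}
    (hφ : ∀ w : ℂ, ‖w‖ ≤ 1 → aeval w φ ≠ 0) (n : ℕ) (g : ℤ → ℝ) (j : ℤ) :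
    ∫ l, ((1 - G n g (circ l)) * (specDensity d θ φ l : ℂ)) * circ l ^ (-j) ∂arcMeasure =
      resid (cov d θ φ) n g j := by
  have hF := integrable_specDensity hd₁ hd₂ (θ := θ) hφ
  have hint : ∀ m : ℤ, Integrable (fun l => (specDensity d θ φ l : ℂ) * circ l ^ m) arcMeasure := by
    intro m
    simpa only [mul_comm] using integrable_continuous_mul hF (continuous_circ_zpow m)
  have e : ∀ l, ((1 - G n g (circ l)) * (specDensity d θ φ l : ℂ)) * circ l ^ (-j) =
      (specDensity d θ φ l : ℂ) * circ l ^ (-j) - ∑ k ∈ Finset.Icc (1 : ℤ) (n - 1),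
        (g k : ℂ) * ((specDensity d θ φ l : ℂ) * circ l ^ (-(j - k))) := by
    intro l
    have e1 : ∀ k : ℤ, circ l ^ (-(j - k)) = circ l ^ k * circ l ^ (-j) := by
      intro k
      rw [← zpow_add₀ (circ_ne_zero l)]
      congr 1; ring
    simp only [e1, G]
    rw [sub_mul, sub_mul, one_mul, Finset.sum_mul, Finset.sum_mul]
    congr 1
    exact Finset.sum_congr rfl fun k _ => by ring
  simp only [e]
  rw [integral_sub (hint _) (integrable_finsetSum _ fun k _ => (hint _).const_mul _),
    integral_finsetSum _ fun k _ => (hint _).const_mul _]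
  simp only [integral_const_mul, integral_specDensity_mul_circ_zpow hd₁ hd₂ hφ, resid]
  push_cast
  rfl

/-- Fourier coefficients are bounded by the `L¹` norm of the density. Boundedness is all that is
needed for convergence of the generating functions. -/
theorem exists_abs_resid_le {d : ℝ} (hd₁ : -(1 / 2) < d) (hd₂ : d < 1 / 2) {θ φ : ℝ[X]}
    (hφ : ∀ w : ℂ, ‖w‖ ≤ 1 → aeval w φ ≠ 0) (n : ℕ) (g : ℤ → ℝ) :
    ∃ K : ℝ, ∀ j : ℤ, ‖(resid (cov d θ φ) n g j : ℂ)‖ ≤ K := by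
  refine ⟨∫ l, ‖1 - G n g (circ l)‖ * ‖(specDensity d θ φ l : ℂ)‖ ∂arcMeasure, fun j => ?_⟩
  rw [← integral_residual hd₁ hd₂ hφ]
  refine (norm_integral_le_integral_norm _).trans (le_of_eq ?_)
  simp only [norm_mul, norm_circ_zpow, mul_one]

/-! ### Generating functions of the residuals -/

/-- The sum of a power series with bounded coefficients is holomorphic in the unit disk. -/
theorem differentiableOn_tsum_of_bounded {c : ℕ → ℂ} {K : ℝ} (hK : ∀ j, ‖c j‖ ≤ K) :
    DifferentiableOn ℂ (fun v : ℂ => ∑' j, c j * v ^ j) (Metric.ball 0 1) := by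
  intro v hv
  have hv : ‖v‖ < 1 := by simpa using hv
  obtain ⟨ρ, h1, h2⟩ := exists_between hv
  have hρ : 0 ≤ ρ := (norm_nonneg v).trans h1.le
  have hd : DifferentiableOn ℂ (fun v : ℂ => ∑' j, c j * v ^ j) (Metric.ball 0 ρ) := by
    refine Complex.differentiableOn_tsum_of_summable_norm
      ((summable_geometric_of_lt_one hρ h2).mul_left K) (fun j => by fun_prop) Metric.isOpen_ball
      fun j w hw => ?_
    have hw : ‖w‖ < ρ := by simpa using hw
    rw [norm_mul, norm_pow]
    have := (norm_nonneg _).trans (hK 0)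
    gcongr
    exact hK j
  exact (hd.differentiableAt (Metric.isOpen_ball.mem_nhds (by simpa using h1))).differentiableWithinAt

theorem summable_bounded_mul_pow {c : ℕ → ℂ} {K : ℝ} (hK : ∀ j, ‖c j‖ ≤ K) {v : ℂ} (hv : ‖v‖ < 1) :
    Summable fun j => c j * v ^ j := by
  refine Summable.of_norm_bounded ((summable_geometric_of_lt_one (norm_nonneg v) hv).mul_left K)
    fun j => ?_
  rw [norm_mul, norm_pow]
  gcongr
  exact hK j

theorem injective_neg_natCast : Function.Injective fun m : ℕ => -(m : ℤ) := fun i j h => by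
  simpa using h

theorem hasSum_int_of_nonpos_support {c : ℤ → ℂ} (hc : ∀ j, 0 < j → c j = 0) {w S : ℂ}
    (h : HasSum (fun m : ℕ => c (-m) * w⁻¹ ^ m) S) : HasSum (fun j : ℤ => c j * w ^ j) S := by
  refine (injective_neg_natCast.hasSum_iff (f := fun j : ℤ => c j * w ^ j) ?_).1 ?_
  · intro j hj
    rw [hc j, zero_mul]
    by_contra h0
    exact hj ⟨(-j).toNat, by simp only; omega⟩
  · convert! h using 1
    funext m
    simp

theorem hasSum_gL {γ : ℤ → ℝ} {n : ℕ} {g : ℤ → ℝ} {w S : ℂ}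
    (h : HasSum (fun m : ℕ => (resid γ n g (-m) : ℂ) * w⁻¹ ^ m) S) :
    HasSum (fun j : ℤ => (gL γ n g j : ℂ) * w ^ j) S := by
  refine hasSum_int_of_nonpos_support (c := fun j => (gL γ n g j : ℂ)) (fun j hj => ?_) ?_
  · simp [gL, not_le.2 hj]
  · convert! h using 1
    funext m
    simp [gL, resid]

theorem hasSum_gR {γ : ℤ → ℝ} {n : ℕ} {g : ℤ → ℝ} {w S : ℂ}
    (h : HasSum (fun m : ℕ => (resid γ n g (n + m) : ℂ) * w⁻¹ ^ m) S) :
    HasSum (fun j : ℤ => (gR γ n g (n - j) : ℂ) * w ^ j) S := by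
  refine hasSum_int_of_nonpos_support (c := fun j => (gR γ n g (n - j) : ℂ)) (fun j hj => ?_) ?_
  · simp [gR, not_le.2 hj]
  · convert! h using 1
    funext m
    simp [gR, resid]

theorem resid_eq_zero {γ : ℤ → ℝ} {n : ℕ} {g : ℤ → ℝ} (hg : IsPredictor γ n g) {j : ℤ}
    (h1 : 1 ≤ j) (h2 : j ≤ n - 1) : resid γ n g j = 0 := by
  rw [resid, hg.eqn j (Finset.mem_Icc.2 ⟨h1, h2⟩), sub_self]

/-- The two generating functions of the residuals, and the functional equations which continue them
analytically across the unit circle. -/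
theorem exists_functional_equations {d : ℝ} (hd₁ : -(1 / 2) < d) (hd₂ : d < 1 / 2) {θ φ : ℝ[X]}
    (hφ : ∀ w : ℂ, ‖w‖ ≤ 1 → aeval w φ ≠ 0) {n : ℕ} (hn : 1 ≤ n) {g : ℤ → ℝ}
    (hg : IsPredictor (cov d θ φ) n g) :
    (∀ w : ℂ, 1 < ‖w‖ →
      Summable (fun j : ℤ => (gL (cov d θ φ) n g j : ℂ) * w ^ j) ∧
      Summable (fun j : ℤ => (gR (cov d θ φ) n g (n - j) : ℂ) * w ^ j)) ∧
    ∃ S₀ S₁ V : ℂ → ℂ, DifferentiableOn ℂ S₀ (Metric.ball 0 1) ∧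
      DifferentiableOn ℂ S₁ (Metric.ball 0 1) ∧ DifferentiableOn ℂ V {0}ᶜ ∧
      (∀ w : ℂ, 1 < ‖w‖ → G0ext (cov d θ φ) n g w = S₀ w⁻¹ ∧ G1ext (cov d θ φ) n g w = S₁ w⁻¹) ∧
      (∀ w : ℂ, 1 < ‖w‖ → aeval w φ * aeval w⁻¹ φ * S₀ w⁻¹ =
        1 / 2 * (aeval w θ * aeval w⁻¹ θ * (1 - G n g w)) *
          ((w⁻¹ - 2 + w) * polylog (-2 * d - 1) w⁻¹) + V w) ∧
      (∀ w : ℂ, w ≠ 0 → ‖w‖ < 1 → aeval w φ * aeval w⁻¹ φ * (w ^ n * S₁ w) =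
        1 / 2 * (aeval w θ * aeval w⁻¹ θ * (1 - G n g w)) *
          ((w⁻¹ - 2 + w) * polylog (-2 * d - 1) w) - V w) := by
  set r : ℤ → ℝ := resid (cov d θ φ) n g with hr
  obtain ⟨K, hK⟩ := exists_abs_resid_le hd₁ hd₂ (θ := θ) hφ n g
  have hF := integrable_specDensity hd₁ hd₂ (θ := θ) hφ
  have hG := isMultiplier_one_sub_G n g
  set h : ℝ → ℂ := fun l => (1 - G n g (circ l)) * (specDensity d θ φ l : ℂ) with hh
  have hint : Integrable h arcMeasure := integrable_continuous_mul hF hG.cont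
  have hcoef : ∀ j : ℤ, ∫ l, h l * circ l ^ (-j) ∂arcMeasure = r j :=
    integral_residual hd₁ hd₂ hφ n g
  have hA : IsMultiplier fun w => aeval w φ * aeval w⁻¹ φ :=
    (IsMultiplier.id.aeval φ).mul (IsMultiplier.inv.aeval φ)
  have hB : IsMultiplier fun w => aeval w θ * aeval w⁻¹ θ * (1 - G n g w) :=
    ((IsMultiplier.id.aeval θ).mul (IsMultiplier.inv.aeval θ)).mul hG
  obtain ⟨L₁, hL₁, e₁⟩ := hA.cauchy_mul h hint
  obtain ⟨L₂, hL₂, e₂⟩ := hB.cauchy_mul _ (integrable_f0 hd₁ hd₂)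
  -- The same density written with `f` and with `f₀`: computing its Cauchy transform in both ways
  -- yields the functional equations.
  have hAB : (fun l => aeval (circ l) φ * aeval (circ l)⁻¹ φ * h l) =
      fun l => aeval (circ l) θ * aeval (circ l)⁻¹ θ * (1 - G n g (circ l)) * (f0 d l : ℂ) := by
    funext l
    simp only [hh]
    linear_combination (1 - G n g (circ l)) * density_mul (d := d) (θ := θ) hφ l
  have hS₀ : ∀ w : ℂ, 1 < ‖w‖ →
      HasSum (fun m : ℕ => (r (-m) : ℂ) * w⁻¹ ^ m) (r 0 - cauchy h w) := by
    intro w hw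
    have h1 := hasSum_cauchy_of_one_lt_norm hint hw
    have e : ∀ j : ℕ, ∫ l, h l * circ l ^ ((j : ℤ) + 1) ∂arcMeasure = r (-((j + 1 : ℕ) : ℤ)) := by
      intro j
      rw [← hcoef, neg_neg]
      push_cast
      rfl
    simp only [e] at h1
    rw [← hasSum_nat_add_iff' 1]
    convert! h1 using 1
    simp
  have hS₁ : ∀ w : ℂ, w ≠ 0 → ‖w‖ < 1 →
      HasSum (fun m : ℕ => (r (n + m) : ℂ) * w ^ m) ((w ^ n)⁻¹ * (cauchy h w - r 0)) := by
    intro w hw0 hw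
    have h1 := hasSum_cauchy_of_norm_lt_one hint hw
    simp only [hcoef] at h1
    rw [← hasSum_nat_add_iff' n] at h1
    -- The normal equations kill the coefficients `1, …, n - 1`, so dropping the first `n` terms
    -- removes only `r(0)`.
    have e : ∑ i ∈ Finset.range n, (r i : ℂ) * w ^ i = r 0 := by
      rw [Finset.sum_eq_single_of_mem 0 (Finset.mem_range.2 hn)]
      · simp
      · intro i hi hi0
        rw [hr, resid_eq_zero hg (by omega) (by have := Finset.mem_range.1 hi; omega)]
        simp
    rw [e] at h1
    convert! h1.mul_left (w ^ n)⁻¹ using 1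
    funext m
    rw [pow_add, show ((m + n : ℕ) : ℤ) = n + m by push_cast; ring]
    field_simp
  have hb₀ : ∀ m : ℕ, ‖(r (-m) : ℂ)‖ ≤ K := fun m => hK _
  have hb₁ : ∀ m : ℕ, ‖(r (n + m) : ℂ)‖ ≤ K := fun m => hK _
  have hinv : ∀ w : ℂ, 1 < ‖w‖ → ‖w⁻¹‖ < 1 := fun w hw => by
    rw [norm_inv]; exact inv_lt_one_of_one_lt₀ hw
  have hne : ∀ w : ℂ, 1 < ‖w‖ → w ≠ 0 := by
    rintro w hw rfl
    simp at hw
    linarith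
  refine ⟨fun w hw => ⟨(hasSum_gL (summable_bounded_mul_pow hb₀ (hinv w hw)).hasSum).summable,
    (hasSum_gR (summable_bounded_mul_pow hb₁ (hinv w hw)).hasSum).summable⟩,
    fun v => ∑' m : ℕ, (r (-m) : ℂ) * v ^ m, fun v => ∑' m : ℕ, (r (n + m) : ℂ) * v ^ m,
    -- `V` collects `r(0)`, the multiplier errors, and the constant `1/2` in the Cauchy transform of
    -- `f₀`. Since that constant is the same on both sides of the circle, one `V` serves both
    -- equations, with opposite signs.
    fun w => aeval w φ * aeval w⁻¹ φ * r 0 - 1 / 2 * (aeval w θ * aeval w⁻¹ θ * (1 - G n g w)) -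
      (L₂ w - L₁ w),
    differentiableOn_tsum_of_bounded hb₀, differentiableOn_tsum_of_bounded hb₁,
    ((hA.diff.mul_const _).sub (hB.diff.const_mul _)).sub (hL₂.sub hL₁),
    fun w hw => ⟨(hasSum_gL (summable_bounded_mul_pow hb₀ (hinv w hw)).hasSum).tsum_eq,
      (hasSum_gR (summable_bounded_mul_pow hb₁ (hinv w hw)).hasSum).tsum_eq⟩,
    fun w hw => ?_, fun w hw0 hw => ?_⟩
  · have h1 := e₁ w (hne w hw) hw.ne'
    rw [hAB, e₂ w (hne w hw) hw.ne', cauchy_f0_of_one_lt_norm hd₁ hd₂ hw] at h1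
    simp only [(hS₀ w hw).tsum_eq]
    linear_combination h1
  · have h1 := e₁ w hw0 hw.ne
    rw [hAB, e₂ w hw0 hw.ne, cauchy_f0_of_norm_lt_one hd₁ hd₂ hw0 hw] at h1
    simp only [(hS₁ w hw0 hw).tsum_eq]
    rw [mul_inv_cancel_left₀ (pow_ne_zero n hw0)]
    linear_combination -h1

/-! ### Analytic continuation and its consequences -/

/-- The sectionally holomorphic function which is `w ^ q φ(w⁻¹) S(w⁻¹)` outside the unit disk. -/
noncomputable def extension (d : ℝ) (φ : ℝ[X]) (q : ℕ) (K S V : ℂ → ℂ) (w : ℂ) : ℂ :=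
  if 1 < ‖w‖ then w ^ q * aeval w⁻¹ φ * S w⁻¹
  else w ^ q * (1 / 2 * K w * ((w⁻¹ - 2 + w) * polylog (-2 * d - 1) w⁻¹) + V w) / aeval w φ

/-- The functional equations of a pair of generating functions `S`, `T`, with symbol `K`. -/
structure IsContinuation (d : ℝ) (φ : ℝ[X]) (n : ℕ) (K S T V : ℂ → ℂ) : Prop where
  diff_K : DifferentiableOn ℂ K {0}ᶜ
  diff_S : DifferentiableOn ℂ S (Metric.ball 0 1)
  diff_T : DifferentiableOn ℂ T (Metric.ball 0 1)
  diff_V : DifferentiableOn ℂ V {0}ᶜ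
  ne_zero : ∀ w : ℂ, ‖w‖ ≤ 1 → aeval w φ ≠ 0
  outside : ∀ w : ℂ, 1 < ‖w‖ → aeval w φ * aeval w⁻¹ φ * S w⁻¹ =
    1 / 2 * K w * ((w⁻¹ - 2 + w) * polylog (-2 * d - 1) w⁻¹) + V w
  inside : ∀ w : ℂ, w ≠ 0 → ‖w‖ < 1 → aeval w φ * aeval w⁻¹ φ * (w ^ n * T w) =
    1 / 2 * K w * ((w⁻¹ - 2 + w) * polylog (-2 * d - 1) w) - V w

theorem two_pi_mul_Q (d : ℝ) (w : ℂ) : 2 * Real.pi * Q d w =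
    1 / 2 * ((w⁻¹ - 2 + w) * (polylog (-2 * d - 1) w + polylog (-2 * d - 1) w⁻¹)) := by
  have hpi : (Real.pi : ℂ) ≠ 0 := by exact_mod_cast Real.pi_ne_zero
  rw [Q]
  field_simp
  ring

theorem isOpen_compl_zero : IsOpen ({0}ᶜ : Set ℂ) := isOpen_compl_singleton

theorem differentiableAt_aeval (φ : ℝ[X]) (w : ℂ) : DifferentiableAt ℂ (fun w => aeval w φ) w :=
  Polynomial.differentiableAt_aeval φ

theorem differentiableAt_aeval_inv (φ : ℝ[X]) {w : ℂ} (hw : w ≠ 0) :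
    DifferentiableAt ℂ (fun w => aeval w⁻¹ φ) w :=
  DifferentiableAt.comp (g := fun w : ℂ => aeval w φ) w (differentiableAt_aeval φ w⁻¹)
    (differentiableAt_inv hw)

namespace IsContinuation

variable {d : ℝ} {φ : ℝ[X]} {n : ℕ} {K S T V : ℂ → ℂ}

/-- After multiplication by `φ(w)` the two cases of the definition coincide, by the outer functional
equation. This is what glues them across the unit circle. -/
theorem mul_extension (H : IsContinuation d φ n K S T V) (q : ℕ) (w : ℂ) :
    aeval w φ * extension d φ q K S V w =
      w ^ q * (1 / 2 * K w * ((w⁻¹ - 2 + w) * polylog (-2 * d - 1) w⁻¹) + V w) := by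
  rw [extension]
  split_ifs with hw
  · rw [← H.outside w hw]
    ring
  · have := H.ne_zero w (not_lt.1 hw)
    field_simp

theorem extension_eq_of_ne_zero (H : IsContinuation d φ n K S T V) (q : ℕ) {w : ℂ}
    (hφ : aeval w φ ≠ 0) : extension d φ q K S V w =
      w ^ q * (1 / 2 * K w * ((w⁻¹ - 2 + w) * polylog (-2 * d - 1) w⁻¹) + V w) / aeval w φ := by
  rw [← H.mul_extension q w]
  field_simp

/-- Eliminating `V` with the inner functional equation turns `Li(w⁻¹)` into `Li(w) + Li(w⁻¹)`. The
result isolates `Q` as the only factor that can jump across the cut. -/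
theorem extension_of_norm_lt_one (H : IsContinuation d φ n K S T V) (q : ℕ) {w : ℂ} (hw0 : w ≠ 0)
    (hw : ‖w‖ < 1) : extension d φ q K S V w =
      2 * Real.pi * (w ^ q * K w) / aeval w φ * Q d w - w ^ (n + q) * aeval w⁻¹ φ * T w := by
  have hφ := H.ne_zero w hw.le
  refine mul_left_cancel₀ hφ ?_
  rw [H.mul_extension]
  have h1 := H.inside w hw0 hw
  have h2 := two_pi_mul_Q d w
  have e : aeval w φ * (2 * Real.pi * (w ^ q * K w) / aeval w φ * Q d w -
      w ^ (n + q) * aeval w⁻¹ φ * T w) =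
      w ^ q * K w * (2 * Real.pi * Q d w) - w ^ q * (aeval w φ * aeval w⁻¹ φ * (w ^ n * T w)) := by
    rw [pow_add]
    field_simp
  rw [e, h1, h2]
  ring

theorem differentiableOn_extension (H : IsContinuation d φ n K S T V) (hd₂ : d < 1 / 2) (q : ℕ) :
    DifferentiableOn ℂ (extension d φ q K S V) unitCutᶜ := by
  intro w hw
  refine DifferentiableAt.differentiableWithinAt ?_
  have hw0 := ne_zero_of_notMem_unitCut hw
  by_cases h : 1 < ‖w‖
  · have hev : extension d φ q K S V =ᶠ[𝓝 w] fun w => w ^ q * aeval w⁻¹ φ * S w⁻¹ := by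
      filter_upwards [(isOpen_lt continuous_const continuous_norm).mem_nhds h] with v hv
      rw [extension, if_pos hv]
    refine DifferentiableAt.congr_of_eventuallyEq ?_ hev
    have hS : DifferentiableAt ℂ S w⁻¹ := H.diff_S.differentiableAt (Metric.isOpen_ball.mem_nhds (by
      simpa using inv_lt_one_of_one_lt₀ h))
    have hS' : DifferentiableAt ℂ (fun w : ℂ => S w⁻¹) w :=
      DifferentiableAt.comp (g := S) w hS (differentiableAt_inv hw0)
    have hp : DifferentiableAt ℂ (fun w : ℂ => w ^ q) w := by fun_prop
    exact (hp.mul (differentiableAt_aeval_inv φ hw0)).mul hS'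
  · have hφ := H.ne_zero w (not_lt.1 h)
    have hev : extension d φ q K S V =ᶠ[𝓝 w] fun w =>
        w ^ q * (1 / 2 * K w * ((w⁻¹ - 2 + w) * polylog (-2 * d - 1) w⁻¹) + V w) / aeval w φ := by
      filter_upwards [(differentiableAt_aeval φ w).continuousAt.eventually_ne hφ] with v hv
      exact H.extension_eq_of_ne_zero q hv
    refine DifferentiableAt.congr_of_eventuallyEq ?_ hev
    have hi : DifferentiableAt ℂ (fun w : ℂ => w⁻¹) w := differentiableAt_inv hw0
    have hL : DifferentiableAt ℂ (fun w : ℂ => polylog (-2 * d - 1) w⁻¹) w :=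
      DifferentiableAt.comp (g := polylog (-2 * d - 1)) w
        (differentiableAt_polylog (by linarith) (one_sub_inv_mem_slitPlane hw)) hi
    have hp : DifferentiableAt ℂ (fun w : ℂ => w ^ q) w := by fun_prop
    have hK := H.diff_K.differentiableAt (isOpen_compl_zero.mem_nhds hw0)
    have hV := H.diff_V.differentiableAt (isOpen_compl_zero.mem_nhds hw0)
    have hM : DifferentiableAt ℂ (fun w : ℂ => w⁻¹ - 2 + w) w :=
      (hi.sub_const 2).add differentiableAt_id
    exact (hp.mul (((hK.const_mul (1 / 2)).mul (hM.mul hL)).add hV)).div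
      (differentiableAt_aeval φ w) hφ

theorem tendsto_extension (H : IsContinuation d φ n K S T V) (q : ℕ) {t : ℝ}
    (ht : t ∈ Set.Ioo (0 : ℝ) 1) {F : Filter ℂ} (hF : F ≤ 𝓝 (t : ℂ)) {m : ℂ}
    (hQ : Tendsto (Q d) F (𝓝 m)) : Tendsto (extension d φ q K S V) F
      (𝓝 (2 * Real.pi * ((t : ℂ) ^ q * K t) / aeval (t : ℂ) φ * m -
        (t : ℂ) ^ (n + q) * aeval (t : ℂ)⁻¹ φ * T t)) := by
  have ht0 : (t : ℂ) ≠ 0 := by exact_mod_cast ht.1.ne'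
  have htn : ‖(t : ℂ)‖ < 1 := by
    rw [Complex.norm_real, Real.norm_of_nonneg ht.1.le]; exact ht.2
  have hK := (H.diff_K.differentiableAt (isOpen_compl_zero.mem_nhds ht0)).continuousAt.tendsto.mono_left hF
  have hT := (H.diff_T.differentiableAt
    (Metric.isOpen_ball.mem_nhds (by simpa using htn))).continuousAt.tendsto.mono_left hF
  have hφ := (differentiableAt_aeval φ (t : ℂ)).continuousAt.tendsto.mono_left hF
  have hφi := (differentiableAt_aeval_inv φ ht0).continuousAt.tendsto.mono_left hF
  have hp : ∀ k : ℕ, Tendsto (fun w : ℂ => w ^ k) F (𝓝 ((t : ℂ) ^ k)) := fun k =>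
    ((continuous_pow k).tendsto _).mono_left hF
  refine (((((hp q).mul hK).const_mul (2 * Real.pi : ℂ)).div hφ (H.ne_zero _ htn.le)).mul hQ).sub
    (((hp (n + q)).mul hφi).mul hT) |>.congr' ?_
  filter_upwards [hF (isOpen_compl_zero.mem_nhds ht0),
    hF ((isOpen_lt continuous_norm continuous_const).mem_nhds htn)] with w hw0 hw
  exact (H.extension_of_norm_lt_one q hw0 hw).symm

theorem sectionallyHolomorphic_extension (H : IsContinuation d φ n K S T V)
    (hd₁ : -(1 / 2) < d) (hd₂ : d < 1 / 2) (hd₀ : d ≠ 0) (q : ℕ) :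
    SectionallyHolomorphic (extension d φ q K S V) where
  holo := H.differentiableOn_extension hd₂ q
  above t ht := by
    obtain ⟨Qp, Qm, h1, -, -⟩ := exists_tendsto_Q hd₁ hd₂ hd₀ ht
    exact ⟨_, H.tendsto_extension q ht nhdsWithin_le_nhds h1⟩
  below t ht := by
    obtain ⟨Qp, Qm, -, h2, -⟩ := exists_tendsto_Q hd₁ hd₂ hd₀ ht
    exact ⟨_, H.tendsto_extension q ht nhdsWithin_le_nhds h2⟩

theorem growthAtInfinity_extension (H : IsContinuation d φ n K S T V) (q : ℕ) :
    GrowthAtInfinity q (extension d φ q K S V) := by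
  have hS : ContinuousAt (fun v => aeval v φ * S v) 0 :=
    ((differentiableAt_aeval φ 0).mul (H.diff_S.differentiableAt
      (Metric.isOpen_ball.mem_nhds (by simp)))).continuousAt
  have h1 := (hS.tendsto.comp (tendsto_inv₀_cobounded (α := ℂ))).isBigO_one ℂ
  have h2 := (Asymptotics.isBigO_refl (fun w : ℂ => w ^ q) (Bornology.cobounded ℂ)).mul h1
  refine h2.congr' ?_ (Eventually.of_forall fun w => mul_one _)
  filter_upwards [(tendsto_norm_cobounded_atTop (E := ℂ)).eventually_gt_atTop 1] with w hw
  rw [extension, if_pos hw]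
  simp only [Function.comp_apply]
  ring

/-- Since `w⁻¹ - 2 + w = w⁻¹ (w - 1)²`, the polylogarithmic part is `O(|w - 1|^{2-a})` with `2 - a =
-2d`, and the remaining term is bounded; the exponent `-2 max(d, 0)` dominates both. -/
theorem growthAtOne_extension (H : IsContinuation d φ n K S T V)
    (hd₁ : -(1 / 2) < d) (hd₂ : d < 1 / 2) (q : ℕ) :
    GrowthAtOne d (extension d φ q K S V) := by
  have ea : -2 * d - 1 = 1 - (2 * d + 2) := by ring
  have hφ1 : aeval (1 : ℂ) φ ≠ 0 := H.ne_zero 1 (by simp)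
  have h10 : (1 : ℂ) ∈ ({0}ᶜ : Set ℂ) := one_ne_zero
  have hK := (H.diff_K.differentiableAt (isOpen_compl_zero.mem_nhds h10)).continuousAt
  have hV := (H.diff_V.differentiableAt (isOpen_compl_zero.mem_nhds h10)).continuousAt
  have hφ := (differentiableAt_aeval φ (1 : ℂ)).continuousAt
  have hq : ContinuousAt (fun w : ℂ => w ^ q) 1 := (continuous_pow q).continuousAt
  have hi : ContinuousAt (fun w : ℂ => w⁻¹) 1 := continuousAt_inv₀ one_ne_zero
  have hbig : ∀ f : ℂ → ℂ, ContinuousAt f 1 → f =O[𝓝[unitCutᶜ] 1] fun _ => (1 : ℝ) := fun f hf =>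
    (hf.tendsto.mono_left nhdsWithin_le_nhds).isBigO_one ℝ
  have hc1 := hbig (fun w => w ^ q / aeval w φ * (1 / 2 * K w * w⁻¹))
    ((hq.div hφ hφ1).mul ((continuousAt_const.mul hK).mul hi))
  have hc2 := hbig (fun w => w ^ q / aeval w φ * V w) ((hq.div hφ hφ1).mul hV)
  have hnear : ∀ᶠ w : ℂ in 𝓝[unitCutᶜ] 1, 0 < ‖w - 1‖ ∧ ‖w - 1‖ ≤ 1 := by
    filter_upwards [self_mem_nhdsWithin,
      nhdsWithin_le_nhds (Metric.closedBall_mem_nhds (1 : ℂ) one_pos)] with w hw hw1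
    refine ⟨norm_pos_iff.2 (sub_ne_zero.2 ?_), by simpa [dist_eq_norm] using hw1⟩
    rintro rfl
    exact hw (mem_unitCut.2 (by simp))
  have hone : (fun _ : ℂ => (1 : ℝ)) =O[𝓝[unitCutᶜ] 1] fun w : ℂ => ‖w - 1‖ ^ (-2 * max d 0) := by
    refine Asymptotics.IsBigO.of_bound 1 ?_
    filter_upwards [hnear] with w hw
    rw [norm_one, one_mul, Real.norm_of_nonneg (Real.rpow_nonneg hw.1.le _)]
    exact Real.one_le_rpow_of_pos_of_le_one_of_nonpos hw.1 hw.2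
      (by nlinarith [le_max_right d 0])
  have hLi : (fun w : ℂ => (w - 1) ^ 2 * polylog (-2 * d - 1) w⁻¹) =O[𝓝[unitCutᶜ] 1]
      fun w : ℂ => ‖w - 1‖ ^ (-2 * max d 0) := by
    have htend : Tendsto (fun w : ℂ => w⁻¹) (𝓝[unitCutᶜ] 1)
        (𝓝[{z | 1 - z ∈ Complex.slitPlane}] 1) := by
      refine tendsto_nhdsWithin_iff.2 ⟨?_, ?_⟩
      · simpa using hi.tendsto.mono_left nhdsWithin_le_nhds
      · filter_upwards [self_mem_nhdsWithin] with w hw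
        exact one_sub_inv_mem_slitPlane hw
    have h1 := (polylog_isBigO_one (a := 2 * d + 2) (by linarith) (by linarith)).comp_tendsto htend
    have h2 := ((Asymptotics.isBigO_refl (fun w : ℂ => (w - 1) ^ 2) (𝓝[unitCutᶜ] 1)).norm_right).mul h1
    rw [ea]
    refine h2.trans ?_
    -- The constant comes from `|1 - w⁻¹| = |w - 1| / |w|` with `|w| ≤ 2`.
    refine Asymptotics.IsBigO.of_bound (2 ^ (2 * d + 2)) ?_
    filter_upwards [hnear] with w hw
    have hw2 : ‖w‖ ≤ 2 := by
      have := norm_add_le (w - 1) 1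
      rw [sub_add_cancel, norm_one] at this
      linarith [hw.2]
    have hp := hw.1
    simp only [Function.comp_apply]
    rw [norm_mul, norm_norm, Real.norm_of_nonneg (Real.rpow_nonneg (norm_nonneg _) _),
      Real.norm_of_nonneg (Real.rpow_nonneg (norm_nonneg _) _), norm_pow]
    -- The bound `‖w - 1‖ ≤ 1` alone does not exclude the origin, where the inverse takes its
    -- default value `0`.
    rcases eq_or_ne w 0 with rfl | hw0
    · simp only [inv_zero, sub_zero, zero_sub, norm_neg, norm_one, Real.one_rpow, one_pow, mul_one]
      exact Real.one_le_rpow one_le_two (by linarith)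
    have hwn : 0 < ‖w‖ := norm_pos_iff.2 hw0
    have e1 : ‖1 - w⁻¹‖ = ‖w - 1‖ / ‖w‖ := by
      rw [← norm_div, sub_div, div_self hw0, one_div]
    have h3 : ‖1 - w⁻¹‖ ^ (-(2 * d + 2)) ≤ 2 ^ (2 * d + 2) * ‖w - 1‖ ^ (-(2 * d + 2)) := by
      have e2 : (2 : ℝ) ^ (2 * d + 2) * ‖w - 1‖ ^ (-(2 * d + 2)) =
          (‖w - 1‖ / 2) ^ (-(2 * d + 2)) := by
        rw [Real.div_rpow hp.le zero_le_two, Real.rpow_neg zero_le_two (2 * d + 2), div_inv_eq_mul,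
          mul_comm]
      rw [e2, e1]
      exact Real.rpow_le_rpow_of_nonpos (by positivity) (by gcongr) (by linarith)
    calc ‖w - 1‖ ^ 2 * ‖1 - w⁻¹‖ ^ (-(2 * d + 2))
        ≤ ‖w - 1‖ ^ 2 * (2 ^ (2 * d + 2) * ‖w - 1‖ ^ (-(2 * d + 2))) := by gcongr
      _ = 2 ^ (2 * d + 2) * ‖w - 1‖ ^ (-2 * d) := by
        rw [← Real.rpow_natCast, mul_left_comm, ← Real.rpow_add hp]
        congr 2
        push_cast
        ring
      _ ≤ 2 ^ (2 * d + 2) * ‖w - 1‖ ^ (-2 * max d 0) := by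
        refine mul_le_mul_of_nonneg_left ?_ (by positivity)
        exact Real.rpow_le_rpow_of_exponent_ge hp hw.2 (by linarith [le_max_left d 0])
  have hmain := hc1.mul hLi
  simp only [one_mul] at hmain
  refine (hmain.add (hc2.trans hone)).congr' ?_ EventuallyEq.rfl
  filter_upwards [nhdsWithin_le_nhds (hφ.eventually_ne hφ1), self_mem_nhdsWithin] with w hw hcut
  have hw0 := ne_zero_of_notMem_unitCut hcut
  rw [H.extension_eq_of_ne_zero q hw]
  field_simp
  ring

end IsContinuation

/-! ### Behaviour at the origin -/

theorem tendsto_inv_Q {d : ℝ} (hd₁ : -(1 / 2) < d) (hd₂ : d < 1 / 2) (hd₀ : d ≠ 0) :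
    Tendsto (fun w => (Q d w)⁻¹) (𝓝[unitCutᶜ] 0) (𝓝 0) := by
  obtain ⟨c, hc, hlim⟩ := exists_tendsto_mul_Q hd₁ hd₂ hd₀
  have h := (hlim.inv₀ hc).mul (tendsto_mul_neg_log_norm_rpow (2 * d + 1))
  rw [mul_zero] at h
  refine h.congr' ?_
  filter_upwards [self_mem_nhdsWithin, tendsto_neg_log_norm.eventually_gt_atTop 0] with w hw hx
  have hw0 := ne_zero_of_notMem_unitCut hw
  have hL : (((-Real.log ‖w‖) ^ (2 * d + 1) : ℝ) : ℂ) ≠ 0 := by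
    exact_mod_cast (Real.rpow_pos_of_pos hx _).ne'
  rw [mul_inv, mul_inv]
  field_simp

/-- The imaginary part is at most `π`, hence at most `-log |w|`. This makes `|log w⁻¹|` and `-log
|w|` comparable near `0`. -/
theorem norm_log_inv_le {w : ℂ} (hw : Real.pi ≤ -Real.log ‖w‖) :
    ‖Complex.log w⁻¹‖ ≤ 2 * -Real.log ‖w‖ := by
  have h1 := Complex.norm_le_abs_re_add_abs_im (Complex.log w⁻¹)
  have h2 := abs_log_im_le_pi w⁻¹
  rw [Complex.log_re, norm_inv, Real.log_inv, abs_of_nonneg (Real.pi_pos.le.trans hw)] at h1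
  linarith

theorem growthAtZero_Q {d : ℝ} (hd₁ : -(1 / 2) < d) (hd₂ : d < 1 / 2) (hd₀ : d ≠ 0) :
    GrowthAtZero d (Q d) := by
  obtain ⟨c, -, hlim⟩ := exists_tendsto_mul_Q hd₁ hd₂ hd₀
  refine Asymptotics.IsBigO.of_bound ((‖c‖ + 1) * 2 ^ (1 + 2 * d)) ?_
  filter_upwards [self_mem_nhdsWithin, tendsto_neg_log_norm.eventually_ge_atTop Real.pi,
    hlim.norm.eventually_le_const (lt_add_one ‖c‖)] with w hw hx hb
  have hx0 : 0 < -Real.log ‖w‖ := Real.pi_pos.trans_le hx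
  have hw0 : 0 < ‖w‖ := norm_pos_iff.2 (ne_zero_of_notMem_unitCut hw)
  have hl := norm_log_inv_le hx
  have hl0 : 0 < ‖Complex.log w⁻¹‖ := by
    refine hx0.trans_le (le_trans (le_of_eq ?_) (Complex.re_le_norm _))
    rw [Complex.log_re, norm_inv, Real.log_inv]
  have hL := Real.rpow_pos_of_pos hx0 (2 * d + 1)
  rw [norm_mul, norm_mul, Complex.norm_real, Real.norm_of_nonneg hL.le] at hb
  have h1 : ((-Real.log ‖w‖) ^ (2 * d + 1))⁻¹ ≤
      2 ^ (1 + 2 * d) * ‖Complex.log w⁻¹‖ ^ (-1 - 2 * d) := by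
    have e1 : (2 : ℝ) ^ (1 + 2 * d) * ‖Complex.log w⁻¹‖ ^ (-1 - 2 * d) =
        (‖Complex.log w⁻¹‖ / 2) ^ (-(2 * d + 1)) := by
      have e : -1 - 2 * d = -(2 * d + 1) := by ring
      rw [Real.div_rpow hl0.le zero_le_two, Real.rpow_neg zero_le_two (2 * d + 1), div_inv_eq_mul,
        mul_comm, e, add_comm 1]
    rw [e1, ← Real.rpow_neg hx0.le]
    exact Real.rpow_le_rpow_of_nonpos (by positivity) (by linarith) (by linarith)
  rw [Real.norm_of_nonneg (by positivity)]
  calc ‖Q d w‖ = (‖w‖ * ‖Q d w‖ * (-Real.log ‖w‖) ^ (2 * d + 1)) *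
        (‖w‖⁻¹ * ((-Real.log ‖w‖) ^ (2 * d + 1))⁻¹) := by field_simp
    _ ≤ (‖c‖ + 1) * (‖w‖⁻¹ * (2 ^ (1 + 2 * d) * ‖Complex.log w⁻¹‖ ^ (-1 - 2 * d))) := by gcongr
    _ = _ := by ring

/-- The degree bound makes `w^N p(w⁻¹)` a polynomial in `w` with constant term `p.coeff N`. -/
theorem tendsto_pow_mul_aeval_inv (p : ℝ[X]) {N : ℕ} (hN : p.natDegree ≤ N) :
    Tendsto (fun w : ℂ => w ^ N * aeval w⁻¹ p) (𝓝[≠] 0) (𝓝 (p.coeff N : ℂ)) := by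
  have hcont : Continuous fun w : ℂ => ∑ i ∈ Finset.range (N + 1), (p.coeff i : ℂ) * w ^ (N - i) := by
    fun_prop
  have h0 : ∑ i ∈ Finset.range (N + 1), (p.coeff i : ℂ) * (0 : ℂ) ^ (N - i) = p.coeff N := by
    rw [Finset.sum_range_succ, Finset.sum_eq_zero, Nat.sub_self, pow_zero, mul_one, zero_add]
    intro i hi
    rw [zero_pow (Nat.sub_ne_zero_of_lt (Finset.mem_range.1 hi)), mul_zero]
  refine ((hcont.tendsto' 0 _ h0).mono_left nhdsWithin_le_nhds).congr' ?_
  filter_upwards [self_mem_nhdsWithin] with w (hw : w ≠ 0)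
  rw [aeval_eq_sum_range' (Nat.lt_succ_of_le hN), Finset.mul_sum]
  refine Finset.sum_congr rfl fun i hi => ?_
  rw [Complex.real_smul, mul_left_comm, inv_pow, ← pow_sub₀ w hw (Finset.mem_range_succ_iff.1 hi)]

namespace IsContinuation

variable {d : ℝ} {φ : ℝ[X]} {n : ℕ} {K S T V : ℂ → ℂ}

/-- In the disk representation, `w^{n+q} φ(w⁻¹) T(w)` stays bounded when `deg φ ≤ n + q`, so
division by `Q` sends it to `0`. Only the first term survives, and `φ(0) = 1`. -/
theorem tendsto_extension_div_Q (H : IsContinuation d φ n K S T V) (hd₁ : -(1 / 2) < d)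
    (hd₂ : d < 1 / 2) (hd₀ : d ≠ 0) (hφ₀ : φ.coeff 0 = 1) {q : ℕ} (hdeg : φ.natDegree ≤ n + q)
    {κ : ℂ} (hκ : Tendsto (fun w => w ^ q * K w) (𝓝[≠] 0) (𝓝 κ)) :
    Tendsto (fun w => extension d φ q K S V w / Q d w) (𝓝[unitCutᶜ] 0) (𝓝 (2 * Real.pi * κ)) := by
  have hle : 𝓝[unitCutᶜ] (0 : ℂ) ≤ 𝓝[≠] 0 :=
    nhdsWithin_mono _ fun w hw => ne_zero_of_notMem_unitCut hw
  have hφ := (differentiableAt_aeval φ 0).continuousAt.tendsto.mono_left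
    (nhdsWithin_le_nhds (s := unitCutᶜ))
  have e0 : aeval (0 : ℂ) φ = 1 := by
    rw [← Polynomial.coeff_zero_eq_aeval_zero', hφ₀, map_one]
  rw [e0] at hφ
  have hT := (H.diff_T.differentiableAt (Metric.isOpen_ball.mem_nhds
    (Metric.mem_ball_self one_pos))).continuousAt.tendsto.mono_left
    (nhdsWithin_le_nhds (s := unitCutᶜ))
  have h := (((hκ.mono_left hle).const_mul (2 * Real.pi : ℂ)).div hφ one_ne_zero).sub
    ((((tendsto_pow_mul_aeval_inv φ hdeg).mono_left hle).mul hT).mul (tendsto_inv_Q hd₁ hd₂ hd₀))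
  rw [mul_zero, sub_zero, div_one] at h
  obtain ⟨c, hc, hlim⟩ := exists_tendsto_mul_Q hd₁ hd₂ hd₀
  refine h.congr' ?_
  filter_upwards [self_mem_nhdsWithin, hlim.eventually_ne hc,
    nhdsWithin_le_nhds (Metric.ball_mem_nhds (0 : ℂ) one_pos)] with w hw hne hw1
  have hQ : Q d w ≠ 0 := right_ne_zero_of_mul (left_ne_zero_of_mul hne)
  rw [H.extension_of_norm_lt_one q (ne_zero_of_notMem_unitCut hw) (by simpa using hw1)]
  simp only [Pi.div_apply]
  field_simp

theorem growthAtZero_extension (H : IsContinuation d φ n K S T V) (hd₁ : -(1 / 2) < d)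
    (hd₂ : d < 1 / 2) (hd₀ : d ≠ 0) (hφ₀ : φ.coeff 0 = 1) {q : ℕ} (hdeg : φ.natDegree ≤ n + q)
    {κ : ℂ} (hκ : Tendsto (fun w => w ^ q * K w) (𝓝[≠] 0) (𝓝 κ)) :
    GrowthAtZero d (extension d φ q K S V) := by
  obtain ⟨c, hc, hlim⟩ := exists_tendsto_mul_Q hd₁ hd₂ hd₀
  have h := ((H.tendsto_extension_div_Q hd₁ hd₂ hd₀ hφ₀ hdeg hκ).isBigO_one ℝ).mul
    (growthAtZero_Q hd₁ hd₂ hd₀)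
  simp only [one_mul] at h
  refine h.congr' ?_ EventuallyEq.rfl
  filter_upwards [hlim.eventually_ne hc] with w hne
  exact div_mul_cancel₀ _ (right_ne_zero_of_mul (left_ne_zero_of_mul hne))

end IsContinuation

/-! ### Reflection, jump relations and the algebraic condition -/

theorem norm_inv_lt_one {w : ℂ} (hw : 1 < ‖w‖) : ‖w⁻¹‖ < 1 := by
  rw [norm_inv]
  exact inv_lt_one_of_one_lt₀ hw

theorem one_lt_norm_inv {w : ℂ} (hw0 : w ≠ 0) (hw : ‖w‖ < 1) : 1 < ‖w⁻¹‖ := by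
  rw [norm_inv]
  exact one_lt_inv₀ (norm_pos_iff.2 hw0) |>.2 hw

theorem differentiableOn_comp_inv {F : ℂ → ℂ} (hF : DifferentiableOn ℂ F {0}ᶜ) :
    DifferentiableOn ℂ (fun w => F w⁻¹) {0}ᶜ :=
  hF.comp (fun w hw => (differentiableAt_inv hw).differentiableWithinAt) fun w hw => by simpa using hw

namespace IsContinuation

variable {d : ℝ} {φ : ℝ[X]} {n : ℕ} {K S T V : ℂ → ℂ}

/-- Replacing `w` by `w⁻¹` and multiplying by `w^n` turns the inner equation into an outer one and
conversely, with the sign of `V` reversed. Thus all results for `Φ₀` transfer to `Φ₁`. -/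
theorem reflect (H : IsContinuation d φ n K S T V) :
    IsContinuation d φ n (fun w => w ^ n * K w⁻¹) T S fun w => -(w ^ n * V w⁻¹) where
  diff_K := (differentiable_pow n).differentiableOn.mul (differentiableOn_comp_inv H.diff_K)
  diff_S := H.diff_T
  diff_T := H.diff_S
  diff_V := ((differentiable_pow n).differentiableOn.mul (differentiableOn_comp_inv H.diff_V)).neg
  ne_zero := H.ne_zero
  outside w hw := by
    have hw0 : w ≠ 0 := norm_pos_iff.1 (one_pos.trans hw)
    have h := H.inside w⁻¹ (inv_ne_zero hw0) (norm_inv_lt_one hw)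
    rw [inv_inv] at h
    have e : aeval w φ * aeval w⁻¹ φ * T w⁻¹ =
        w ^ n * (aeval w⁻¹ φ * aeval w φ * (w⁻¹ ^ n * T w⁻¹)) := by
      rw [inv_pow]
      field_simp
    rw [e, h]
    ring
  inside w hw0 hw := by
    have h := H.outside w⁻¹ (one_lt_norm_inv hw0 hw)
    rw [inv_inv] at h
    have e : aeval w φ * aeval w⁻¹ φ * (w ^ n * S w) =
        w ^ n * (aeval w⁻¹ φ * aeval w φ * S w) := by ring
    rw [e, h]
    ring

/-- The part of the disk representation without `Q` has the same limit from both sides, so it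
survives in `Φ^+ - (Q^+/Q^-) Φ^-` with the factor `Q^+/Q^- - 1`. It is expressed through the other
function at `t⁻¹`, outside the disk, where the value depends neither on `K'` nor on `V'`. -/
theorem jump (H : IsContinuation d φ n K S T V) (q : ℕ) (K' V' : ℂ → ℂ) {t : ℝ}
    (ht : t ∈ Set.Ioo (0 : ℝ) 1) {F F' : Filter ℂ} (hF : F ≤ 𝓝 (t : ℂ)) (hF' : F' ≤ 𝓝 (t : ℂ))
    {Qp Qm : ℂ} (hQp : Tendsto (Q d) F (𝓝 Qp)) (hQm : Tendsto (Q d) F' (𝓝 Qm)) (hm : Qm ≠ 0) :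
    ∃ Φp Φm : ℂ, Tendsto (extension d φ q K S V) F (𝓝 Φp) ∧
      Tendsto (extension d φ q K S V) F' (𝓝 Φm) ∧
      Φp - Qp / Qm * Φm = (t : ℂ) ^ (n + 2 * q) * extension d φ q K' T V' (t : ℂ)⁻¹ *
        (aeval (t : ℂ)⁻¹ φ / aeval (t : ℂ) φ) * (Qp / Qm - 1) := by
  refine ⟨_, _, H.tendsto_extension q ht hF hQp, H.tendsto_extension q ht hF' hQm, ?_⟩
  have ht0 : (t : ℂ) ≠ 0 := by exact_mod_cast ht.1.ne'
  have htn : ‖(t : ℂ)‖ < 1 := by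
    rw [Complex.norm_real, Real.norm_of_nonneg ht.1.le]; exact ht.2
  have hφ := H.ne_zero _ htn.le
  rw [extension, if_pos (one_lt_norm_inv ht0 htn), inv_inv]
  have e : (t : ℂ) ^ (n + 2 * q) = (t : ℂ) ^ (n + q) * (t : ℂ) ^ q := by ring
  rw [e, inv_pow]
  generalize aeval (t : ℂ)⁻¹ φ = y
  field_simp
  ring

theorem jumpCondition (H : IsContinuation d φ n K S T V) (hd₁ : -(1 / 2) < d)
    (hd₂ : d < 1 / 2) (hd₀ : d ≠ 0) (q : ℕ) :
    JumpCondition d φ n q (extension d φ q K S V)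
      (extension d φ q (fun w => w ^ n * K w⁻¹) T fun w => -(w ^ n * V w⁻¹)) := by
  intro t ht
  obtain ⟨Qp, Qm, hp, hm, hne⟩ := exists_tendsto_Q hd₁ hd₂ hd₀ ht
  obtain ⟨a, b, ha, hb, hab⟩ := H.jump q (fun w => w ^ n * K w⁻¹) (fun w => -(w ^ n * V w⁻¹)) ht
    nhdsWithin_le_nhds nhdsWithin_le_nhds hp hm hne
  obtain ⟨a', b', ha', hb', hab'⟩ := H.reflect.jump q K V ht
    nhdsWithin_le_nhds nhdsWithin_le_nhds hp hm hne
  exact ⟨a, b, a', b', Qp, Qm, ha, hb, ha', hb', hp, hm, hne, hab, hab'⟩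

/-- The `V` terms of the function and of its reflection cancel, and `Li(w⁻¹)` and `Li(w)` combine to
`Q`. The zeros in (H3) can then be read off the factors `K` and `Q`. -/
theorem algExpr_extension (H : IsContinuation d φ n K S T V) (q : ℕ) {w : ℂ} (hw : w ≠ 0) :
    algExpr φ n q (extension d φ q K S V)
      (extension d φ q (fun w => w ^ n * K w⁻¹) T fun w => -(w ^ n * V w⁻¹)) w =
      2 * Real.pi * (w ^ q * K w) * Q d w := by
  have h1 := H.mul_extension q w
  have h2 := H.reflect.mul_extension q w⁻¹
  have h3 := two_pi_mul_Q d w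
  simp only [inv_inv] at h2
  have e1 : algExpr φ n q (extension d φ q K S V)
      (extension d φ q (fun w => w ^ n * K w⁻¹) T fun w => -(w ^ n * V w⁻¹)) w =
      aeval w φ * extension d φ q K S V w + w ^ n * w ^ q * w ^ q * (aeval w⁻¹ φ *
        extension d φ q (fun w => w ^ n * K w⁻¹) T (fun w => -(w ^ n * V w⁻¹)) w⁻¹) := by
    rw [algExpr]
    ring
  have e2 : 2 * Real.pi * (w ^ q * K w) * Q d w = w ^ q * K w * (2 * Real.pi * Q d w) := by ring
  rw [e1, e2, h1, h2, h3, inv_pow, inv_pow]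
  field_simp
  ring

end IsContinuation

theorem tendsto_inv_fromAbove {t : ℝ} (ht : 0 < t) :
    Tendsto (fun w : ℂ => w⁻¹) (fromAbove t) (fromBelow t⁻¹) := by
  refine tendsto_nhdsWithin_iff.2 ⟨?_, ?_⟩
  · have := (continuousAt_inv₀ (Complex.ofReal_ne_zero.2 ht.ne')).tendsto
    rw [← Complex.ofReal_inv] at this
    exact this.mono_left nhdsWithin_le_nhds
  · filter_upwards [self_mem_nhdsWithin] with w (hw : 0 < w.im)
    have hw0 : w ≠ 0 := by rintro rfl; simp at hw
    change (w⁻¹).im < 0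
    rw [Complex.inv_im]
    exact div_neg_of_neg_of_pos (neg_lt_zero.2 hw) (Complex.normSq_pos.2 hw0)

theorem tendsto_inv_fromBelow {t : ℝ} (ht : 0 < t) :
    Tendsto (fun w : ℂ => w⁻¹) (fromBelow t) (fromAbove t⁻¹) := by
  refine tendsto_nhdsWithin_iff.2 ⟨?_, ?_⟩
  · have := (continuousAt_inv₀ (Complex.ofReal_ne_zero.2 ht.ne')).tendsto
    rw [← Complex.ofReal_inv] at this
    exact this.mono_left nhdsWithin_le_nhds
  · filter_upwards [self_mem_nhdsWithin] with w (hw : w.im < 0)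
    have hw0 : w ≠ 0 := by rintro rfl; simp at hw
    change 0 < (w⁻¹).im
    rw [Complex.inv_im]
    exact div_pos (neg_pos.2 hw) (Complex.normSq_pos.2 hw0)

/-- For `t > 1`, `Q(w) = Q(w⁻¹)` reduces to `t⁻¹ < 1`; inversion exchanges the two half-planes. -/
theorem exists_tendsto_Q_of_ne_one {d : ℝ} (hd₁ : -(1 / 2) < d) (hd₂ : d < 1 / 2) (hd₀ : d ≠ 0)
    {t : ℝ} (ht : 0 < t) (ht1 : t ≠ 1) :
    ∃ Qp Qm : ℂ, Tendsto (Q d) (fromAbove t) (𝓝 Qp) ∧ Tendsto (Q d) (fromBelow t) (𝓝 Qm) := by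
  rcases lt_or_gt_of_ne ht1 with h | h
  · obtain ⟨a, b, ha, hb, -⟩ := exists_tendsto_Q hd₁ hd₂ hd₀ ⟨ht, h⟩
    exact ⟨a, b, ha, hb⟩
  · obtain ⟨a, b, ha, hb, -⟩ := exists_tendsto_Q hd₁ hd₂ hd₀ ⟨inv_pos.2 ht, inv_lt_one_of_one_lt₀ h⟩
    exact ⟨b, a, (hb.comp (tendsto_inv_fromAbove ht)).congr fun w => Q_inv d w,
      (ha.comp (tendsto_inv_fromBelow ht)).congr fun w => Q_inv d w⟩

/-- On the positive half-line only zeros of `θ` and their reciprocals occur. There `K` tends to `0`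
while `Q` has finite one-sided limits, since `|z_j| ≠ 1` excludes `t = 1`. -/
theorem IsContinuation.algebraicCondition {d : ℝ} {φ : ℝ[X]} {n : ℕ} {K S T V : ℂ → ℂ}
    (H : IsContinuation d φ n K S T V) (hd₁ : -(1 / 2) < d) (hd₂ : d < 1 / 2) (hd₀ : d ≠ 0)
    {q : ℕ} {z : Fin q → ℂ} (hz₁ : ∀ j, ‖z j‖ ≠ 1) (hK : ∀ j, K (z j) = 0 ∧ K (z j)⁻¹ = 0) :
    AlgebraicCondition d φ n z (extension d φ q K S V)
      (extension d φ q (fun w => w ^ n * K w⁻¹) T fun w => -(w ^ n * V w⁻¹)) := by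
  refine ⟨fun w hw hcut => ?_, fun t ht hw => ?_⟩
  · rw [H.algExpr_extension q
      (ne_zero_of_notMem_unitCut (notMem_unitCut_of_notMem_halfLine hcut))]
    rcases hw with (⟨j, rfl⟩ | ⟨j, rfl⟩) | ⟨-, hQ⟩
    · simp [(hK j).1]
    · simp [(hK j).2]
    · simp [hQ]
  · have hzero : K t = 0 ∧ t ≠ 1 := by
      rcases hw with (⟨j, hj⟩ | ⟨j, hj⟩) | ⟨hcut, -⟩
      · refine ⟨hj ▸ (hK j).1, ?_⟩
        rintro rfl
        exact hz₁ j (by simp [hj])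
      · refine ⟨hj ▸ (hK j).2, ?_⟩
        rintro rfl
        refine hz₁ j ?_
        have := congrArg norm hj
        simpa using this
      · exact absurd ⟨t, ht.le, rfl⟩ hcut
    have ht0 : (t : ℂ) ≠ 0 := Complex.ofReal_ne_zero.2 ht.ne'
    have hcK := (H.diff_K.differentiableAt (isOpen_compl_zero.mem_nhds ht0)).continuousAt
    have hc : Tendsto (fun w => 2 * Real.pi * (w ^ q * K w)) (𝓝 (t : ℂ)) (𝓝 0) := by
      have := ((continuous_pow q).continuousAt.mul hcK).const_mul (2 * Real.pi : ℂ)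
      simpa [ContinuousAt, hzero.1] using this
    obtain ⟨a, b, ha, hb⟩ := exists_tendsto_Q_of_ne_one hd₁ hd₂ hd₀ ht hzero.2
    have main : ∀ (F : Filter ℂ) (m : ℂ), F ≤ 𝓝 (t : ℂ) → Tendsto (Q d) F (𝓝 m) →
        Tendsto (algExpr φ n q (extension d φ q K S V)
          (extension d φ q (fun w => w ^ n * K w⁻¹) T fun w => -(w ^ n * V w⁻¹))) F (𝓝 0) := by
      intro F m hF hm
      have h := (hc.mono_left hF).mul hm
      rw [zero_mul] at h
      refine h.congr' ?_
      filter_upwards [hF (isOpen_compl_zero.mem_nhds ht0)] with w hw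
      exact (H.algExpr_extension q hw).symm
    exact ⟨main _ _ nhdsWithin_le_nhds ha, main _ _ nhdsWithin_le_nhds hb⟩

/-! ### Limits of the symbol `K` at the origin -/

theorem tendsto_G_zero (n : ℕ) (g : ℤ → ℝ) : Tendsto (G n g) (𝓝[≠] 0) (𝓝 0) := by
  refine (tendsto_finsetSum (a := fun _ => (0 : ℂ)) _ fun k hk => ?_).trans_eq (by simp)
  lift k to ℕ using by have := (Finset.mem_Icc.1 hk).1; omega
  have hk1 : k ≠ 0 := by have := (Finset.mem_Icc.1 hk).1; omega
  simp only [zpow_natCast]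
  have : Continuous fun w : ℂ => (g k : ℂ) * w ^ k := by fun_prop
  exact (this.tendsto' 0 0 (by simp [hk1])).mono_left nhdsWithin_le_nhds

/-- `G` has degree at most `n - 1`, so `w^n (1 - G(w⁻¹))` is a polynomial without constant term.
This is the source of the zero limit for `Φ₁ / Q`. -/
theorem tendsto_pow_mul_G_inv {n : ℕ} (hn : 1 ≤ n) (g : ℤ → ℝ) :
    Tendsto (fun w => w ^ n * (1 - G n g w⁻¹)) (𝓝[≠] 0) (𝓝 0) := by
  have h : Tendsto (fun w : ℂ => w ^ n - ∑ k ∈ Finset.Icc (1 : ℤ) (n - 1), (g k : ℂ) * w ^ (n - k))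
      (𝓝[≠] 0) (𝓝 (0 - ∑ k ∈ Finset.Icc (1 : ℤ) (n - 1), 0)) := by
    refine Tendsto.sub (((continuous_pow n).tendsto' (0 : ℂ) 0
      (zero_pow (by omega))).mono_left nhdsWithin_le_nhds) (tendsto_finsetSum _ fun k hk => ?_)
    obtain ⟨m, hm⟩ := Int.eq_ofNat_of_zero_le (a := n - k) (by
      have := (Finset.mem_Icc.1 hk).2; omega)
    have hm1 : m ≠ 0 := by have := (Finset.mem_Icc.1 hk).2; omega
    simp only [hm, zpow_natCast]
    have : Continuous fun w : ℂ => (g k : ℂ) * w ^ m := by fun_prop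
    exact (this.tendsto' 0 0 (by simp [hm1])).mono_left nhdsWithin_le_nhds
  rw [Finset.sum_const_zero, sub_zero] at h
  refine h.congr' ?_
  filter_upwards [self_mem_nhdsWithin] with w (hw : w ≠ 0)
  rw [G, mul_sub, mul_one, Finset.mul_sum]
  congr 1
  refine Finset.sum_congr rfl fun k _ => ?_
  rw [zpow_sub₀ hw, zpow_natCast, inv_zpow]
  ring

theorem tendsto_pow_mul_theta_inv {q : ℕ} {θ : ℝ[X]} {z : Fin q → ℂ}
    (hθ : ∀ w : ℂ, aeval w θ = ∏ j, (1 - (z j)⁻¹ * w)) :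
    Tendsto (fun w => w ^ q * (aeval w θ * aeval w⁻¹ θ)) (𝓝[≠] 0) (𝓝 (∏ j, -(z j)⁻¹)) := by
  have hcont : Continuous fun w : ℂ => (∏ j, (1 - (z j)⁻¹ * w)) * ∏ j, (w - (z j)⁻¹) := by
    fun_prop
  refine ((hcont.tendsto' 0 (∏ j, -(z j)⁻¹) (by simp)).mono_left nhdsWithin_le_nhds).congr' ?_
  filter_upwards [self_mem_nhdsWithin] with w (hw : w ≠ 0)
  have e : ∏ j, (w - (z j)⁻¹) = w ^ q * ∏ j, (1 - (z j)⁻¹ * w⁻¹) := by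
    rw [← Fin.prod_const q w, ← Finset.prod_mul_distrib]
    refine Finset.prod_congr rfl fun j _ => ?_
    field_simp
  rw [hθ, hθ, e]
  ring

theorem differentiableOn_G (n : ℕ) (g : ℤ → ℝ) : DifferentiableOn ℂ (G n g) {0}ᶜ := by
  unfold G
  refine DifferentiableOn.fun_sum fun k _ w hw => ?_
  exact ((differentiableAt_zpow.2 (Or.inl hw)).const_mul _).differentiableWithinAt

end FGN

/-! ### The theorem -/

theorem theorem2p1
    (d : ℝ) (hd₁ : -(1 / 2) < d) (hd₂ : d < 1 / 2) (hd₀ : d ≠ 0)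
    (q : ℕ) (θ φ : ℝ[X]) (z : Fin q → ℂ)
    -- the MA polynomial, with simple non-zero zeros off the unit circle
    (hθ : ∀ w : ℂ, aeval w θ = ∏ j, (1 - (z j)⁻¹ * w))
    (hz₀ : ∀ j, z j ≠ 0) (hz₁ : ∀ j, ‖z j‖ ≠ 1) (hz : Function.Injective z)
    -- the AR polynomial
    (hφ₀ : φ.coeff 0 = 1) (hφ : ∀ w : ℂ, ‖w‖ ≤ 1 → aeval w φ ≠ 0)
    (hφθ : ∀ j, aeval (z j) φ ≠ 0)
    (n : ℕ) (hn : 1 ≤ n) (g : ℤ → ℝ) (hg : FGN.IsPredictor (FGN.cov d θ φ) n g) :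
    -- the generating functions converge outside the closed unit disk
    (∀ w : ℂ, 1 < ‖w‖ →
      Summable (fun j : ℤ => (FGN.gL (FGN.cov d θ φ) n g j : ℂ) * w ^ j) ∧
      Summable (fun j : ℤ => (FGN.gR (FGN.cov d θ φ) n g (n - j) : ℂ) * w ^ j)) ∧
    ∃ Φ₀ Φ₁ : ℂ → ℂ,
      -- off the unit circle, the cut and the removable singularities, they are given by `G₀`, `G₁`
      (∀ w : ℂ, ‖w‖ ≠ 1 → w ∉ FGN.unitCut → aeval w⁻¹ φ ≠ 0 →
        Φ₀ w = w ^ q * aeval w⁻¹ φ * FGN.G0 d θ φ n g w ∧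
        Φ₁ w = w ^ q * aeval w⁻¹ φ * FGN.G1 d θ φ n g w) ∧
      FGN.SectionallyHolomorphic Φ₀ ∧ FGN.SectionallyHolomorphic Φ₁ ∧
      FGN.JumpCondition d φ n q Φ₀ Φ₁ ∧
      (FGN.GrowthAtOne d Φ₀ ∧ FGN.GrowthAtOne d Φ₁) ∧
      (FGN.GrowthAtInfinity q Φ₀ ∧ FGN.GrowthAtInfinity q Φ₁) ∧
      FGN.AlgebraicCondition d φ n z Φ₀ Φ₁ ∧
      (φ.natDegree ≤ n + q →
        (FGN.GrowthAtZero d Φ₀ ∧ FGN.GrowthAtZero d Φ₁) ∧ FGN.ScalingCondition d z Φ₀ Φ₁) := by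
  obtain ⟨hsum, S₀, S₁, V, hS₀, hS₁, hV, hext, hout, hin⟩ :=
    FGN.exists_functional_equations hd₁ hd₂ hφ hn hg
  set K : ℂ → ℂ := fun w => aeval w θ * aeval w⁻¹ θ * (1 - FGN.G n g w) with hKdef
  have hKdiff : DifferentiableOn ℂ K {0}ᶜ := fun w hw =>
    (((FGN.differentiableAt_aeval θ w).mul (FGN.differentiableAt_aeval_inv θ hw)).mul
      ((differentiableAt_const 1).sub ((FGN.differentiableOn_G n g).differentiableAt
        (FGN.isOpen_compl_zero.mem_nhds hw)))).differentiableWithinAt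
  have H : FGN.IsContinuation d φ n K S₀ S₁ V := ⟨hKdiff, hS₀, hS₁, hV, hφ, hout, hin⟩
  have hθz : ∀ j, aeval (z j) θ = 0 := fun j => by
    rw [hθ]
    exact Finset.prod_eq_zero (Finset.mem_univ j) (by rw [inv_mul_cancel₀ (hz₀ j), sub_self])
  have hK₀ : Tendsto (fun w => w ^ q * K w) (𝓝[≠] 0) (𝓝 (∏ j, -(z j)⁻¹)) := by
    have h := (FGN.tendsto_pow_mul_theta_inv hθ).mul ((FGN.tendsto_G_zero n g).const_sub 1)
    rw [sub_zero, mul_one] at h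
    exact h.congr fun w => mul_assoc _ _ _
  -- The reflected symbol: `w^q θ(w) θ(w⁻¹)` is unchanged by `w ↦ w⁻¹` apart from the power, so its
  -- finite limit is multiplied by one equal to `0`.
  have hK₁ : Tendsto (fun w => w ^ q * (w ^ n * K w⁻¹)) (𝓝[≠] 0) (𝓝 0) := by
    have h := (FGN.tendsto_pow_mul_theta_inv hθ).mul (FGN.tendsto_pow_mul_G_inv hn g)
    rw [mul_zero] at h
    refine h.congr fun w => ?_
    simp only [hKdef, inv_inv]
    ring
  have hle : 𝓝[FGN.halfLineᶜ] (0 : ℂ) ≤ 𝓝[FGN.unitCutᶜ] 0 :=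
    nhdsWithin_mono _ fun w hw => FGN.notMem_unitCut_of_notMem_halfLine hw
  refine ⟨hsum, _, _, fun w hw1 hcut hw => ?_, H.sectionallyHolomorphic_extension hd₁ hd₂ hd₀ q,
    H.reflect.sectionallyHolomorphic_extension hd₁ hd₂ hd₀ q, H.jumpCondition hd₁ hd₂ hd₀ q,
    ⟨H.growthAtOne_extension hd₁ hd₂ q, H.reflect.growthAtOne_extension hd₁ hd₂ q⟩,
    ⟨H.growthAtInfinity_extension q, H.reflect.growthAtInfinity_extension q⟩,
    H.algebraicCondition hd₁ hd₂ hd₀ hz₁ fun j => ⟨by simp [hKdef, hθz], by simp [hKdef, hθz]⟩,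
    fun hdeg => ⟨⟨H.growthAtZero_extension hd₁ hd₂ hd₀ hφ₀ hdeg hK₀,
      H.reflect.growthAtZero_extension hd₁ hd₂ hd₀ hφ₀ hdeg hK₁⟩,
      (H.tendsto_extension_div_Q hd₁ hd₂ hd₀ hφ₀ hdeg hK₀).mono_left hle, ?_⟩⟩
  -- Inside the disk, the representation through `Q` must match the defining formula of `G₀` and
  -- `G₁`, whose last terms use the outer series at `w⁻¹`. Outside, both are the series themselves.
  · have hw0 := FGN.ne_zero_of_notMem_unitCut hcut
    rcases lt_or_gt_of_ne hw1 with h | h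
    · have hn1 := not_lt.2 h.le
      have h' := hext w⁻¹ (FGN.one_lt_norm_inv hw0 h)
      rw [inv_inv] at h'
      have hφw := hφ w h.le
      rw [FGN.G0, FGN.G1, if_neg hn1, if_neg hn1, h'.1, h'.2,
        H.extension_of_norm_lt_one q hw0 h, H.reflect.extension_of_norm_lt_one q hw0 h, FGN.ratio]
      simp only [hKdef, inv_inv]
      generalize aeval w⁻¹ φ = y at hw ⊢
      constructor
      · field_simp
        ring
      · field_simp
        ring
    · rw [FGN.extension, FGN.extension, FGN.G0, FGN.G1, if_pos h, if_pos h, if_pos h, if_pos h,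
        (hext w h).1, (hext w h).2]
      exact ⟨rfl, rfl⟩
  · have h := (H.reflect.tendsto_extension_div_Q hd₁ hd₂ hd₀ hφ₀ hdeg hK₁).mono_left hle
    rwa [mul_zero] at h
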